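/- Let $n$ be a positive integer with $n\neq 2$. Consider diagrams with a top row and a bottom row of $n$ dots, each numbered $1,\dots,n$ from left to right. The partition monoid $\mathfrak C_n$ consists of all set partitions of these $2n$ dots, with the concatenation product $I*J$: put $I$ on top of $J$, identify the bottom row of $I$ with the top row of $J$, join blocks accordingly, and delete the middle row. A set partition is planar if it is noncrossing when the dots are read in the boundary order (top row from left to right, then bottom row from right to left). The Jones monoid $\mathcal J_n$ is the submonoid of all planar set partitions all of whose blocks have exactly two elements. Write $I\preceq J$ if every block of $J$ is a union of blocks of $I$. The planar ramified Jones monoid $\mathcal{PR}(\mathcal J_n)$ is the monoid of all pairs $(I,J)$ with $I\in\mathcal J_n$, $J$ planar and $I\preceq J$, with componentwise concatenation. For $1\le i\le n-1$ let $t_i$ be the set partition with blocks $\{i,i+1\}$ in the top row, $\{i,i+1\}$ in the bottom row, and a vertical line at each $k\notin\{i,i+1\}$; let $h_i$ be the set partition in which the dots $i,i+1$ of both rows form one block of four elements, with a vertical line at each $k\notin\{i,i+1\}$. In $\mathcal{PR}(\mathcal J_n)$ write $t_i=(t_i,t_i)$, $e_i=(1,h_i)$, $f_i=(t_i,h_i)$.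 The tied Temperley–Lieb monoid $\mathrm{tTL}_n$ is the monoid presented by generators $\tau_i,\epsilon_i,\phi_i$ ($1\le i\le n-1$) and the relations, for all indices $i,j$ (subject to the conditions indicated), $$\epsilon_i^2=\epsilon_i,\qquad \epsilon_i\epsilon_j=\epsilon_j\epsilon_i,$$ $$\tau_i^2=\tau_i,\qquad \tau_i\tau_j=\tau_j\tau_i\ (|i-j|>1),\qquad \tau_i\tau_j\tau_i=\tau_i\ (|i-j|=1),$$ $$\phi_i^2=\phi_i,\qquad \phi_i\phi_j=\phi_j\phi_i\ (|i-j|>1),$$ $$\epsilon_i\tau_i=\tau_i\epsilon_i=\tau_i,\qquad \epsilon_i\phi_j=\phi_j\epsilon_i,\qquad \phi_i\epsilon_i=\phi_i,\qquad \tau_i\phi_i=\phi_i\tau_i,$$ $$\epsilon_i\tau_j=\tau_j\epsilon_i,\qquad \phi_i\tau_j=\tau_j\phi_i\qquad(|i-j|>1),$$ $$\tau_i\epsilon_j\tau_i=\tau_i,\qquad \phi_i\epsilon_j=\epsilon_j\phi_i=\epsilon_j\tau_i\epsilon_j\qquad(|i-j|=1).$$ Then the monoids $\mathcal{PR}(\mathcal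 J_n)$ and $\mathrm{tTL}_n$ are isomorphic. Moreover $\mathcal{PR}(\mathcal J_n)$ is presented by the generators $t_i,e_i,f_i$ ($1\le i\le n-1$) subject to the relations above with $\tau_i,\epsilon_i,\phi_i$ replaced by $t_i,e_i,f_i$: these elements generate $\mathcal{PR}(\mathcal J_n)$, and two words in them are equal in $\mathcal{PR}(\mathcal J_n)$ if and only if this follows from these relations. -/

import Mathlib

/-- The `2 * n` dots of a diagram: `Sum.inl i` is the `i`-th dot of the top row and `Sum.inr i` is
the `i`-th dot of the bottom row, both rows being read from left to right. -/
abbrev Dots (n : ℕ) : Type := Fin n ⊕ Fin n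

/-- A set partition of the `2 * n` dots, as an equivalence relation. The refinement order
`I ≤ J` (every block of `J` is a union of blocks of `I`) is the order of `Setoid`. -/
abbrev SetPartition (n : ℕ) : Type := Setoid (Dots n)

/-- Three aligned rows of `n` dots: top, middle and bottom. -/
abbrev ThreeRows (n : ℕ) : Type := Fin n ⊕ (Fin n ⊕ Fin n)

namespace SetPartition

variable {n : ℕ}

/-- The top and middle rows. -/
def upper : Dots n → ThreeRows n := Sum.elim Sum.inl (fun y => Sum.inr (Sum.inl y))

/-- The middle and bottom rows. -/
def lower : Dots n → ThreeRows n := Sum.inr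

/-- The top and bottom rows. -/
def outer : Dots n → ThreeRows n := Sum.elim Sum.inl (fun z => Sum.inr (Sum.inr z))

/-- `I` drawn on the top and middle rows, joined with `J` drawn on the middle and bottom rows. -/
def stack (I J : SetPartition n) : Setoid (ThreeRows n) := I.map upper ⊔ J.map lower

/-- The concatenation product: `I` is put on top of `J` and the middle row is removed. -/
@[reducible] def concat (I J : SetPartition n) : SetPartition n := (stack I J).comap outer

/-- The identity diagram, whose blocks are the `n` vertical lines. -/
@[reducible] def identity (n : ℕ) : SetPartition n := Setoid.ker (Sum.elim id id : Dots n → Fin n)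

theorem stack_le_iff {I J : SetPartition n} {S : Setoid (ThreeRows n)} :
    stack I J ≤ S ↔ I ≤ S.comap upper ∧ J ≤ S.comap lower := by
  constructor
  · intro h
    refine ⟨fun x y hxy => ?_, fun x y hxy => ?_⟩
    · exact h (le_sup_left (a := I.map upper) (Relation.EqvGen.rel _ _ ⟨x, y, hxy, rfl, rfl⟩))
    · exact h (le_sup_right (b := J.map lower) (Relation.EqvGen.rel _ _ ⟨x, y, hxy, rfl, rfl⟩))
  · rintro ⟨h1, h2⟩
    refine sup_le (Setoid.eqvGen_le ?_) (Setoid.eqvGen_le ?_)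
    · rintro _ _ ⟨x, y, hxy, rfl, rfl⟩; exact h1 hxy
    · rintro _ _ ⟨x, y, hxy, rfl, rfl⟩; exact h2 hxy

theorem stack_upper {I J : SetPartition n} {x y : Dots n} (h : I x y) :
    stack I J (upper x) (upper y) := (stack_le_iff.1 le_rfl).1 h

theorem stack_lower {I J : SetPartition n} {x y : Dots n} (h : J x y) :
    stack I J (lower x) (lower y) := (stack_le_iff.1 le_rfl).2 h

theorem eq_of_colourings {I J : SetPartition n}
    (h : ∀ c : Dots n → Prop, I ≤ Setoid.ker c ↔ J ≤ Setoid.ker c) : I = J := by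
  have key : ∀ K : SetPartition n, ∀ x, K ≤ Setoid.ker (fun z => K x z) := by
    intro K x a b hab
    exact propext ⟨fun h => K.trans' h hab, fun h => K.trans' h (K.symm' hab)⟩
  apply le_antisymm
  · intro x y hxy
    have := (h _).2 (key J x) hxy
    exact (show J x x = J x y from this) ▸ J.refl' x
  · intro x y hxy
    have := (h _).1 (key I x) hxy
    exact (show I x x = I x y from this) ▸ I.refl' x

theorem concat_le_ker {I J : SetPartition n} {c : Dots n → Prop} :
    concat I J ≤ Setoid.ker c ↔ ∃ m : Fin n → Prop,
      I ≤ Setoid.ker (Sum.elim (c ∘ Sum.inl) m) ∧ J ≤ Setoid.ker (Sum.elim m (c ∘ Sum.inr)) := by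
  constructor
  · intro h
    let C : ThreeRows n → Prop := fun t => ∃ o, c o ∧ stack I J (outer o) t
    have hC : stack I J ≤ Setoid.ker C := by
      intro s t hst
      refine propext ⟨?_, ?_⟩
      · rintro ⟨o, ho, h1⟩; exact ⟨o, ho, (stack I J).trans' h1 hst⟩
      · rintro ⟨o, ho, h1⟩; exact ⟨o, ho, (stack I J).trans' h1 ((stack I J).symm' hst)⟩
    have hCo : ∀ o, C (outer o) = c o := by
      intro o
      refine propext ⟨?_, fun ho => ⟨o, ho, (stack I J).refl' _⟩⟩
      rintro ⟨o', ho', h1⟩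
      exact (show c o' = c o from h h1) ▸ ho'
    obtain ⟨h1, h2⟩ := stack_le_iff.1 hC
    have e1 : C ∘ upper = Sum.elim (c ∘ Sum.inl) (fun y => C (Sum.inr (Sum.inl y))) := by
      funext x
      rcases x with x | x
      · exact hCo (Sum.inl x)
      · rfl
    have e2 : C ∘ lower = Sum.elim (fun y => C (Sum.inr (Sum.inl y))) (c ∘ Sum.inr) := by
      funext x
      rcases x with x | x
      · rfl
      · exact hCo (Sum.inr x)
    refine ⟨fun y => C (Sum.inr (Sum.inl y)), ?_, ?_⟩
    · rw [← e1]; exact h1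
    · rw [← e2]; exact h2
  · rintro ⟨m, h1, h2⟩
    let C : ThreeRows n → Prop := Sum.elim (c ∘ Sum.inl) (Sum.elim m (c ∘ Sum.inr))
    have hC : stack I J ≤ Setoid.ker C := by
      rw [stack_le_iff]
      refine ⟨fun x y hxy => ?_, fun x y hxy => ?_⟩
      · have := h1 hxy
        rcases x with x | x <;> rcases y with y | y <;> exact this
      · have := h2 hxy
        rcases x with x | x <;> rcases y with y | y <;> exact this
    intro x y hxy
    have := hC hxy
    rcases x with x | x <;> rcases y with y | y <;> exact this

theorem identity_le_ker {c : Dots n → Prop} :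
    identity n ≤ Setoid.ker c ↔ c ∘ Sum.inl = c ∘ Sum.inr := by
  constructor
  · intro h
    funext x
    exact h (show identity n (Sum.inl x) (Sum.inr x) from rfl)
  · intro h x y hxy
    have h' : ∀ x, c (Sum.inl x) = c (Sum.inr x) := fun x => congrFun h x
    rcases x with x | x <;> rcases y with y | y <;>
      (obtain rfl : x = y := hxy) <;> simp [h']

theorem concat_assoc (I J K : SetPartition n) :
    concat (concat I J) K = concat I (concat J K) := by
  apply eq_of_colourings
  intro c
  simp only [concat_le_ker, Sum.elim_comp_inl, Sum.elim_comp_inr]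
  constructor
  · rintro ⟨m, ⟨k, h1, h2⟩, h3⟩; exact ⟨k, h1, m, h2, h3⟩
  · rintro ⟨k, h1, m, h2, h3⟩; exact ⟨m, ⟨k, h1, h2⟩, h3⟩

theorem identity_concat (I : SetPartition n) : concat (identity n) I = I := by
  apply eq_of_colourings
  intro c
  simp only [concat_le_ker, identity_le_ker, Sum.elim_comp_inl, Sum.elim_comp_inr]
  constructor
  · rintro ⟨m, rfl, h⟩; simpa using h
  · intro h; exact ⟨_, rfl, by simpa using h⟩

theorem concat_identity (I : SetPartition n) : concat I (identity n) = I := by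
  apply eq_of_colourings
  intro c
  simp only [concat_le_ker, identity_le_ker, Sum.elim_comp_inl, Sum.elim_comp_inr]
  constructor
  · rintro ⟨m, h, rfl⟩; simpa using h
  · intro h; exact ⟨_, by simpa using h, rfl⟩

/-- The partition monoid: set partitions of the `2 * n` dots under concatenation. -/
instance : Monoid (SetPartition n) where
  mul := concat
  one := identity n
  mul_assoc := concat_assoc
  one_mul := identity_concat
  mul_one := concat_identity

theorem mul_def (I J : SetPartition n) : I * J = concat I J := rfl

theorem one_def : (1 : SetPartition n) = identity n := rfl

theorem mul_mono {I I' J J' : SetPartition n} (h : I ≤ I') (h' : J ≤ J') :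
    I * J ≤ I' * J' := by
  have : stack I J ≤ stack I' J' :=
    stack_le_iff.2 ⟨fun _ _ hxy => stack_upper (h hxy), fun _ _ hxy => stack_lower (h' hxy)⟩
  exact fun _ _ hxy => this hxy

/-- The position of a dot on the boundary of the diagram: the top row is read from left to right
and then the bottom row from right to left. -/
def pos : Dots n → ℕ
  | Sum.inl i => i
  | Sum.inr i => 2 * n - 1 - i

/-- A set partition is planar if its diagram can be drawn without crossings, that is, if it is
noncrossing for the boundary order of the dots. -/
def IsPlanar (I : SetPartition n) : Prop :=
  ∀ a b c d : Dots n, pos a < pos b → pos b < pos c → pos c < pos d → I a c → I b d → I a b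

theorem pos_injective : Function.Injective (pos : Dots n → ℕ) := by
  intro x y h
  rcases x with x | x <;> rcases y with y | y <;> simp only [pos] at h
  · exact congrArg _ (Fin.ext h)
  · omega
  · omega
  · exact congrArg _ (Fin.ext (by omega))

/-- `1` if `p` lies in the same row as `v` and to the left of it, `0` otherwise. -/
def leftOf : Dots n → Dots n → ZMod 2
  | Sum.inl x, Sum.inl y => if x < y then 1 else 0
  | Sum.inr x, Sum.inr y => if x < y then 1 else 0
  | _, _ => 0

theorem leftOf_add (p q v : Dots n) (hp : p ≠ v) (hq : q ≠ v) :
    leftOf p v + leftOf q v =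
      (if pos p < pos v then 1 else 0) + (if pos q < pos v then 1 else 0) := by
  have h2 : (1 : ZMod 2) + 1 = 0 := rfl
  have pl : ∀ i : Fin n, pos (Sum.inl i) = i := fun _ => rfl
  have pr : ∀ i : Fin n, pos (Sum.inr i) = 2 * n - 1 - i := fun _ => rfl
  rcases v with v | v
  · have key : ∀ p : Dots n, leftOf p (Sum.inl v) = if pos p < pos (Sum.inl v) then 1 else 0 := by
      rintro (p | p)
      · rfl
      · rw [if_neg (by rw [pl, pr]; omega)]; rfl
    rw [key, key]
  · have key : ∀ p : Dots n, p ≠ Sum.inr v →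
        leftOf p (Sum.inr v) = 1 + if pos p < pos (Sum.inr v) then 1 else 0 := by
      rintro (p | p) hp
      · rw [if_pos (by rw [pl, pr]; omega), h2]; rfl
      · have : (p : ℕ) ≠ v := fun h => hp (congrArg _ (Fin.ext h))
        by_cases hlt : (p : ℕ) < v
        · rw [if_neg (by rw [pr, pr]; omega), add_zero]; exact if_pos hlt
        · rw [if_pos (by rw [pr, pr]; omega), h2]; exact if_neg hlt
    rw [key p hp, key q hq, add_add_add_comm, h2, zero_add]

/-- The number modulo `2` of the dots to the left of `v` in its row, with weights `α`. -/
def weightLeft (α : Dots n → ZMod 2) (v : Dots n) : ZMod 2 := ∑ p, α p * leftOf p v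

theorem weightLeft_add (α β : Dots n → ZMod 2) (v : Dots n) :
    weightLeft (α + β) v = weightLeft α v + weightLeft β v := by
  simp [weightLeft, add_mul, Finset.sum_add_distrib]

theorem weightLeft_single (p v : Dots n) : weightLeft (Pi.single p 1) v = leftOf p v := by
  simp [weightLeft, Pi.single_apply]

/-- The sum of weights on the two halves of a stack of diagrams. -/
def stackWeight (α β : Dots n → ZMod 2) : ThreeRows n → ZMod 2 :=
  Sum.elim (α ∘ Sum.inl) (Sum.elim (fun y => α (Sum.inr y) + β (Sum.inl y)) (β ∘ Sum.inr))

theorem interleave_aux {p q v w : ℕ} (hpv : p ≠ v) (hqv : q ≠ v) (hpw : p ≠ w) (hqw : q ≠ w)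
    (c1 : p < v → v < q → ¬ q < w) (c2 : p < w → w < q → ¬ q < v)
    (c3 : q < v → v < p → ¬ p < w) (c4 : q < w → w < p → ¬ p < v)
    (c5 : v < p → p < w → ¬ w < q) (c6 : v < q → q < w → ¬ w < p)
    (c7 : w < p → p < v → ¬ v < q) (c8 : w < q → q < v → ¬ v < p) :
    ((if p < v then 1 else 0) + (if q < v then 1 else 0) : ZMod 2) =
      (if p < w then 1 else 0) + (if q < w then 1 else 0) := by
  split_ifs <;> first | rfl | (exfalso; omega)

theorem IsPlanar.weightLeft_pair {I : SetPartition n} (hI : I.IsPlanar) {p q v w : Dots n}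
    (hpq : I p q) (hvw : I v w) (hpv : ¬ I p v) :
    weightLeft (Pi.single p 1 + Pi.single q 1) v = weightLeft (Pi.single p 1 + Pi.single q 1) w := by
  have hpw : ¬ I p w := fun h => hpv (I.trans' h (I.symm' hvw))
  have hqv : ¬ I q v := fun h => hpv (I.trans' hpq h)
  have hqw : ¬ I q w := fun h => hpw (I.trans' hpq h)
  have ne : ∀ {x y}, ¬ I x y → x ≠ y := fun h e => h (e ▸ I.refl' _)
  rw [weightLeft_add, weightLeft_add]
  simp only [weightLeft_single]
  rw [leftOf_add p q v (ne hpv) (ne hqv), leftOf_add p q w (ne hpw) (ne hqw)]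
  have pne : ∀ {x y}, ¬ I x y → pos x ≠ pos y := fun h e => ne h (pos_injective e)
  have hqp := I.symm' hpq
  have hwv := I.symm' hvw
  have sy : ∀ {x y}, ¬ I x y → ¬ I y x := fun h k => h (I.symm' k)
  exact interleave_aux (pne hpv) (pne hqv) (pne hpw) (pne hqw)
    (fun a b c => hpv (hI _ _ _ _ a b c hpq hvw))
    (fun a b c => hpw (hI _ _ _ _ a b c hpq hwv))
    (fun a b c => hqv (hI _ _ _ _ a b c hqp hvw))
    (fun a b c => hqw (hI _ _ _ _ a b c hqp hwv))
    (fun a b c => sy hpv (hI _ _ _ _ a b c hvw hpq))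
    (fun a b c => sy hqv (hI _ _ _ _ a b c hvw hqp))
    (fun a b c => sy hpw (hI _ _ _ _ a b c hwv hpq))
    (fun a b c => sy hqw (hI _ _ _ _ a b c hwv hqp))

theorem exists_weights {I J : SetPartition n} (hI : I.IsPlanar) (hJ : J.IsPlanar)
    (o : ThreeRows n) {a c : ThreeRows n} (hac : stack I J a c) (hoa : stack I J o a) :
    ∃ α β : Dots n → ZMod 2,
      (stackWeight α β = Pi.single a 1 + Pi.single c 1) ∧
      (∀ v w, I v w → ¬ stack I J o (upper v) → weightLeft α v = weightLeft α w) ∧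
      (∀ v w, J v w → ¬ stack I J o (lower v) → weightLeft β v = weightLeft β w) := by
  classical
  have two : ∀ f : ThreeRows n → ZMod 2, f + f = 0 := fun f => by
    funext x; exact CharTwo.add_self_eq_zero _
  have w0 : ∀ v : Dots n, weightLeft 0 v = 0 := fun v => by simp [weightLeft]
  have sw0 : stackWeight (n := n) 0 0 = 0 := by
    funext t; rcases t with t | t | t <;> simp [stackWeight]
  have swadd : ∀ α β α' β' : Dots n → ZMod 2,
      stackWeight (α + α') (β + β') = stackWeight α β + stackWeight α' β' := by
    intro α β α' β'
    funext t
    rcases t with t | t | t <;> simp [stackWeight]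
    abel
  have swu : ∀ p : Dots n, stackWeight (Pi.single p 1) 0 = Pi.single (upper p) 1 := by
    intro p; funext t
    rcases t with t | t | t <;> rcases p with p | p <;>
      simp [stackWeight, upper, Pi.single_apply]
  have swl : ∀ p : Dots n, stackWeight 0 (Pi.single p 1) = Pi.single (lower p) 1 := by
    intro p; funext t
    rcases t with t | t | t <;> rcases p with p | p <;>
      simp [stackWeight, lower, Pi.single_apply]
  let S : Setoid (ThreeRows n) :=
    { r := fun a c => stack I J a c ∧ (stack I J o a → ∃ α β : Dots n → ZMod 2,
        (stackWeight α β = Pi.single a 1 + Pi.single c 1) ∧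
        (∀ v w, I v w → ¬ stack I J o (upper v) → weightLeft α v = weightLeft α w) ∧
        (∀ v w, J v w → ¬ stack I J o (lower v) → weightLeft β v = weightLeft β w))
      iseqv := by
        refine ⟨fun a => ⟨(stack I J).refl' a, fun _ => ⟨0, 0, ?_, ?_, ?_⟩⟩, ?_, ?_⟩
        · rw [sw0, two]
        · intros; rw [w0, w0]
        · intros; rw [w0, w0]
        · rintro a c ⟨h, h'⟩
          refine ⟨(stack I J).symm' h, fun hc => ?_⟩
          obtain ⟨α, β, h1, h2, h3⟩ := h' ((stack I J).trans' hc ((stack I J).symm' h))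
          exact ⟨α, β, by rw [h1, add_comm], h2, h3⟩
        · rintro a b c ⟨h, h'⟩ ⟨k, k'⟩
          refine ⟨(stack I J).trans' h k, fun ha => ?_⟩
          obtain ⟨α, β, h1, h2, h3⟩ := h' ha
          obtain ⟨α', β', k1, k2, k3⟩ := k' ((stack I J).trans' ha h)
          refine ⟨α + α', β + β', ?_, ?_, ?_⟩
          · rw [swadd, h1, k1, add_assoc, ← add_assoc (Pi.single b 1), two, zero_add]
          · intro v w hvw hv
            rw [weightLeft_add, weightLeft_add, h2 v w hvw hv, k2 v w hvw hv]
          · intro v w hvw hv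
            rw [weightLeft_add, weightLeft_add, h3 v w hvw hv, k3 v w hvw hv] }
  have hS : stack I J ≤ S := by
    rw [stack_le_iff]
    constructor
    · intro p q hpq
      refine ⟨stack_upper hpq, fun hp => ⟨Pi.single p 1 + Pi.single q 1, 0, ?_, ?_, ?_⟩⟩
      · rw [← add_zero (0 : Dots n → ZMod 2), swadd, swu, swu]
      · intro v w hvw hv
        exact hI.weightLeft_pair hpq hvw
          fun h => hv ((stack I J).trans' hp (stack_upper h))
      · intros; rw [w0, w0]
    · intro p q hpq
      refine ⟨stack_lower hpq, fun hp => ⟨0, Pi.single p 1 + Pi.single q 1, ?_, ?_, ?_⟩⟩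
      · rw [← add_zero (0 : Dots n → ZMod 2), swadd, swl, swl]
      · intros; rw [w0, w0]
      · intro v w hvw hv
        exact hJ.weightLeft_pair hpq hvw
          fun h => hv ((stack I J).trans' hp (stack_lower h))
  exact (hS hac).2 hoa

theorem IsPlanar.mul {I J : SetPartition n} (hI : I.IsPlanar) (hJ : J.IsPlanar) :
    (I * J).IsPlanar := by
  classical
  intro a b c d hab hbc hcd hac hbd
  by_contra hnab
  obtain ⟨α, β, h1, h2, h3⟩ := exists_weights hI hJ (outer a) hac ((stack I J).refl' _)
  let σ : ThreeRows n → ZMod 2 := Sum.elim (fun x => weightLeft α (Sum.inl x))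
    (Sum.elim (fun y => weightLeft α (Sum.inr y)) (fun z => weightLeft β (Sum.inr z)))
  have hmid : ∀ y : Fin n, α (Sum.inr y) = β (Sum.inl y) := by
    intro y
    have := congrFun h1 (Sum.inr (Sum.inl y))
    have e : ∀ o : Dots n, (Pi.single (outer o) 1 : ThreeRows n → ZMod 2) (Sum.inr (Sum.inl y)) = 0 := by
      rintro (o | o) <;> simp [outer]
    simp only [Pi.add_apply, e, stackWeight, Sum.elim_inl, Sum.elim_inr, add_zero] at this
    exact CharTwo.add_eq_zero.1 this
  have hσu : ∀ v, σ (upper v) = weightLeft α v := by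
    rintro (v | v) <;> rfl
  have hσl : ∀ v, σ (lower v) = weightLeft β v := by
    rintro (v | v)
    · simp [σ, lower, weightLeft, leftOf, Fintype.sum_sum_type, hmid]
    · rfl
  have hσo : ∀ v, σ (outer v) = leftOf a v + leftOf c v := by
    have e : ∀ v, weightLeft (Pi.single a 1 + Pi.single c 1) v = leftOf a v + leftOf c v := by
      intro v; rw [weightLeft_add, weightLeft_single, weightLeft_single]
    have s1 : ∀ (o : Dots n) x, (Pi.single (outer o) 1 : ThreeRows n → ZMod 2) (Sum.inl x)
        = (Pi.single o 1 : Dots n → ZMod 2) (Sum.inl x) := by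
      rintro (o | o) x <;> simp [outer, Pi.single_apply]
    have s2 : ∀ (o : Dots n) x, (Pi.single (outer o) 1 : ThreeRows n → ZMod 2) (Sum.inr (Sum.inr x))
        = (Pi.single o 1 : Dots n → ZMod 2) (Sum.inr x) := by
      rintro (o | o) x <;> simp [outer, Pi.single_apply]
    rintro (v | v)
    · rw [← e]
      have : ∀ x, α (Sum.inl x) = (Pi.single a 1 + Pi.single c 1 : Dots n → ZMod 2) (Sum.inl x) := by
        intro x
        have := congrFun h1 (Sum.inl x)
        simpa only [stackWeight, Sum.elim_inl, Function.comp, Pi.add_apply, s1] using this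
      simp only [σ, outer, weightLeft, leftOf, Fintype.sum_sum_type, this, Sum.elim_inl, mul_zero,
        Finset.sum_const_zero]
    · rw [← e]
      have : ∀ x, β (Sum.inr x) = (Pi.single a 1 + Pi.single c 1 : Dots n → ZMod 2) (Sum.inr x) := by
        intro x
        have := congrFun h1 (Sum.inr (Sum.inr x))
        simpa only [stackWeight, Sum.elim_inr, Function.comp, Pi.add_apply, s2] using this
      simp only [σ, outer, weightLeft, leftOf, Fintype.sum_sum_type, this, Sum.elim_inr, mul_zero,
        Finset.sum_const_zero]
  let F : ThreeRows n → Option (ZMod 2) := fun t => if stack I J (outer a) t then none else some (σ t)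
  have hF : stack I J ≤ Setoid.ker F := by
    have hiff : ∀ s t, stack I J s t → (stack I J (outer a) s ↔ stack I J (outer a) t) :=
      fun s t h => ⟨fun k => (stack I J).trans' k h,
        fun k => (stack I J).trans' k ((stack I J).symm' h)⟩
    rw [stack_le_iff]
    constructor
    · intro v w hvw
      show F (upper v) = F (upper w)
      by_cases hv : stack I J (outer a) (upper v)
      · simp only [F, if_pos hv, if_pos ((hiff _ _ (stack_upper hvw)).1 hv)]
      · simp only [F, if_neg hv, if_neg (fun k => hv ((hiff _ _ (stack_upper hvw)).2 k)), hσu,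
          h2 v w hvw hv]
    · intro v w hvw
      show F (lower v) = F (lower w)
      by_cases hv : stack I J (outer a) (lower v)
      · simp only [F, if_pos hv, if_pos ((hiff _ _ (stack_lower hvw)).1 hv)]
      · simp only [F, if_neg hv, if_neg (fun k => hv ((hiff _ _ (stack_lower hvw)).2 k)), hσl,
          h3 v w hvw hv]
  have hnb : ¬ stack I J (outer a) (outer b) := hnab
  have hnd : ¬ stack I J (outer a) (outer d) :=
    fun h => hnb ((stack I J).trans' h ((stack I J).symm' hbd))
  have := hF hbd
  have this : F (outer b) = F (outer d) := this
  simp only [F, if_neg hnb, if_neg hnd, hσo, Option.some.injEq] at this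
  have ne : ∀ {x y : Dots n}, pos x ≠ pos y → x ≠ y := fun h e => h (congrArg _ e)
  rw [leftOf_add a c b (ne (by omega)) (ne (by omega)),
    leftOf_add a c d (ne (by omega)) (ne (by omega)), if_pos (by omega), if_neg (by omega),
    if_pos (by omega), if_pos (by omega)] at this
  exact absurd this (by decide)

theorem isPlanar_one : (1 : SetPartition n).IsPlanar := by
  intro a b c d hab hbc hcd hac hbd
  have hac : (Sum.elim id id a : Fin n) = Sum.elim id id c := hac
  have hbd : (Sum.elim id id b : Fin n) = Sum.elim id id d := hbd
  rcases a with a | a <;> rcases b with b | b <;> rcases c with c | c <;> rcases d with d | d <;>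
    simp only [Sum.elim_inl, Sum.elim_inr, id, pos, Fin.ext_iff] at * <;> omega

/-- Every block has exactly two elements. -/
def IsPairing (I : SetPartition n) : Prop := ∀ B ∈ I.classes, B.ncard = 2

theorem IsPairing.exists_partner {I : SetPartition n} (hI : I.IsPairing) :
    ∃ f : Dots n → Dots n, (∀ x y, I x y ↔ y = x ∨ y = f x) ∧ (∀ x, f x ≠ x) ∧
      ∀ x, f (f x) = x := by
  have h : ∀ x, ∃ y, y ≠ x ∧ ∀ z, I x z ↔ z = x ∨ z = y := by
    intro x
    obtain ⟨u, v, huv, he⟩ := Set.ncard_eq_two.1 (hI _ (I.mem_classes x))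
    have hm : ∀ z, I z x ↔ z = u ∨ z = v := fun z => by
      have : z ∈ {z | I z x} ↔ z ∈ ({u, v} : Set (Dots n)) := by rw [he]
      simpa using this
    rcases (hm x).1 (I.refl' x) with rfl | rfl
    · exact ⟨v, huv.symm, fun z => ⟨fun k => (hm z).1 (I.symm' k), fun k => I.symm' ((hm z).2 k)⟩⟩
    · exact ⟨u, huv, fun z => ⟨fun k => ((hm z).1 (I.symm' k)).symm,
        fun k => I.symm' ((hm z).2 k.symm)⟩⟩
  choose f hf hf' using h
  refine ⟨f, hf', hf, fun x => ?_⟩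
  have h1 : I (f x) x := I.symm' ((hf' x _).2 (Or.inr rfl))
  exact (((hf' _ _).1 h1).resolve_left (hf x).symm).symm

theorem isPairing_of_partner {I : SetPartition n}
    (h : ∀ x, ∃ y, y ≠ x ∧ ∀ z, I x z ↔ z = x ∨ z = y) : I.IsPairing := by
  rintro _ ⟨x, rfl⟩
  obtain ⟨y, hy, hz⟩ := h x
  have : {z | I z x} = {x, y} := by
    ext z
    have : I z x ↔ I x z := ⟨fun k => I.symm' k, fun k => I.symm' k⟩
    simp [this, hz]
  rw [this]
  exact Set.ncard_pair hy.symm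

theorem upper_injective : Function.Injective (upper : Dots n → ThreeRows n) := by
  rintro (x | x) (y | y) h <;> simp_all [upper]

theorem lower_injective : Function.Injective (lower : Dots n → ThreeRows n) :=
  Sum.inr_injective

theorem outer_injective : Function.Injective (outer : Dots n → ThreeRows n) := by
  rintro (x | x) (y | y) h <;> simp_all [outer]

/-- One step along a component of a stack of two pairings with partner functions `f` and `g`;
the Boolean tells whether the next step is taken in the upper diagram. -/
inductive Step (f g : Dots n → Dots n) : ThreeRows n × Bool → ThreeRows n × Bool → Prop
  | up (p : Dots n) : Step f g (upper p, true) (upper (f p), false)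
  | down (p : Dots n) : Step f g (lower p, false) (lower (g p), true)

theorem step_rightUnique (f g : Dots n → Dots n) : Relator.RightUnique (Step f g) := by
  intro s t u h k
  obtain ⟨s, b⟩ := s
  obtain ⟨t, c⟩ := t
  obtain ⟨u, d⟩ := u
  cases b
  · obtain ⟨p, rfl, rfl, rfl⟩ : ∃ p, s = lower p ∧ t = lower (g p) ∧ c = true := by
      cases h; exact ⟨_, rfl, rfl, rfl⟩
    obtain ⟨q, hq, rfl, rfl⟩ : ∃ q, lower p = lower q ∧ u = lower (g q) ∧ d = true := by
      generalize lower p = s at k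
      cases k; exact ⟨_, rfl, rfl, rfl⟩
    rw [lower_injective hq]
  · obtain ⟨p, rfl, rfl, rfl⟩ : ∃ p, s = upper p ∧ t = upper (f p) ∧ c = false := by
      cases h; exact ⟨_, rfl, rfl, rfl⟩
    obtain ⟨q, hq, rfl, rfl⟩ : ∃ q, upper p = upper q ∧ u = upper (f q) ∧ d = false := by
      generalize upper p = s at k
      cases k; exact ⟨_, rfl, rfl, rfl⟩
    rw [upper_injective hq]

theorem step_true {f g : Dots n → Dots n} {t : ThreeRows n} {s} (h : Step f g (t, true) s) :
    ∃ p, t = upper p ∧ s = (upper (f p), false) := by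
  cases h; exact ⟨_, rfl, rfl⟩

theorem step_false {f g : Dots n → Dots n} {t : ThreeRows n} {s} (h : Step f g (t, false) s) :
    ∃ p, t = lower p ∧ s = (lower (g p), true) := by
  cases h; exact ⟨_, rfl, rfl⟩

theorem step_to_true {f g : Dots n → Dots n} {t : ThreeRows n} {s} (h : Step f g s (t, true)) :
    ∃ p, s = (lower p, false) ∧ t = lower (g p) := by
  cases h; exact ⟨_, rfl, rfl⟩

theorem step_to_false {f g : Dots n → Dots n} {t : ThreeRows n} {s} (h : Step f g s (t, false)) :
    ∃ p, s = (upper p, true) ∧ t = upper (f p) := by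
  cases h; exact ⟨_, rfl, rfl⟩

theorem even_component {I J : SetPartition n} {f g : Dots n → Dots n}
    (hf : ∀ x y, I x y ↔ y = x ∨ y = f x) (hf' : ∀ x, f x ≠ x) (hff : ∀ x, f (f x) = x)
    (hg : ∀ x y, J x y ↔ y = x ∨ y = g x) (hg' : ∀ x, g x ≠ x) (hgg : ∀ x, g (g x) = x)
    (a : Dots n) : ∃ b, b ≠ a ∧ (I * J) a b := by
  classical
  by_contra! hcon
  let χ : ThreeRows n → ZMod 2 := fun t => if stack I J (outer a) t then 1 else 0
  have hiff : ∀ s t, stack I J s t → χ s = χ t := fun s t h => by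
    have : stack I J (outer a) s ↔ stack I J (outer a) t :=
      ⟨fun k => (stack I J).trans' k h, fun k => (stack I J).trans' k ((stack I J).symm' h)⟩
    simp only [χ, this]
  have two : ∀ z : ZMod 2, z + z = 0 := CharTwo.add_self_eq_zero
  have hu : ∑ x : Dots n, χ (upper x) = 0 := by
    refine Finset.sum_involution (fun x _ => f x) ?_ ?_ ?_ ?_
    · intro x _
      rw [← hiff _ _ (stack_upper ((hf x _).2 (Or.inr rfl))), two]
    · intro x _ _; exact hf' x
    · intro x _; exact Finset.mem_univ _
    · intro x _; exact hff x
  have hl : ∑ x : Dots n, χ (lower x) = 0 := by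
    refine Finset.sum_involution (fun x _ => g x) ?_ ?_ ?_ ?_
    · intro x _
      rw [← hiff _ _ (stack_lower ((hg x _).2 (Or.inr rfl))), two]
    · intro x _ _; exact hg' x
    · intro x _; exact Finset.mem_univ _
    · intro x _; exact hgg x
  have ho : ∑ x : Dots n, χ (outer x) = 1 := by
    rw [Finset.sum_eq_single a]
    · exact if_pos ((stack I J).refl' _)
    · intro b _ hb; exact if_neg (hcon b hb)
    · intro h; exact absurd (Finset.mem_univ _) h
  rw [Fintype.sum_sum_type] at hu hl ho
  simp only [upper, lower, outer, Sum.elim_inl, Sum.elim_inr] at hu hl ho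
  have : (1 : ZMod 2) = 0 := by
    rw [← ho]
    linear_combination hu + hl - two (∑ y : Fin n, χ (Sum.inr (Sum.inl y)))
  exact absurd this (by decide)

theorem IsPairing.mul {I J : SetPartition n} (hI : I.IsPairing) (hJ : J.IsPairing) :
    (I * J).IsPairing := by
  obtain ⟨f, hf, hf', hff⟩ := hI.exists_partner
  obtain ⟨g, hg, hg', hgg⟩ := hJ.exists_partner
  apply isPairing_of_partner
  intro a
  obtain ⟨b, hba, hab⟩ := even_component hf hf' hff hg hg' hgg a
  refine ⟨b, hba, fun z => ⟨fun haz => ?_, ?_⟩⟩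
  swap
  · rintro (rfl | rfl)
    · exact (I * J).refl' _
    · exact hab
  let s₀ : ThreeRows n × Bool := (outer a, a.isLeft)
  let C : ThreeRows n → Prop := fun t => ∃ c, Relation.ReflTransGen (Step f g) s₀ (t, c)
  have hCu : ∀ p, C (upper p) → C (upper (f p)) := by
    rintro p ⟨c, hc⟩
    cases c
    · rcases Relation.ReflTransGen.cases_tail hc with h0 | ⟨u, hu, hs⟩
      · exfalso
        rcases a with a | a <;> rcases p with p | p <;> simp [s₀, outer, upper] at h0
      · obtain ⟨q, rfl, hq⟩ := step_to_false hs
        have : f p = q := by rw [upper_injective hq, hff]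
        exact ⟨_, this ▸ hu⟩
    · exact ⟨_, hc.tail (Step.up p)⟩
  have hCl : ∀ p, C (lower p) → C (lower (g p)) := by
    rintro p ⟨c, hc⟩
    cases c
    · exact ⟨_, hc.tail (Step.down p)⟩
    · rcases Relation.ReflTransGen.cases_tail hc with h0 | ⟨u, hu, hs⟩
      · exfalso
        rcases a with a | a <;> rcases p with p | p <;> simp [s₀, outer, lower] at h0
      · obtain ⟨q, rfl, hq⟩ := step_to_true hs
        have : g p = q := by rw [lower_injective hq, hgg]
        exact ⟨_, this ▸ hu⟩
  have hC : stack I J ≤ Setoid.ker C := by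
    rw [stack_le_iff]
    constructor
    · intro x y hxy
      rcases (hf x y).1 hxy with rfl | rfl
      · rfl
      · exact propext ⟨hCu x, fun h => by have := hCu _ h; rwa [hff] at this⟩
    · intro x y hxy
      rcases (hg x y).1 hxy with rfl | rfl
      · rfl
      · exact propext ⟨hCl x, fun h => by have := hCl _ h; rwa [hgg] at this⟩
  have hreach : ∀ o, (I * J) a o → ∃ c, Relation.ReflTransGen (Step f g) s₀ (outer o, c) :=
    fun o ho => (show C (outer a) = C (outer o) from hC ho).mp ⟨_, Relation.ReflTransGen.refl⟩
  have hterm : ∀ o c, o ≠ a → Relation.ReflTransGen (Step f g) s₀ (outer o, c) →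
      ∀ s, ¬ Step f g (outer o, c) s := by
    intro o c hoa hr s hs
    rcases Relation.ReflTransGen.cases_tail hr with h0 | ⟨u, hu, hs'⟩
    · exact hoa (outer_injective (congrArg Prod.fst h0))
    · cases c
      · obtain ⟨q, -, hq⟩ := step_to_false hs'
        obtain ⟨p, hp, -⟩ := step_false hs
        rcases o with o | o
        · simp [outer, lower] at hp
        · rcases h : f q with q' | q' <;> simp [outer, upper, h] at hq
      · obtain ⟨q, -, hq⟩ := step_to_true hs'
        obtain ⟨p, hp, -⟩ := step_true hs
        rcases o with o | o
        · simp [outer, lower] at hq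
        · rcases p with p | p <;> simp [outer, upper] at hp
  by_cases hza : z = a
  · exact Or.inl hza
  right
  obtain ⟨c, hc⟩ := hreach z haz
  obtain ⟨d, hd⟩ := hreach b hab
  rcases Relation.ReflTransGen.total_of_right_unique (step_rightUnique f g) hc hd with h | h
  · rcases Relation.ReflTransGen.cases_head h with h0 | ⟨u, hu, -⟩
    · exact outer_injective (congrArg Prod.fst h0)
    · exact absurd hu (hterm z c hza hc u)
  · rcases Relation.ReflTransGen.cases_head h with h0 | ⟨u, hu, -⟩
    · exact (outer_injective (congrArg Prod.fst h0)).symm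
    · exact absurd hu (hterm b d hba hd u)

theorem isPairing_one : (1 : SetPartition n).IsPairing := by
  apply isPairing_of_partner
  have e : ∀ x y : Dots n, (1 : SetPartition n) x y ↔
      (Sum.elim id id x : Fin n) = Sum.elim id id y := fun _ _ => Iff.rfl
  intro x
  refine ⟨x.swap, ?_, fun z => ?_⟩
  · rcases x with x | x <;> simp
  · rw [e]
    rcases x with x | x <;> rcases z with z | z <;> simp [eq_comm]

end SetPartition

open SetPartition

/-- The planar partition monoid: all planar set partitions of the `2 * n` dots. -/
def planarPartitionMonoid (n : ℕ) : Submonoid (SetPartition n) where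
  carrier := {I | I.IsPlanar}
  mul_mem' := IsPlanar.mul
  one_mem' := isPlanar_one

/-- The Jones monoid: all planar set partitions whose blocks have exactly two elements. -/
def jonesMonoid (n : ℕ) : Submonoid (SetPartition n) where
  carrier := {I | I.IsPlanar ∧ I.IsPairing}
  mul_mem' h h' := ⟨h.1.mul h'.1, h.2.mul h'.2⟩
  one_mem' := ⟨isPlanar_one, isPairing_one⟩

/-- The planar ramified monoid of a submonoid `M` of the partition monoid: the pairs `(I, J)` with
`I ∈ M`, `J` planar and `I ≤ J`, multiplied componentwise. -/
def planarRamifiedMonoid {n : ℕ} (M : Submonoid (SetPartition n)) :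
    Submonoid (SetPartition n × SetPartition n) where
  carrier := {p | p.1 ∈ M ∧ p.2 ∈ planarPartitionMonoid n ∧ p.1 ≤ p.2}
  mul_mem' h h' := ⟨M.mul_mem h.1 h'.1, (planarPartitionMonoid n).mul_mem h.2.1 h'.2.1,
    mul_mono h.2.2 h'.2.2⟩
  one_mem' := ⟨M.one_mem, (planarPartitionMonoid n).one_mem, le_rfl⟩

/-- The colouring of the dots whose colour classes are the blocks of `tangle i`. -/
def tangleColour {n : ℕ} (i : Fin (n - 1)) : Dots n → ℕ ⊕ Bool
  | Sum.inl k => if (k : ℕ) = i ∨ (k : ℕ) = i + 1 then Sum.inr true else Sum.inl k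
  | Sum.inr k => if (k : ℕ) = i ∨ (k : ℕ) = i + 1 then Sum.inr false else Sum.inl k

/-- The tangle `t_i`: the dots `i`, `i + 1` of the top row form a block, so do the dots `i`, `i + 1`
of the bottom row, and the other blocks are vertical lines. -/
@[reducible] def tangle {n : ℕ} (i : Fin (n - 1)) : SetPartition n := Setoid.ker (tangleColour i)

/-- The colouring of the dots whose colour classes are the blocks of `joiner i`. -/
def joinerColour {n : ℕ} (i : Fin (n - 1)) : Dots n → ℕ
  | Sum.inl k => if (k : ℕ) = i + 1 then i else k
  | Sum.inr k => if (k : ℕ) = i + 1 then i else k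

/-- The set partition `h_i`: the dots `i`, `i + 1` of both rows form one block with four elements,
and the other blocks are vertical lines. -/
@[reducible] def joiner {n : ℕ} (i : Fin (n - 1)) : SetPartition n := Setoid.ker (joinerColour i)

theorem tangle_le_joiner {n : ℕ} (i : Fin (n - 1)) : tangle i ≤ joiner i := by
  intro x y h
  have h : tangleColour i x = tangleColour i y := h
  show joinerColour i x = joinerColour i y
  rcases x with x | x <;> rcases y with y | y <;> simp only [tangleColour, joinerColour] at h ⊢ <;>
    split_ifs at h ⊢ <;> simp at h <;> omega

theorem joiner_isPlanar {n : ℕ} (i : Fin (n - 1)) : (joiner i).IsPlanar := by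
  intro a b c d hab hbc hcd hac hbd
  have hac : joinerColour i a = joinerColour i c := hac
  have hbd : joinerColour i b = joinerColour i d := hbd
  show joinerColour i a = joinerColour i b
  rcases a with a | a <;> rcases b with b | b <;> rcases c with c | c <;> rcases d with d | d <;>
    simp only [joinerColour, pos] at * <;> split_ifs at * <;> omega

theorem tangle_isPlanar {n : ℕ} (i : Fin (n - 1)) : (tangle i).IsPlanar := by
  intro a b c d hab hbc hcd hac hbd
  have hac : tangleColour i a = tangleColour i c := hac
  have hbd : tangleColour i b = tangleColour i d := hbd
  show tangleColour i a = tangleColour i b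
  rcases a with a | a <;> rcases b with b | b <;> rcases c with c | c <;> rcases d with d | d <;>
    simp only [tangleColour, pos] at * <;> split_ifs at * <;> simp at hac hbd ⊢ <;> omega

theorem tangle_isPairing {n : ℕ} (i : Fin (n - 1)) : (tangle i).IsPairing := by
  apply isPairing_of_partner
  have hi : (i : ℕ) + 1 < n := by omega
  intro x
  have e : ∀ z, tangle i x z ↔ tangleColour i x = tangleColour i z := fun _ => Iff.rfl
  rcases x with x | x
  · by_cases h0 : (x : ℕ) = i
    · refine ⟨Sum.inl ⟨i + 1, hi⟩, ?_, fun z => ?_⟩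
      · simp [Fin.ext_iff]; omega
      · rw [e]
        rcases z with z | z <;> simp only [tangleColour] <;> split_ifs <;>
          simp [Fin.ext_iff] <;> omega
    · by_cases h1 : (x : ℕ) = i + 1
      · refine ⟨Sum.inl ⟨i, by omega⟩, ?_, fun z => ?_⟩
        · simp [Fin.ext_iff]; omega
        · rw [e]
          rcases z with z | z <;> simp only [tangleColour] <;> split_ifs <;>
            simp [Fin.ext_iff] <;> omega
      · refine ⟨Sum.inr x, by simp, fun z => ?_⟩
        rw [e]
        rcases z with z | z <;> simp only [tangleColour] <;> split_ifs <;>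
          simp [Fin.ext_iff] <;> omega
  · by_cases h0 : (x : ℕ) = i
    · refine ⟨Sum.inr ⟨i + 1, hi⟩, ?_, fun z => ?_⟩
      · simp [Fin.ext_iff]; omega
      · rw [e]
        rcases z with z | z <;> simp only [tangleColour] <;> split_ifs <;>
          simp [Fin.ext_iff] <;> omega
    · by_cases h1 : (x : ℕ) = i + 1
      · refine ⟨Sum.inr ⟨i, by omega⟩, ?_, fun z => ?_⟩
        · simp [Fin.ext_iff]; omega
        · rw [e]
          rcases z with z | z <;> simp only [tangleColour] <;> split_ifs <;>
            simp [Fin.ext_iff] <;> omega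
      · refine ⟨Sum.inl x, by simp, fun z => ?_⟩
        rw [e]
        rcases z with z | z <;> simp only [tangleColour] <;> split_ifs <;>
          simp [Fin.ext_iff] <;> omega

theorem one_le_joiner {n : ℕ} (i : Fin (n - 1)) : 1 ≤ joiner i := by
  intro x y h
  have h : (Sum.elim id id x : Fin n) = Sum.elim id id y := h
  show joinerColour i x = joinerColour i y
  rcases x with x | x <;> rcases y with y | y <;> (obtain rfl : x = y := h) <;> rfl

/-- The generators of the tied Temperley-Lieb monoid: `t i`, `e i` and `f i` stand for the
generators usually written `τ_i`, `ε_i` and `φ_i`. -/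
inductive TiedGenerator (n : ℕ) : Type
  | t (i : Fin (n - 1))
  | e (i : Fin (n - 1))
  | f (i : Fin (n - 1))

namespace TiedGenerator

/-- The letter `t i` in the free monoid. -/
def τ {n : ℕ} (i : Fin (n - 1)) : FreeMonoid (TiedGenerator n) := FreeMonoid.of (t i)

/-- The letter `e i` in the free monoid. -/
def ε {n : ℕ} (i : Fin (n - 1)) : FreeMonoid (TiedGenerator n) := FreeMonoid.of (e i)

/-- The letter `f i` in the free monoid. -/
def φ {n : ℕ} (i : Fin (n - 1)) : FreeMonoid (TiedGenerator n) := FreeMonoid.of (f i)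

end TiedGenerator

open TiedGenerator in
/-- The defining relations of the tied Temperley-Lieb monoid. -/
inductive TiedRelation (n : ℕ) :
    FreeMonoid (TiedGenerator n) → FreeMonoid (TiedGenerator n) → Prop
  | ε_sq (i : Fin (n - 1)) : TiedRelation n (ε i * ε i) (ε i)
  | ε_comm (i j : Fin (n - 1)) : TiedRelation n (ε i * ε j) (ε j * ε i)
  | τ_sq (i : Fin (n - 1)) : TiedRelation n (τ i * τ i) (τ i)
  | τ_comm (i j : Fin (n - 1)) (h : 1 < |(i : ℤ) - (j : ℤ)|) : TiedRelation n (τ i * τ j) (τ j * τ i)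
  | τ_τ_τ (i j : Fin (n - 1)) (h : |(i : ℤ) - (j : ℤ)| = 1) : TiedRelation n (τ i * τ j * τ i) (τ i)
  | φ_sq (i : Fin (n - 1)) : TiedRelation n (φ i * φ i) (φ i)
  | φ_comm (i j : Fin (n - 1)) (h : 1 < |(i : ℤ) - (j : ℤ)|) : TiedRelation n (φ i * φ j) (φ j * φ i)
  | ε_τ_self (i : Fin (n - 1)) : TiedRelation n (ε i * τ i) (τ i)
  | τ_ε_self (i : Fin (n - 1)) : TiedRelation n (τ i * ε i) (τ i)
  | ε_φ_comm (i j : Fin (n - 1)) : TiedRelation n (ε i * φ j) (φ j * ε i)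
  | φ_ε_self (i : Fin (n - 1)) : TiedRelation n (φ i * ε i) (φ i)
  | τ_φ_self (i : Fin (n - 1)) : TiedRelation n (τ i * φ i) (φ i * τ i)
  | ε_τ_comm (i j : Fin (n - 1)) (h : 1 < |(i : ℤ) - (j : ℤ)|) : TiedRelation n (ε i * τ j) (τ j * ε i)
  | φ_τ_comm (i j : Fin (n - 1)) (h : 1 < |(i : ℤ) - (j : ℤ)|) : TiedRelation n (φ i * τ j) (τ j * φ i)
  | τ_ε_τ (i j : Fin (n - 1)) (h : |(i : ℤ) - (j : ℤ)| = 1) : TiedRelation n (τ i * ε j * τ i) (τ i)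
  | φ_ε_adj (i j : Fin (n - 1)) (h : |(i : ℤ) - (j : ℤ)| = 1) : TiedRelation n (φ i * ε j) (ε j * φ i)
  | ε_τ_ε (i j : Fin (n - 1)) (h : |(i : ℤ) - (j : ℤ)| = 1) : TiedRelation n (ε j * φ i) (ε j * τ i * ε j)

/-- The tied Temperley-Lieb monoid, defined by generators and relations. -/
abbrev TiedTemperleyLieb (n : ℕ) : Type := PresentedMonoid (TiedRelation n)

/-- The generators of the planar ramified Jones monoid: `t_i = (t_i, t_i)`, `e_i = (1, h_i)` and
`f_i = (t_i, h_i)`. -/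
def ramifiedGenerator {n : ℕ} : TiedGenerator n → planarRamifiedMonoid (jonesMonoid n)
  | .t i => ⟨(tangle i, tangle i), ⟨tangle_isPlanar i, tangle_isPairing i⟩,
      tangle_isPlanar i, le_rfl⟩
  | .e i => ⟨(1, joiner i), (jonesMonoid n).one_mem, joiner_isPlanar i, one_le_joiner i⟩
  | .f i => ⟨(tangle i, joiner i), ⟨tangle_isPlanar i, tangle_isPairing i⟩,
      joiner_isPlanar i, tangle_le_joiner i⟩

/-- The monoid `M` is presented by the generators `g x` subject to the relations `R`: the `g x`
generate `M`, and two words in them are equal in `M` precisely when this follows from `R`. -/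
def IsPresentedBy {X M : Type} [Monoid M] (g : X → M)
    (R : FreeMonoid X → FreeMonoid X → Prop) : Prop :=
  Function.Surjective (FreeMonoid.lift g) ∧ Con.ker (FreeMonoid.lift g) = conGen R

/-!
The generators satisfy the tied Temperley-Lieb relations, which gives a homomorphism `eval` from
the presented monoid to the planar ramified Jones monoid. It has to be shown injective and
surjective. Identities between diagrams are checked on the two-colourings of the dots which are
constant on blocks: a set partition is determined by them, and those of a product are obtained by
choosing a colouring of the middle row.

*Injectivity* (`n ≥ 3`). Let `A s` be the submonoid generated by the letters of index less than `s`
(`tower n s`); `eval` is shown to be injective on `A s` by induction on `s`. As in the theory of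
the Temperley-Lieb algebras, a word can be rewritten so that its largest index occurs at most once
(`mem_tower_succ`), and this gives `A (s + 1) τ_s = A s τ_s` (`mul_T_of_mem_tower`). A diagram `u`
of `A s` can be recovered from `u τ_s`, because multiplication by `τ_s` just bends the last column
of `u` round to the top row (`mul_tangle_cancel`). Hence `eval` is injective on the left ideal `A
(s + 1) τ_s`, and by reflection on the right ideal `τ_s A (s + 1)`. Two elements of `A (s + 1)`
with the same diagrams therefore act in the same way on the two-sided ideal `D` generated by `τ_s`;
as the partition monoid is a regular `*`-semigroup, `eval` is injective on `D`
(`eval_injOn_lastIdeal`). Outside `D` only the sparse words are left, products of letters `ε` and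
`φ` in which no index of a `φ` is adjacent to another index. Their letters commute and can be read
off from the diagram (`IsSparse.word_eq_word`), and their diagrams differ from those of the
remaining elements by a property of the cups in the top row (`IsDegenerate`,
`isSparse_or_isDegenerate`).

The relation `φ_i τ_i = τ_i` follows from the others only if `i` has a neighbouring index; it fails
in the presented monoid for `n = 2`.

*Surjectivity.* By induction on `s`, every pair `(I, J)` whose columns from number `s` on are
vertical lines is a product of generators (`isGenerated_of_isAdmissible`). If `I` has a cap on
neighbouring bottom dots which is a block of `J`, or is joined by `J` to a neighbouring bottom dot,
a factor `τ` can be split off, and bending its column round leaves a pair with one more vertical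
line (`isGenerated_of_isReducible`). If there is no such cap, and no such cup in the top row, then
planarity forces the last relevant columns to be a vertical line of `I`, possibly joined to its
neighbour, or a cup above a cap to which it is joined. So a factor `ε` or `φ` can be split off.
-/

/-! ### Colourings of products with tangles and joiners -/

namespace SetPartition

variable {n : ℕ}

/-- The left one of the two columns on which the generators with index `i` act. -/
def lo (i : Fin (n - 1)) : Fin n := ⟨i, by omega⟩

/-- The right one of the two columns on which the generators with index `i` act. -/
def hi (i : Fin (n - 1)) : Fin n := ⟨i + 1, by omega⟩

@[simp] theorem lo_val (i : Fin (n - 1)) : (lo i : ℕ) = i := rfl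

@[simp] theorem hi_val (i : Fin (n - 1)) : (hi i : ℕ) = i + 1 := rfl

theorem mul_le_ker {I J : SetPartition n} {a b : Fin n → Prop} :
    I * J ≤ Setoid.ker (Sum.elim a b) ↔ ∃ m : Fin n → Prop,
      I ≤ Setoid.ker (Sum.elim a m) ∧ J ≤ Setoid.ker (Sum.elim m b) :=
  concat_le_ker

theorem ext_ker {I J : SetPartition n}
    (h : ∀ a b : Fin n → Prop, I ≤ Setoid.ker (Sum.elim a b) ↔ J ≤ Setoid.ker (Sum.elim a b)) :
    I = J := by
  apply eq_of_colourings
  intro c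
  rw [← Sum.elim_comp_inl_inr c]
  exact h _ _

theorem one_le_ker {a b : Fin n → Prop} :
    (1 : SetPartition n) ≤ Setoid.ker (Sum.elim a b) ↔ a = b :=
  identity_le_ker

theorem tangle_le_ker {i : Fin (n - 1)} {a b : Fin n → Prop} :
    tangle i ≤ Setoid.ker (Sum.elim a b) ↔
      a (lo i) = a (hi i) ∧ b (lo i) = b (hi i) ∧ ∀ k, k ≠ lo i → k ≠ hi i → a k = b k := by
  constructor
  · intro h
    refine ⟨?_, ?_, fun k h0 h1 => ?_⟩
    · exact @h (Sum.inl (lo i)) (Sum.inl (hi i)) (by simp [tangleColour])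
    · exact @h (Sum.inr (lo i)) (Sum.inr (hi i)) (by simp [tangleColour])
    · refine @h (Sum.inl k) (Sum.inr k) ?_
      have h0' : (k : ℕ) ≠ i := fun e => h0 (Fin.ext e)
      have h1' : (k : ℕ) ≠ i + 1 := fun e => h1 (Fin.ext e)
      simp [tangleColour, h0', h1']
  · rintro ⟨h1, h2, h3⟩ x y hxy
    have hxy : tangleColour i x = tangleColour i y := hxy
    have e0 : ∀ k : Fin n, (k : ℕ) = i ↔ k = lo i := fun k => by simp [Fin.ext_iff]
    have e1 : ∀ k : Fin n, (k : ℕ) = i + 1 ↔ k = hi i := fun k => by simp [Fin.ext_iff]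
    rcases x with x | x <;> rcases y with y | y <;>
      simp only [tangleColour, e0, e1] at hxy <;>
      show _ = _ <;> simp only [Sum.elim_inl, Sum.elim_inr] <;>
      split_ifs at hxy with k1 k2 k2 <;> simp [← Fin.ext_iff] at hxy
    · rcases k1 with rfl | rfl <;> rcases k2 with rfl | rfl <;> simp [h1]
    · rw [hxy]
    · rw [hxy, h3 y (fun e => k2 (Or.inl e)) (fun e => k2 (Or.inr e))]
    · rw [hxy, h3 y (fun e => k2 (Or.inl e)) (fun e => k2 (Or.inr e))]
    · rcases k1 with rfl | rfl <;> rcases k2 with rfl | rfl <;> simp [h2]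
    · rw [hxy]

theorem joiner_le_ker {i : Fin (n - 1)} {a b : Fin n → Prop} :
    joiner i ≤ Setoid.ker (Sum.elim a b) ↔ a = b ∧ a (lo i) = a (hi i) := by
  constructor
  · intro h
    refine ⟨?_, ?_⟩
    · funext k
      exact @h (Sum.inl k) (Sum.inr k) (by simp [joinerColour])
    · exact @h (Sum.inl (lo i)) (Sum.inl (hi i)) (by simp [joinerColour])
  · rintro ⟨rfl, h2⟩ x y hxy
    have hxy : joinerColour i x = joinerColour i y := hxy
    have key : ∀ x y : Fin n, (if (x : ℕ) = i + 1 then (i : ℕ) else x) =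
        (if (y : ℕ) = i + 1 then (i : ℕ) else y) → a x = a y := by
      intro x y h
      have e1 : ∀ k : Fin n, (k : ℕ) = i + 1 ↔ k = hi i := fun k => by simp [Fin.ext_iff]
      have e0 : ∀ k : Fin n, (k : ℕ) = i ↔ k = lo i := fun k => by simp [Fin.ext_iff]
      split_ifs at h with k1 k2 k2
      · rw [(e1 x).1 k1, (e1 y).1 k2]
      · rw [(e1 x).1 k1, (e0 y).1 h.symm, h2]
      · rw [(e1 y).1 k2, (e0 x).1 h, h2]
      · rw [Fin.ext h]
    rcases x with x | x <;> rcases y with y | y <;> exact key x y hxy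

theorem lo_ne_hi (i : Fin (n - 1)) : lo i ≠ hi i := by simp [Fin.ext_iff]

/-- The function which takes the value `v` on the two columns of `i` and agrees with `a`
elsewhere. -/
def recolour (a : Fin n → Prop) (i : Fin (n - 1)) (v : Prop) : Fin n → Prop :=
  fun k => if k = lo i ∨ k = hi i then v else a k

@[simp] theorem recolour_lo (a : Fin n → Prop) (i : Fin (n - 1)) (v : Prop) :
    recolour a i v (lo i) = v := by simp [recolour]

@[simp] theorem recolour_hi (a : Fin n → Prop) (i : Fin (n - 1)) (v : Prop) :
    recolour a i v (hi i) = v := by simp [recolour]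

theorem recolour_of_ne (a : Fin n → Prop) {i : Fin (n - 1)} (v : Prop) {k : Fin n}
    (h0 : k ≠ lo i) (h1 : k ≠ hi i) : recolour a i v k = a k := by simp [recolour, h0, h1]

theorem tangle_mul_le_ker {i : Fin (n - 1)} {K : SetPartition n} {a b : Fin n → Prop} :
    tangle i * K ≤ Setoid.ker (Sum.elim a b) ↔
      a (lo i) = a (hi i) ∧ ∃ v, K ≤ Setoid.ker (Sum.elim (recolour a i v) b) := by
  simp only [mul_le_ker, tangle_le_ker]
  constructor
  · rintro ⟨m, ⟨h1, h2, h3⟩, h⟩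
    have : recolour a i (m (lo i)) = m := by
      funext k
      by_cases k0 : k = lo i
      · simp [k0]
      · by_cases k1 : k = hi i
        · simp [k1, h2]
        · rw [recolour_of_ne _ _ k0 k1, h3 k k0 k1]
    exact ⟨h1, m (lo i), by rwa [this]⟩
  · rintro ⟨h1, v, h⟩
    exact ⟨_, ⟨h1, by simp, fun k k0 k1 => (recolour_of_ne _ _ k0 k1).symm⟩, h⟩

theorem mul_tangle_le_ker {i : Fin (n - 1)} {K : SetPartition n} {a b : Fin n → Prop} :
    K * tangle i ≤ Setoid.ker (Sum.elim a b) ↔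
      b (lo i) = b (hi i) ∧ ∃ v, K ≤ Setoid.ker (Sum.elim a (recolour b i v)) := by
  simp only [mul_le_ker, tangle_le_ker]
  constructor
  · rintro ⟨m, h, h1, h2, h3⟩
    have : recolour b i (m (lo i)) = m := by
      funext k
      by_cases k0 : k = lo i
      · simp [k0]
      · by_cases k1 : k = hi i
        · simp [k1, h1]
        · rw [recolour_of_ne _ _ k0 k1, h3 k k0 k1]
    exact ⟨h2, m (lo i), by rwa [this]⟩
  · rintro ⟨h1, v, h⟩
    exact ⟨_, h, by simp, h1, fun k k0 k1 => recolour_of_ne _ _ k0 k1⟩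

theorem joiner_mul_le_ker {i : Fin (n - 1)} {K : SetPartition n} {a b : Fin n → Prop} :
    joiner i * K ≤ Setoid.ker (Sum.elim a b) ↔
      a (lo i) = a (hi i) ∧ K ≤ Setoid.ker (Sum.elim a b) := by
  simp only [mul_le_ker, joiner_le_ker]
  constructor
  · rintro ⟨m, ⟨rfl, h1⟩, h⟩; exact ⟨h1, h⟩
  · rintro ⟨h1, h⟩; exact ⟨a, ⟨rfl, h1⟩, h⟩

theorem mul_joiner_le_ker {i : Fin (n - 1)} {K : SetPartition n} {a b : Fin n → Prop} :
    K * joiner i ≤ Setoid.ker (Sum.elim a b) ↔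
      b (lo i) = b (hi i) ∧ K ≤ Setoid.ker (Sum.elim a b) := by
  simp only [mul_le_ker, joiner_le_ker]
  constructor
  · rintro ⟨m, h, rfl, h1⟩; exact ⟨h1, h⟩
  · rintro ⟨h1, h⟩; exact ⟨b, h, rfl, h1⟩

/-! ### The relations between tangles and joiners -/

theorem joiner_mul_self (i : Fin (n - 1)) : joiner i * joiner i = joiner i := by
  refine ext_ker fun a b => ?_
  simp only [joiner_mul_le_ker, joiner_le_ker]; tauto

theorem joiner_comm (i j : Fin (n - 1)) : joiner i * joiner j = joiner j * joiner i := by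
  refine ext_ker fun a b => ?_
  simp only [joiner_mul_le_ker, joiner_le_ker]; tauto

theorem joiner_mul_tangle (i : Fin (n - 1)) : joiner i * tangle i = tangle i := by
  refine ext_ker fun a b => ?_
  simp only [joiner_mul_le_ker, tangle_le_ker]; tauto

theorem tangle_mul_joiner (i : Fin (n - 1)) : tangle i * joiner i = tangle i := by
  refine ext_ker fun a b => ?_
  simp only [mul_joiner_le_ker, tangle_le_ker]; tauto

theorem recolour_self {a : Fin n → Prop} {i : Fin (n - 1)} (h : a (lo i) = a (hi i)) :
    recolour a i (a (lo i)) = a := by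
  funext k
  unfold recolour
  split_ifs with hk
  · rcases hk with rfl | rfl
    · rfl
    · exact h
  · rfl

theorem tangle_mul_self (i : Fin (n - 1)) : tangle i * tangle i = tangle i := by
  refine ext_ker fun a b => ?_
  simp only [tangle_mul_le_ker, tangle_le_ker]
  constructor
  · rintro ⟨h1, v, -, h2, h3⟩
    exact ⟨h1, h2, fun k k0 k1 => by rw [← h3 k k0 k1, recolour_of_ne _ _ k0 k1]⟩
  · rintro ⟨h1, h2, h3⟩
    refine ⟨h1, a (lo i), ?_⟩
    rw [recolour_self h1]; exact ⟨h1, h2, h3⟩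

/-- Indices at distance at least two: their generators act on disjoint pairs of columns. -/
theorem far_ne {i j : Fin (n - 1)} (h : 1 < |(i : ℤ) - (j : ℤ)|) :
    lo i ≠ lo j ∧ lo i ≠ hi j ∧ hi i ≠ lo j ∧ hi i ≠ hi j := by
  simp only [ne_eq, Fin.ext_iff, lo_val, hi_val]
  rw [lt_abs] at h
  omega

/-- Adjacent indices: their generators share one column. -/
theorem adj_cases {i j : Fin (n - 1)} (h : |(i : ℤ) - (j : ℤ)| = 1) :
    (hi i = lo j ∧ lo i ≠ lo j ∧ lo i ≠ hi j ∧ hi i ≠ hi j) ∨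
    (lo i = hi j ∧ lo i ≠ lo j ∧ hi i ≠ lo j ∧ hi i ≠ hi j) := by
  simp only [ne_eq, Fin.ext_iff, lo_val, hi_val]
  rw [abs_eq zero_le_one] at h
  omega

theorem joiner_tangle_comm {i j : Fin (n - 1)} (h : 1 < |(i : ℤ) - (j : ℤ)|) :
    joiner i * tangle j = tangle j * joiner i := by
  obtain ⟨h1, h2, h3, h4⟩ := far_ne h
  refine ext_ker fun a b => ?_
  simp only [joiner_mul_le_ker, mul_joiner_le_ker, tangle_le_ker]
  constructor
  · rintro ⟨k0, k1, k2, k3⟩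
    exact ⟨by rw [← k3 _ h1 h2, ← k3 _ h3 h4, k0], k1, k2, k3⟩
  · rintro ⟨k0, k1, k2, k3⟩
    exact ⟨by rw [k3 _ h1 h2, k3 _ h3 h4, k0], k1, k2, k3⟩

theorem tangle_comm_aux {i j : Fin (n - 1)} (h : 1 < |(i : ℤ) - (j : ℤ)|) :
    tangle i * tangle j ≤ tangle j * tangle i := by
  obtain ⟨h1, h2, h3, h4⟩ := far_ne h
  have key : ∀ a b : Fin n → Prop, tangle j * tangle i ≤ Setoid.ker (Sum.elim a b) →
      tangle i * tangle j ≤ Setoid.ker (Sum.elim a b) := by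
    intro a b
    simp only [tangle_mul_le_ker, tangle_le_ker]
    rintro ⟨k0, v, k1, k2, k3⟩
    rw [recolour_of_ne _ _ h1 h2, recolour_of_ne _ _ h3 h4] at k1
    refine ⟨k1, b (lo i), ?_, ?_, fun k e0 e1 => ?_⟩
    · rw [recolour_of_ne _ _ h1.symm h3.symm, recolour_of_ne _ _ h2.symm h4.symm, k0]
    · rw [← k3 _ h1.symm h3.symm, ← k3 _ h2.symm h4.symm]; simp
    · by_cases f0 : k = lo i
      · simp [f0]
      · by_cases f1 : k = hi i
        · simp [f1, k2]
        · rw [recolour_of_ne _ _ f0 f1, ← k3 _ f0 f1, recolour_of_ne _ _ e0 e1]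
  intro x y hxy
  have h := key ((fun z => (tangle j * tangle i) x z) ∘ Sum.inl)
    ((fun z => (tangle j * tangle i) x z) ∘ Sum.inr) (by
      rw [Sum.elim_comp_inl_inr]
      intro u v huv
      exact propext ⟨fun k => Setoid.trans' _ k huv, fun k => Setoid.trans' _ k (Setoid.symm' _ huv)⟩)
  rw [Sum.elim_comp_inl_inr] at h
  have : (tangle j * tangle i) x x = (tangle j * tangle i) x y := h hxy
  exact this ▸ Setoid.refl' _ x

theorem tangle_comm {i j : Fin (n - 1)} (h : 1 < |(i : ℤ) - (j : ℤ)|) :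
    tangle i * tangle j = tangle j * tangle i :=
  le_antisymm (tangle_comm_aux h) (tangle_comm_aux (by rwa [abs_sub_comm]))

theorem joiner_mul_tangle_mul_joiner {i j : Fin (n - 1)} (h : |(i : ℤ) - (j : ℤ)| = 1) :
    joiner j * tangle i * joiner j = joiner j * joiner i := by
  refine ext_ker fun a b => ?_
  rw [mul_assoc]
  simp only [joiner_mul_le_ker, mul_joiner_le_ker, tangle_le_ker, joiner_le_ker]
  constructor
  · rintro ⟨k0, k1, k2, k3, k4⟩
    refine ⟨k3, funext fun k => ?_, k0⟩
    rcases adj_cases h with ⟨h1, h2, h3, h4⟩ | ⟨h1, h2, h3, h4⟩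
    · have e := k4 _ h3.symm h4.symm
      have e1 : a (hi i) = b (hi i) := by rw [h1, k0, e, ← k1]
      by_cases f1 : k = hi i
      · rw [f1, e1]
      · by_cases f0 : k = lo i
        · rw [f0, k2, e1, k3]
        · exact k4 _ f0 f1
    · have e := k4 _ h2.symm h3.symm
      have e1 : a (lo i) = b (lo i) := by rw [h1, ← k0, e, ← k1]
      by_cases f1 : k = lo i
      · rw [f1, e1]
      · by_cases f0 : k = hi i
        · rw [f0, ← k2, e1, k3]
        · exact k4 _ f1 f0
  · rintro ⟨k0, rfl, k1⟩
    exact ⟨k1, k1, k0, k0, fun _ _ _ => rfl⟩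

theorem tangle_mul_joiner_mul_tangle {i j : Fin (n - 1)} (h : |(i : ℤ) - (j : ℤ)| = 1) :
    tangle i * joiner j * tangle i = tangle i := by
  refine ext_ker fun a b => ?_
  rw [mul_assoc]
  simp only [joiner_mul_le_ker, tangle_mul_le_ker, tangle_le_ker]
  constructor
  · rintro ⟨k0, v, k1, k2, k3, k4⟩
    exact ⟨k0, k3, fun k f0 f1 => by rw [← k4 _ f0 f1, recolour_of_ne _ _ f0 f1]⟩
  · rintro ⟨k0, k1, k2⟩
    refine ⟨k0, ?_⟩
    rcases adj_cases h with ⟨h1, h2, h3, h4⟩ | ⟨h1, h2, h3, h4⟩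
    · refine ⟨a (hi j), ?_, by simp, k1, fun k f0 f1 =>
        by rw [recolour_of_ne _ _ f0 f1, k2 k f0 f1]⟩
      rw [← h1, recolour_hi, recolour_of_ne _ _ h3.symm h4.symm]
    · refine ⟨a (lo j), ?_, by simp, k1, fun k f0 f1 =>
        by rw [recolour_of_ne _ _ f0 f1, k2 k f0 f1]⟩
      rw [← h1, recolour_lo, recolour_of_ne _ _ h2.symm h3.symm]

theorem tangle_mul_tangle_mul_tangle {i j : Fin (n - 1)} (h : |(i : ℤ) - (j : ℤ)| = 1) :
    tangle i * tangle j * tangle i = tangle i := by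
  refine ext_ker fun a b => ?_
  rw [mul_assoc]
  simp only [tangle_mul_le_ker, tangle_le_ker]
  constructor
  · rintro ⟨k0, v, k1, w, k2, k3, k4⟩
    refine ⟨k0, k3, fun k f0 f1 => ?_⟩
    rw [← k4 _ f0 f1]
    by_cases g0 : k = lo j
    · subst g0
      rw [recolour_lo]
      rcases adj_cases h with ⟨h1, h2, h3, h4⟩ | ⟨h1, h2, h3, h4⟩
      · exact absurd h1.symm f1
      · rw [recolour_of_ne _ _ f0 f1, ← h1, recolour_lo] at k1
        rw [k1, ← recolour_hi (recolour a i v) j w, ← h1, k2, recolour_of_ne _ _ h3 h4,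
          recolour_hi]
    · by_cases g1 : k = hi j
      · subst g1
        rw [recolour_hi]
        rcases adj_cases h with ⟨h1, h2, h3, h4⟩ | ⟨h1, h2, h3, h4⟩
        · rw [recolour_of_ne _ _ f0 f1, ← h1, recolour_hi] at k1
          rw [← k1, ← recolour_lo (recolour a i v) j w, ← h1, ← k2, recolour_of_ne _ _ h2 h3,
            recolour_lo]
        · exact absurd h1.symm f0
      · rw [recolour_of_ne _ _ g0 g1, recolour_of_ne _ _ f0 f1]
  · rintro ⟨k0, k1, k2⟩
    refine ⟨k0, ?_⟩
    rcases adj_cases h with ⟨h1, h2, h3, h4⟩ | ⟨h1, h2, h3, h4⟩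
    · refine ⟨a (hi j), ?_, a (hi j), ?_, k1, fun k f0 f1 => ?_⟩
      · rw [← h1, recolour_hi, recolour_of_ne _ _ h3.symm h4.symm]
      · rw [h1, recolour_lo, recolour_of_ne _ _ h2 h3, recolour_lo]
      · rw [← k2 k f0 f1]
        by_cases g0 : k = hi j
        · simp [g0]
        · rw [recolour_of_ne _ _ (fun e => f1 (e.trans h1.symm)) g0, recolour_of_ne _ _ f0 f1]
    · refine ⟨a (lo j), ?_, a (lo j), ?_, k1, fun k f0 f1 => ?_⟩
      · rw [← h1, recolour_lo, recolour_of_ne _ _ h2.symm h3.symm]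
      · rw [h1, recolour_hi, recolour_of_ne _ _ h3 h4, recolour_hi]
      · rw [← k2 k f0 f1]
        by_cases g0 : k = lo j
        · simp [g0]
        · rw [recolour_of_ne _ _ g0 (fun e => f0 (e.trans h1.symm)), recolour_of_ne _ _ f0 f1]

end SetPartition

namespace SetPartition

variable {n : ℕ}

/-! ### Reflection of a diagram in a horizontal line -/

/-- The diagram with its two rows exchanged. -/
@[reducible] def mirror (K : SetPartition n) : SetPartition n := K.comap Sum.swap

theorem mirror_apply (K : SetPartition n) (x y : Dots n) :
    mirror K x y ↔ K x.swap y.swap := Iff.rfl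

theorem mirror_mirror (K : SetPartition n) : mirror (mirror K) = K := by
  ext x y; simp [mirror_apply]

theorem mirror_le_ker {K : SetPartition n} {a b : Fin n → Prop} :
    mirror K ≤ Setoid.ker (Sum.elim a b) ↔ K ≤ Setoid.ker (Sum.elim b a) := by
  constructor
  · intro h x y hxy
    have := @h x.swap y.swap (by simpa [mirror_apply] using hxy)
    rcases x with x | x <;> rcases y with y | y <;> exact this
  · intro h x y hxy
    have := @h x.swap y.swap hxy
    rcases x with x | x <;> rcases y with y | y <;> exact this

theorem mirror_one : mirror (1 : SetPartition n) = 1 := by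
  refine ext_ker fun a b => ?_
  rw [mirror_le_ker, one_le_ker, one_le_ker, eq_comm]

theorem mirror_mul (I J : SetPartition n) : mirror (I * J) = mirror J * mirror I := by
  refine ext_ker fun a b => ?_
  simp only [mul_le_ker, mirror_le_ker]
  exact exists_congr fun m => and_comm

theorem mirror_tangle (i : Fin (n - 1)) : mirror (tangle i) = tangle i := by
  refine ext_ker fun a b => ?_
  simp only [mirror_le_ker, tangle_le_ker]
  constructor <;> rintro ⟨h1, h2, h3⟩ <;> exact ⟨h2, h1, fun k h h' => (h3 k h h').symm⟩

theorem mirror_joiner (i : Fin (n - 1)) : mirror (joiner i) = joiner i := by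
  refine ext_ker fun a b => ?_
  simp only [mirror_le_ker, joiner_le_ker]
  constructor <;> rintro ⟨rfl, h⟩ <;> exact ⟨rfl, h⟩

theorem mirror_mono {I J : SetPartition n} (h : I ≤ J) : mirror I ≤ mirror J :=
  fun _ _ hxy => h hxy

theorem pos_swap (x : Dots n) : pos x.swap = 2 * n - 1 - pos x := by
  rcases x with x | x
  · rfl
  · simp only [Sum.swap_inr, pos]; omega

theorem pos_lt (x : Dots n) : pos x < 2 * n := by
  rcases x with x | x <;> simp only [pos] <;> omega

theorem IsPlanar.mirror {K : SetPartition n} (hK : K.IsPlanar) : (mirror K).IsPlanar := by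
  intro a b c d hab hbc hcd hac hbd
  have ha := pos_lt a
  have hb := pos_lt b
  have hc := pos_lt c
  have hd := pos_lt d
  have h := hK d.swap c.swap b.swap a.swap (by simp only [pos_swap]; omega)
    (by simp only [pos_swap]; omega) (by simp only [pos_swap]; omega) (K.symm' hbd) (K.symm' hac)
  exact K.trans' (K.trans' hac (K.symm' h)) (K.symm' hbd)

theorem IsPairing.mirror {K : SetPartition n} (hK : K.IsPairing) : (mirror K).IsPairing := by
  obtain ⟨f, hf, hf', -⟩ := hK.exists_partner
  refine isPairing_of_partner fun x => ⟨(f x.swap).swap, fun h => hf' x.swap ?_, fun z => ?_⟩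
  · simpa using congrArg Sum.swap h
  · rw [mirror_apply, hf, ← Sum.swap_rightInverse.injective.eq_iff (a := z),
      ← Sum.swap_rightInverse.injective.eq_iff (a := z), Sum.swap_swap]

/-- The partition monoid is a regular `*`-semigroup. -/
theorem mul_mirror_mul (K : SetPartition n) : K * mirror K * K = K := by
  refine ext_ker fun a b => ?_
  rw [mul_assoc]
  simp only [mul_le_ker, mirror_le_ker]
  constructor
  · rintro ⟨m, h1, m', h2, h3⟩ x y hxy
    have k1 := h1 hxy
    have k2 := h2 hxy
    have k3 := h3 hxy
    rcases x with x | x <;> rcases y with y | y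
    · exact k1
    · exact (show a x = m y from k1).trans ((show m' x = m y from k2).symm.trans k3)
    · exact (show b x = m' y from k3).trans ((show m x = m' y from k2).symm.trans k1)
    · exact k3
  · intro h
    exact ⟨b, h, a, h, h⟩

/-! ### Dots of a product -/

theorem mul_inl_inl {I J : SetPartition n} {x y : Fin n} (h : I (Sum.inl x) (Sum.inl y)) :
    (I * J) (Sum.inl x) (Sum.inl y) :=
  stack_upper (J := J) h

theorem mul_inl_inr {I J : SetPartition n} {x y z : Fin n} (h : I (Sum.inl x) (Sum.inr y))
    (h' : J (Sum.inl y) (Sum.inr z)) : (I * J) (Sum.inl x) (Sum.inr z) :=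
  (stack I J).trans' (stack_upper (J := J) h) (stack_lower (I := I) h')

theorem mul_inl_inl_of_bend {I J : SetPartition n} {x y z w : Fin n}
    (h : I (Sum.inl x) (Sum.inr z)) (h' : J (Sum.inl z) (Sum.inl w))
    (h'' : I (Sum.inl y) (Sum.inr w)) : (I * J) (Sum.inl x) (Sum.inl y) :=
  (stack I J).trans' (stack_upper (J := J) h)
    ((stack I J).trans' (stack_lower (I := I) h') ((stack I J).symm' (stack_upper (J := J) h'')))

theorem tangle_inl (i : Fin (n - 1)) : (tangle i) (Sum.inl (lo i)) (Sum.inl (hi i)) := by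
  simp [tangleColour]

theorem joiner_inl (i : Fin (n - 1)) : (joiner i) (Sum.inl (lo i)) (Sum.inl (hi i)) :=
  tangle_le_joiner i (tangle_inl i)

/-! ### Straight columns -/

/-- Column `j` is a vertical line which is a block by itself. -/
def IsStraightAt (K : SetPartition n) (j : Fin n) : Prop :=
  K (Sum.inl j) (Sum.inr j) ∧ K ≤ Setoid.ker (Sum.elim (· = j) (· = j))

theorem isStraightAt_one (j : Fin n) : (1 : SetPartition n).IsStraightAt j :=
  ⟨rfl, one_le_ker.2 rfl⟩

theorem IsStraightAt.mul {K L : SetPartition n} {j : Fin n} (hK : K.IsStraightAt j)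
    (hL : L.IsStraightAt j) : (K * L).IsStraightAt j :=
  ⟨mul_inl_inr hK.1 hL.1, mul_le_ker.2 ⟨_, hK.2, hL.2⟩⟩

theorem IsStraightAt.mirror {K : SetPartition n} {j : Fin n} (hK : K.IsStraightAt j) :
    (mirror K).IsStraightAt j :=
  ⟨K.symm' hK.1, mirror_le_ker.2 hK.2⟩

theorem tangle_isStraightAt {i : Fin (n - 1)} {j : Fin n} (h0 : j ≠ lo i) (h1 : j ≠ hi i) :
    (tangle i).IsStraightAt j := by
  constructor
  · have e0 : (j : ℕ) ≠ i := fun h => h0 (Fin.ext h)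
    have e1 : (j : ℕ) ≠ i + 1 := fun h => h1 (Fin.ext h)
    simp [tangleColour, e0, e1]
  · rw [tangle_le_ker]
    simp [h0.symm, h1.symm]

theorem one_le_apply {K : SetPartition n} (h : 1 ≤ K) (j : Fin n) : K (Sum.inl j) (Sum.inr j) :=
  h (show (1 : SetPartition n) (Sum.inl j) (Sum.inr j) from rfl)

theorem joiner_isStraightAt {i : Fin (n - 1)} {j : Fin n} (h0 : j ≠ lo i) (h1 : j ≠ hi i) :
    (joiner i).IsStraightAt j := by
  refine ⟨one_le_apply (one_le_joiner i) j, ?_⟩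
  rw [joiner_le_ker]
  simp [h0.symm, h1.symm]

theorem IsStraightAt.eq_of_le_ker {K : SetPartition n} {j : Fin n} (hK : K.IsStraightAt j)
    {a b : Fin n → Prop} (h : K ≤ Setoid.ker (Sum.elim a b)) : a j = b j := h hK.1

/-- The colour of a straight column may be changed freely. -/
theorem IsStraightAt.le_ker_update {K : SetPartition n} {j : Fin n} (hK : K.IsStraightAt j)
    {a b a' b' : Fin n → Prop} (h : K ≤ Setoid.ker (Sum.elim a b)) (ha : ∀ k, k ≠ j → a' k = a k)
    (hb : ∀ k, k ≠ j → b' k = b k) (hj : a' j = b' j) : K ≤ Setoid.ker (Sum.elim a' b') := by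
  intro x y hxy
  have h1 := hK.2 hxy
  have h2 := h hxy
  have key : ∀ z : Dots n, (Sum.elim (· = j) (· = j) z → Sum.elim a' b' z = a' j) ∧
      (¬ Sum.elim (· = j) (· = j) z → Sum.elim a' b' z = Sum.elim a b z) := by
    rintro (z | z)
    · exact ⟨fun e => congrArg a' e, ha z⟩
    · exact ⟨fun e => (congrArg b' e).trans hj.symm, hb z⟩
  have h1 : Sum.elim (· = j) (· = j) x = Sum.elim (· = j) (· = j) y := h1
  show Sum.elim a' b' x = Sum.elim a' b' y
  by_cases hx : Sum.elim (· = j) (· = j) x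
  · rw [(key x).1 hx, (key y).1 (h1 ▸ hx)]
  · rw [(key x).2 hx, (key y).2 (h1 ▸ hx)]
    exact h2

theorem mul_tangle_cancel_aux {K L : SetPartition n} {i : Fin (n - 1)} (hK : K.IsStraightAt (hi i))
    (hL : L.IsStraightAt (hi i)) (h : K * tangle i = L * tangle i) {a b : Fin n → Prop}
    (hab : K ≤ Setoid.ker (Sum.elim a b)) : L ≤ Setoid.ker (Sum.elim a b) := by
  classical
  have e := lo_ne_hi i
  -- give column `i + 1` the colour of the bottom dot `i`, so that the tangle can be attached
  have h1 : K * tangle i ≤ Setoid.ker (Sum.elim (Function.update a (hi i) (b (lo i)))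
      (recolour b i True)) := by
    rw [mul_tangle_le_ker]
    refine ⟨by simp, b (lo i), hK.le_ker_update hab (fun k hk => Function.update_of_ne hk _ _)
      (fun k hk => ?_) (by simp)⟩
    by_cases f : k = lo i
    · rw [f, recolour_lo]
    · rw [recolour_of_ne _ _ f hk, recolour_of_ne _ _ f hk]
  rw [h, mul_tangle_le_ker] at h1
  obtain ⟨-, v, h2⟩ := h1
  have h3 := hL.eq_of_le_ker h2
  rw [recolour_hi, Function.update_self] at h3
  refine hL.le_ker_update h2 (fun k hk => (Function.update_of_ne hk _ _).symm) (fun k hk => ?_)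
    (hK.eq_of_le_ker hab)
  by_cases f : k = lo i
  · rw [f, recolour_lo, h3]
  · rw [recolour_of_ne _ _ f hk, recolour_of_ne _ _ f hk]

/-- Capping off the last two columns loses no information about a diagram whose last column is
straight: it only bends that column round to the top row. -/
theorem mul_tangle_cancel {K L : SetPartition n} {i : Fin (n - 1)} (hK : K.IsStraightAt (hi i))
    (hL : L.IsStraightAt (hi i)) (h : K * tangle i = L * tangle i) : K = L :=
  ext_ker fun _ _ => ⟨mul_tangle_cancel_aux hK hL h, mul_tangle_cancel_aux hL hK h.symm⟩

end SetPartition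

namespace TiedTemperleyLieb

open TiedGenerator

variable {n : ℕ}

/-! ### Computations in the tied Temperley-Lieb monoid -/

/-- The generator `τ_i` of the tied Temperley-Lieb monoid. -/
def T (i : Fin (n - 1)) : TiedTemperleyLieb n := PresentedMonoid.of _ (.t i)

/-- The generator `ε_i` of the tied Temperley-Lieb monoid. -/
def E (i : Fin (n - 1)) : TiedTemperleyLieb n := PresentedMonoid.of _ (.e i)

/-- The generator `φ_i` of the tied Temperley-Lieb monoid. -/
def F (i : Fin (n - 1)) : TiedTemperleyLieb n := PresentedMonoid.of _ (.f i)

theorem E_sq (i : Fin (n - 1)) : E i * E i = E i :=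
  PresentedMonoid.mk_eq_mk_of_rel (TiedRelation.ε_sq i)

theorem E_comm (i j : Fin (n - 1)) : E i * E j = E j * E i :=
  PresentedMonoid.mk_eq_mk_of_rel (TiedRelation.ε_comm i j)

theorem T_sq (i : Fin (n - 1)) : T i * T i = T i :=
  PresentedMonoid.mk_eq_mk_of_rel (TiedRelation.τ_sq i)

theorem T_comm {i j : Fin (n - 1)} (h : 1 < |(i : ℤ) - (j : ℤ)|) : T i * T j = T j * T i :=
  PresentedMonoid.mk_eq_mk_of_rel (TiedRelation.τ_comm i j h)

theorem T_T_T {i j : Fin (n - 1)} (h : |(i : ℤ) - (j : ℤ)| = 1) : T i * T j * T i = T i :=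
  PresentedMonoid.mk_eq_mk_of_rel (TiedRelation.τ_τ_τ i j h)

theorem F_sq (i : Fin (n - 1)) : F i * F i = F i :=
  PresentedMonoid.mk_eq_mk_of_rel (TiedRelation.φ_sq i)

theorem F_comm {i j : Fin (n - 1)} (h : 1 < |(i : ℤ) - (j : ℤ)|) : F i * F j = F j * F i :=
  PresentedMonoid.mk_eq_mk_of_rel (TiedRelation.φ_comm i j h)

theorem E_T_self (i : Fin (n - 1)) : E i * T i = T i :=
  PresentedMonoid.mk_eq_mk_of_rel (TiedRelation.ε_τ_self i)

theorem T_E_self (i : Fin (n - 1)) : T i * E i = T i :=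
  PresentedMonoid.mk_eq_mk_of_rel (TiedRelation.τ_ε_self i)

theorem E_F_comm (i j : Fin (n - 1)) : E i * F j = F j * E i :=
  PresentedMonoid.mk_eq_mk_of_rel (TiedRelation.ε_φ_comm i j)

theorem F_E_self (i : Fin (n - 1)) : F i * E i = F i :=
  PresentedMonoid.mk_eq_mk_of_rel (TiedRelation.φ_ε_self i)

theorem T_F_comm (i : Fin (n - 1)) : T i * F i = F i * T i :=
  PresentedMonoid.mk_eq_mk_of_rel (TiedRelation.τ_φ_self i)

theorem E_T_comm {i j : Fin (n - 1)} (h : 1 < |(i : ℤ) - (j : ℤ)|) : E i * T j = T j * E i :=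
  PresentedMonoid.mk_eq_mk_of_rel (TiedRelation.ε_τ_comm i j h)

theorem F_T_comm {i j : Fin (n - 1)} (h : 1 < |(i : ℤ) - (j : ℤ)|) : F i * T j = T j * F i :=
  PresentedMonoid.mk_eq_mk_of_rel (TiedRelation.φ_τ_comm i j h)

theorem T_E_T {i j : Fin (n - 1)} (h : |(i : ℤ) - (j : ℤ)| = 1) : T i * E j * T i = T i :=
  PresentedMonoid.mk_eq_mk_of_rel (TiedRelation.τ_ε_τ i j h)

theorem E_T_E {i j : Fin (n - 1)} (h : |(i : ℤ) - (j : ℤ)| = 1) : E j * T i * E j = F i * E j :=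
  (PresentedMonoid.mk_eq_mk_of_rel (TiedRelation.ε_τ_ε i j h)).symm.trans
    (PresentedMonoid.mk_eq_mk_of_rel (TiedRelation.φ_ε_adj i j h)).symm

theorem E_F_self (i : Fin (n - 1)) : E i * F i = F i := by rw [E_F_comm, F_E_self]

@[elab_as_elim]
theorem induction_on {p : TiedTemperleyLieb n → Prop} (m : TiedTemperleyLieb n) (one : p 1)
    (mul : ∀ m x, p m → p (m * PresentedMonoid.of _ x)) : p m := by
  induction m using PresentedMonoid.inductionOn with
  | h w =>
    induction w using List.reverseRecOn with
    | nil => exact one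
    | append_singleton w x ih => exact mul _ x ih

/-- The anti-automorphism of the tied Temperley-Lieb monoid which fixes the generators. -/
def revHom (n : ℕ) : TiedTemperleyLieb n →* (TiedTemperleyLieb n)ᵐᵒᵖ :=
  PresentedMonoid.lift (fun x => MulOpposite.op (PresentedMonoid.of _ x)) (by
    intro a b h
    apply MulOpposite.unop_injective
    cases h with
    | ε_sq i => exact E_sq i
    | ε_comm i j => exact E_comm j i
    | τ_sq i => exact T_sq i
    | τ_comm i j h => exact (T_comm h).symm
    | τ_τ_τ i j h => exact (mul_assoc _ _ _).symm.trans (T_T_T h)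
    | φ_sq i => exact F_sq i
    | φ_comm i j h => exact (F_comm h).symm
    | ε_τ_self i => exact T_E_self i
    | τ_ε_self i => exact E_T_self i
    | ε_φ_comm i j => exact (E_F_comm i j).symm
    | φ_ε_self i => exact E_F_self i
    | τ_φ_self i => exact (T_F_comm i).symm
    | ε_τ_comm i j h => exact (E_T_comm h).symm
    | φ_τ_comm i j h => exact (F_T_comm h).symm
    | τ_ε_τ i j h => exact (mul_assoc _ _ _).symm.trans (T_E_T h)
    | φ_ε_adj i j h => exact E_F_comm j i
    | ε_τ_ε i j h => exact (E_T_E h).symm.trans (mul_assoc _ _ _))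

/-- The element represented by the reversed word. -/
def rev (m : TiedTemperleyLieb n) : TiedTemperleyLieb n := (revHom n m).unop

@[simp] theorem rev_one : rev (1 : TiedTemperleyLieb n) = 1 := rfl

@[simp] theorem rev_mul (a b : TiedTemperleyLieb n) : rev (a * b) = rev b * rev a := by
  simp [rev]

@[simp] theorem rev_of (x : TiedGenerator n) :
    rev (PresentedMonoid.of (TiedRelation n) x) = PresentedMonoid.of _ x := rfl

@[simp] theorem rev_T (i : Fin (n - 1)) : rev (T i) = T i := rfl

@[simp] theorem rev_E (i : Fin (n - 1)) : rev (E i) = E i := rfl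

@[simp] theorem rev_F (i : Fin (n - 1)) : rev (F i) = F i := rfl

@[simp] theorem rev_rev (m : TiedTemperleyLieb n) : rev (rev m) = m := by
  induction m using induction_on with
  | one => rfl
  | mul m x ih => rw [rev_mul, rev_mul, ih, rev_of, rev_of]

variable {i j : Fin (n - 1)}

/-- A consequence of the relations which needs a neighbouring index `j`. -/
theorem F_T_self (h : |(i : ℤ) - (j : ℤ)| = 1) : F i * T i = T i := by
  calc F i * T i = F i * (T i * T i) := by rw [T_sq]
    _ = T i * (F i * T i) := by rw [← mul_assoc, ← mul_assoc, T_F_comm]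
    _ = T i * E j * T i * (F i * T i) := by rw [T_E_T h]
    _ = T i * E j * (T i * F i) * T i := by simp only [mul_assoc]
    _ = T i * E j * (F i * T i) * T i := by rw [T_F_comm]
    _ = T i * (E j * F i) * (T i * T i) := by simp only [mul_assoc]
    _ = T i * (E j * T i * E j) * T i := by rw [E_F_comm, E_T_E h, T_sq]
    _ = (T i * E j * T i) * E j * T i := by simp only [mul_assoc]
    _ = T i := by rw [T_E_T h, T_E_T h]

theorem E_T_T (h : |(i : ℤ) - (j : ℤ)| = 1) : E i * T j * T i = F j * T i := by
  have h' : |(j : ℤ) - (i : ℤ)| = 1 := by rwa [abs_sub_comm]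
  calc E i * T j * T i = E i * T j * E i * T i := by rw [mul_assoc _ (E i), E_T_self]
    _ = F j * T i := by rw [E_T_E h', mul_assoc, E_T_self]

theorem T_F_T (h : |(i : ℤ) - (j : ℤ)| = 1) : T i * F j * T i = T i := by
  have h' : |(j : ℤ) - (i : ℤ)| = 1 := by rwa [abs_sub_comm]
  calc T i * F j * T i = T i * (F j * E i) * T i := by
        rw [mul_assoc _ _ (T i), mul_assoc _ _ (T i), mul_assoc _ _ (T i), E_T_self]
    _ = (T i * E i) * T j * (E i * T i) := by rw [← E_T_E h']; simp only [mul_assoc]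
    _ = T i := by rw [T_E_self, E_T_self, T_T_T h]

theorem F_F_T (h : |(i : ℤ) - (j : ℤ)| = 1) : F i * F j * T i = E j * T i := by
  calc F i * F j * T i = F i * E j * (F j * T i) := by
        rw [mul_assoc, mul_assoc, ← mul_assoc (E j), E_F_self]
    _ = E j * T i * (E j * F j) * T i := by rw [← E_T_E h]; simp only [mul_assoc]
    _ = E j * T i := by rw [E_F_self, mul_assoc, mul_assoc, ← mul_assoc (T i), T_F_T h]

theorem F_T_T (h : |(i : ℤ) - (j : ℤ)| = 1) : F i * T j * T i = E j * T i := by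
  calc F i * T j * T i = F i * (E i * T j * T i) := by
        simp only [← mul_assoc, F_E_self]
    _ = E j * T i := by rw [E_T_T h, ← mul_assoc, F_F_T h]

theorem T_T_E (h : |(i : ℤ) - (j : ℤ)| = 1) : T i * T j * E i = T i * F j := by
  simpa [mul_assoc] using congrArg rev (E_T_T h)

theorem T_F_F (h : |(i : ℤ) - (j : ℤ)| = 1) : T i * F j * F i = T i * E j := by
  simpa [mul_assoc] using congrArg rev (F_F_T h)

theorem T_T_F (h : |(i : ℤ) - (j : ℤ)| = 1) : T i * T j * F i = T i * E j := by
  simpa [mul_assoc] using congrArg rev (F_T_T h)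

theorem F_F_F (h : |(i : ℤ) - (j : ℤ)| = 1) : F i * F j * F i = F i * E j := by
  calc F i * F j * F i = F i * E j * (F j * F i) := by
        rw [mul_assoc, mul_assoc, ← mul_assoc (E j), E_F_self]
    _ = E j * T i * (E j * F j) * F i := by rw [← E_T_E h]; simp only [mul_assoc]
    _ = F i * E j := by
        rw [E_F_self, mul_assoc, mul_assoc, ← mul_assoc (T i), T_F_F h, ← mul_assoc, E_T_E h]

theorem F_T_E (h : |(i : ℤ) - (j : ℤ)| = 1) : F i * T j * E i = F i * F j := by
  have h' : |(j : ℤ) - (i : ℤ)| = 1 := by rwa [abs_sub_comm]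
  calc F i * T j * E i = F i * (E i * T j * E i) := by simp only [← mul_assoc, F_E_self]
    _ = F i * F j := by rw [E_T_E h', ← E_F_comm, ← mul_assoc, F_E_self]

theorem E_T_F (h : |(i : ℤ) - (j : ℤ)| = 1) : E i * T j * F i = F j * F i := by
  simpa [mul_assoc] using congrArg rev (F_T_E h)

theorem F_T_F (h : |(i : ℤ) - (j : ℤ)| = 1) : F i * T j * F i = F i * E j := by
  calc F i * T j * F i = F i * T j * E i * F i := by rw [mul_assoc _ (E i), E_F_self]
    _ = F i * E j := by rw [F_T_E h, F_F_F h]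

/-- `x` is one of the three generators with index `i`. -/
def IsLetter (i : Fin (n - 1)) (x : TiedTemperleyLieb n) : Prop := x = T i ∨ x = E i ∨ x = F i

/-- Two generators with the same index multiply to a generator with that index. -/
theorem IsLetter.mul (h : |(i : ℤ) - (j : ℤ)| = 1) {x y : TiedTemperleyLieb n}
    (hx : IsLetter i x) (hy : IsLetter i y) : IsLetter i (x * y) := by
  unfold IsLetter
  rcases hx with rfl | rfl | rfl <;> rcases hy with rfl | rfl | rfl <;>
    simp only [T_sq, T_E_self, T_F_comm, F_T_self h, E_T_self, E_sq, E_F_self, F_E_self, F_sq,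
      true_or, or_true]

/-- If a generator with index `j` stands between two generators with the adjacent index `i`, one of
the latter can be removed. -/
theorem sandwich (h : |(i : ℤ) - (j : ℤ)| = 1) {x y z : TiedTemperleyLieb n}
    (hx : IsLetter i x) (hy : IsLetter i y) (hz : IsLetter j z)
    {S : Submonoid (TiedTemperleyLieb n)}
    (hS : ∀ w, IsLetter j w → w ∈ S) :
    ∃ a ∈ S, ∃ b ∈ S, ∃ w, IsLetter i w ∧ x * z * y = a * w * b := by
  have h' : |(j : ℤ) - (i : ℤ)| = 1 := by rwa [abs_sub_comm]
  have h1 := S.one_mem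
  have hE := hS _ (Or.inr (Or.inl rfl))
  have hF := hS _ (Or.inr (Or.inr rfl))
  have lT : IsLetter i (T i) := Or.inl rfl
  have lE : IsLetter i (E i) := Or.inr (Or.inl rfl)
  have lF : IsLetter i (F i) := Or.inr (Or.inr rfl)
  rcases hz with rfl | rfl | rfl
  · rcases hx with rfl | rfl | rfl <;> rcases hy with rfl | rfl | rfl
    · exact ⟨1, h1, 1, h1, _, lT, by simp [T_T_T h]⟩
    · exact ⟨1, h1, _, hF, _, lT, by rw [T_T_E h, one_mul]⟩
    · exact ⟨1, h1, _, hE, _, lT, by rw [T_T_F h, one_mul]⟩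
    · exact ⟨_, hF, 1, h1, _, lT, by rw [E_T_T h, mul_one]⟩
    · exact ⟨_, hF, 1, h1, _, lE, by rw [E_T_E h', mul_one]⟩
    · exact ⟨_, hF, 1, h1, _, lF, by rw [E_T_F h, mul_one]⟩
    · exact ⟨_, hE, 1, h1, _, lT, by rw [F_T_T h, mul_one]⟩
    · exact ⟨1, h1, _, hF, _, lF, by rw [F_T_E h, one_mul]⟩
    · exact ⟨1, h1, _, hE, _, lF, by rw [F_T_F h, one_mul]⟩
  · rcases hx with rfl | rfl | rfl
    · rcases hy with rfl | rfl | rfl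
      · exact ⟨1, h1, 1, h1, _, lT, by simp [T_E_T h]⟩
      · exact ⟨1, h1, _, hE, _, lT, by
          rw [mul_assoc, E_comm j i, ← mul_assoc, T_E_self, one_mul]⟩
      · exact ⟨1, h1, _, hE, _, lT, by
          rw [mul_assoc, E_F_comm, ← mul_assoc, T_F_comm, F_T_self h, one_mul]⟩
    · exact ⟨_, hE, 1, h1, _, IsLetter.mul h lE hy, by rw [E_comm i j, mul_one, mul_assoc]⟩
    · exact ⟨_, hE, 1, h1, _, IsLetter.mul h lF hy, by rw [← E_F_comm, mul_one, mul_assoc]⟩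
  · rcases hx with rfl | rfl | rfl
    · rcases hy with rfl | rfl | rfl
      · exact ⟨1, h1, 1, h1, _, lT, by simp [T_F_T h]⟩
      · exact ⟨1, h1, _, hF, _, lT, by
          rw [mul_assoc, ← E_F_comm, ← mul_assoc, T_E_self, one_mul]⟩
      · exact ⟨1, h1, _, hE, _, lT, by rw [T_F_F h, one_mul]⟩
    · exact ⟨_, hF, 1, h1, _, IsLetter.mul h lE hy, by rw [E_F_comm, mul_one, mul_assoc]⟩
    · rcases hy with rfl | rfl | rfl
      · exact ⟨_, hE, 1, h1, _, lT, by rw [F_F_T h, mul_one]⟩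
      · exact ⟨1, h1, _, hF, _, lF, by
          rw [mul_assoc, ← E_F_comm, ← mul_assoc, F_E_self, one_mul]⟩
      · exact ⟨1, h1, _, hE, _, lF, by rw [F_F_F h, one_mul]⟩

/-- The case of `sandwich` in which the right one of the outer generators is `τ_i`: it can be kept in
its place. -/
theorem sandwich_T (h : |(i : ℤ) - (j : ℤ)| = 1) {x z : TiedTemperleyLieb n}
    (hx : IsLetter i x) (hz : IsLetter j z) {S : Submonoid (TiedTemperleyLieb n)}
    (hS : ∀ w, IsLetter j w → w ∈ S) : ∃ a ∈ S, x * z * T i = a * T i := by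
  have h1 := S.one_mem
  have hE := hS _ (Or.inr (Or.inl rfl))
  have hF := hS _ (Or.inr (Or.inr rfl))
  rcases hz with rfl | rfl | rfl <;> rcases hx with rfl | rfl | rfl
  · exact ⟨1, h1, by rw [T_T_T h, one_mul]⟩
  · exact ⟨_, hF, E_T_T h⟩
  · exact ⟨_, hE, F_T_T h⟩
  · exact ⟨1, h1, by rw [T_E_T h, one_mul]⟩
  · exact ⟨_, hE, by rw [E_comm, mul_assoc, E_T_self]⟩
  · exact ⟨_, hE, by rw [← E_F_comm, mul_assoc, F_T_self h]⟩
  · exact ⟨1, h1, by rw [T_F_T h, one_mul]⟩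
  · exact ⟨_, hF, by rw [E_F_comm, mul_assoc, E_T_self]⟩
  · exact ⟨_, hE, F_F_T h⟩

theorem IsLetter.mul_T (h : |(i : ℤ) - (j : ℤ)| = 1) {x : TiedTemperleyLieb n}
    (hx : IsLetter i x) : x * T i = T i := by
  rcases hx with rfl | rfl | rfl
  · exact T_sq i
  · exact E_T_self i
  · exact F_T_self h

theorem IsLetter.comm_of_far (h : 1 < |(i : ℤ) - (j : ℤ)|) {x y : TiedTemperleyLieb n}
    (hx : IsLetter i x) (hy : IsLetter j y) : x * y = y * x := by
  have h' : 1 < |(j : ℤ) - (i : ℤ)| := by rwa [abs_sub_comm]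
  rcases hx with rfl | rfl | rfl <;> rcases hy with rfl | rfl | rfl
  · exact T_comm h
  · exact (E_T_comm h').symm
  · exact (F_T_comm h').symm
  · exact E_T_comm h
  · exact E_comm i j
  · exact E_F_comm i j
  · exact F_T_comm h
  · exact (E_F_comm j i).symm
  · exact F_comm h

/-! ### The tower of submonoids -/

/-- The submonoid generated by the letters with index smaller than `s`. -/
def tower (n s : ℕ) : Submonoid (TiedTemperleyLieb n) :=
  Submonoid.closure {x | ∃ i : Fin (n - 1), (i : ℕ) < s ∧ IsLetter i x}

theorem IsLetter.mem_tower {s : ℕ} {x : TiedTemperleyLieb n} (hx : IsLetter i x)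
    (hi : (i : ℕ) < s) :
    x ∈ tower n s := Submonoid.subset_closure ⟨i, hi, hx⟩

theorem T_mem_tower {s : ℕ} (hi : (i : ℕ) < s) : T i ∈ tower n s :=
  IsLetter.mem_tower (Or.inl rfl) hi

theorem E_mem_tower {s : ℕ} (hi : (i : ℕ) < s) : E i ∈ tower n s :=
  IsLetter.mem_tower (Or.inr (Or.inl rfl)) hi

theorem F_mem_tower {s : ℕ} (hi : (i : ℕ) < s) : F i ∈ tower n s :=
  IsLetter.mem_tower (Or.inr (Or.inr rfl)) hi

theorem tower_mono {s s' : ℕ} (h : s ≤ s') : tower n s ≤ tower n s' :=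
  Submonoid.closure_mono fun _ ⟨i, hi, hx⟩ => ⟨i, hi.trans_le h, hx⟩

theorem tower_zero : tower n 0 = ⊥ := by
  rw [eq_bot_iff, tower, Submonoid.closure_le]
  rintro x ⟨i, hi, -⟩
  exact absurd hi (by omega)

theorem tower_top : tower n (n - 1) = ⊤ := by
  rw [Submonoid.eq_top_iff']
  intro m
  induction m using induction_on with
  | one => exact Submonoid.one_mem _
  | mul m x ih =>
    refine Submonoid.mul_mem _ ih ?_
    rcases x with i | i | i
    · exact T_mem_tower i.2
    · exact E_mem_tower i.2
    · exact F_mem_tower i.2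

theorem rev_mem_tower {s : ℕ} {m : TiedTemperleyLieb n} (h : m ∈ tower n s) :
    rev m ∈ tower n s := by
  induction h using Submonoid.closure_induction with
  | mem x hx =>
    obtain ⟨i, hi, h⟩ := hx
    rcases h with rfl | rfl | rfl
    · exact T_mem_tower hi
    · exact E_mem_tower hi
    · exact F_mem_tower hi
  | one => exact Submonoid.one_mem _
  | mul x y _ _ h1 h2 => rw [rev_mul]; exact Submonoid.mul_mem _ h2 h1

theorem IsLetter.comm_tower {s : ℕ} (hs : s < i) {x m : TiedTemperleyLieb n} (hx : IsLetter i x)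
    (h : m ∈ tower n s) : m * x = x * m := by
  induction h using Submonoid.closure_induction with
  | mem y hy =>
    obtain ⟨j, hj, hy⟩ := hy
    refine IsLetter.comm_of_far ?_ hy hx
    rw [lt_abs]; omega
  | one => simp
  | mul a b _ _ h1 h2 => rw [mul_assoc, h2, ← mul_assoc, h1, mul_assoc]

theorem exists_adj (hn : 3 ≤ n) (i : Fin (n - 1)) :
    ∃ j : Fin (n - 1), |(i : ℤ) - (j : ℤ)| = 1 := by
  by_cases h : (i : ℕ) = 0
  · exact ⟨⟨1, by omega⟩, by rw [abs_eq zero_le_one]; dsimp only; omega⟩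
  · exact ⟨⟨i - 1, by omega⟩, by rw [abs_eq zero_le_one]; dsimp only; omega⟩

/-- Every word is equivalent to one in which the largest index occurs at most once. -/
theorem mem_tower_succ (hn : 3 ≤ n) {s : ℕ} (i : Fin (n - 1)) (hi : (i : ℕ) = s)
    {m : TiedTemperleyLieb n} (h : m ∈ tower n (s + 1)) :
    m ∈ tower n s ∨ ∃ a ∈ tower n s, ∃ b ∈ tower n s, ∃ x, IsLetter i x ∧ m = a * x * b := by
  induction s generalizing i m with
  | zero =>
    obtain ⟨k, hk⟩ := exists_adj hn i
    induction h using Submonoid.closure_induction with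
    | mem y hy =>
      obtain ⟨j, hj, hy⟩ := hy
      obtain rfl : j = i := Fin.ext (by omega)
      exact Or.inr ⟨1, Submonoid.one_mem _, 1, Submonoid.one_mem _, y, hy, by simp⟩
    | one => exact Or.inl (Submonoid.one_mem _)
    | mul x y _ _ h1 h2 =>
      simp only [tower_zero, Submonoid.mem_bot, exists_eq_left, one_mul, mul_one] at h1 h2 ⊢
      rcases h1 with rfl | ⟨x, hx, rfl⟩
      · simpa using h2
      · rcases h2 with rfl | ⟨y, hy, rfl⟩
        · exact Or.inr ⟨x, hx, by simp⟩
        · exact Or.inr ⟨_, hx.mul hk hy, rfl⟩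
  | succ s ih =>
    have hs1 : s < n - 1 := by omega
    have hij : |(i : ℤ) - ((⟨s, hs1⟩ : Fin (n - 1)) : ℤ)| = 1 := by
      rw [abs_eq zero_le_one]; dsimp only; omega
    induction h using Submonoid.closure_induction_right with
    | one => exact Or.inl (Submonoid.one_mem _)
    | mul_right m _ y hy ihm =>
      obtain ⟨j, hj, hy⟩ := hy
      by_cases hjs : (j : ℕ) < s + 1
      · have hy' : y ∈ tower n (s + 1) := hy.mem_tower hjs
        rcases ihm with hm | ⟨a, ha, b, hb, x, hx, rfl⟩
        · exact Or.inl (Submonoid.mul_mem _ hm hy')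
        · exact Or.inr ⟨a, ha, b * y, Submonoid.mul_mem _ hb hy', x, hx, by simp only [mul_assoc]⟩
      · obtain rfl : j = i := Fin.ext (by omega)
        right
        rcases ihm with hm | ⟨a, ha, b, hb, x, hx, rfl⟩
        · exact ⟨m, hm, 1, Submonoid.one_mem _, y, hy, by simp⟩
        · rcases ih ⟨s, hs1⟩ rfl hb with hb | ⟨b1, hb1, b2, hb2, z, hz, rfl⟩
          · refine ⟨a * b, Submonoid.mul_mem _ ha (tower_mono (by omega) hb), 1,
              Submonoid.one_mem _, _, hx.mul hij hy, ?_⟩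
            rw [mul_assoc a, ← hx.comm_tower (by omega) hb]
            simp only [mul_assoc, mul_one]
          · obtain ⟨a', ha', b', hb', w, hw, e⟩ := sandwich hij hx hy hz (S := tower n (s + 1))
              fun w hw => hw.mem_tower (by dsimp only; omega)
            refine ⟨a * b1 * a', Submonoid.mul_mem _ (Submonoid.mul_mem _ ha
              (tower_mono (by omega) hb1)) ha', b' * b2, Submonoid.mul_mem _ hb'
              (tower_mono (by omega) hb2), w, hw, ?_⟩
            calc a * x * (b1 * z * b2) * y = a * (x * b1) * z * (b2 * y) := by
                  simp only [mul_assoc]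
              _ = a * (b1 * x) * z * (y * b2) := by
                  rw [hx.comm_tower (by omega) hb1, hy.comm_tower (by omega) hb2]
              _ = a * b1 * (x * z * y) * b2 := by simp only [mul_assoc]
              _ = a * b1 * a' * w * (b' * b2) := by rw [e]; simp only [mul_assoc]

/-- The left ideal generated by the last `τ` is generated as a set by the smaller submonoid. -/
theorem mul_T_of_mem_tower (hn : 3 ≤ n) (i : Fin (n - 1)) {m : TiedTemperleyLieb n}
    (h : m ∈ tower n (i + 1)) : ∃ u ∈ tower n i, m * T i = u * T i := by
  obtain ⟨k, hk⟩ := exists_adj hn i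
  rcases mem_tower_succ hn i rfl h with h | ⟨a, ha, b, hb, x, hx, rfl⟩
  · exact ⟨m, h, rfl⟩
  · by_cases h0 : (i : ℕ) = 0
    · rw [h0, tower_zero, Submonoid.mem_bot] at hb
      refine ⟨a, ha, ?_⟩
      rw [hb, mul_one, mul_assoc, hx.mul_T hk]
    · obtain ⟨s, hs⟩ : ∃ s, (i : ℕ) = s + 1 := ⟨i - 1, by omega⟩
      have hs1 : s < n - 1 := by omega
      have hij : |(i : ℤ) - ((⟨s, hs1⟩ : Fin (n - 1)) : ℤ)| = 1 := by
        rw [abs_eq zero_le_one]; dsimp only; omega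
      rw [hs] at ha hb ⊢
      have lT : IsLetter i (T i) := Or.inl rfl
      rcases mem_tower_succ (s := s) hn ⟨s, hs1⟩ rfl hb with hb | ⟨b1, hb1, b2, hb2, z, hz, rfl⟩
      · refine ⟨a * b, Submonoid.mul_mem _ ha (tower_mono (by omega) hb), ?_⟩
        rw [mul_assoc a, ← hx.comm_tower (by omega) hb, mul_assoc, mul_assoc, hx.mul_T hk,
          mul_assoc]
      · obtain ⟨a', ha', e⟩ := sandwich_T hij hx hz (S := tower n (s + 1))
          fun w hw => hw.mem_tower (by dsimp only; omega)
        refine ⟨a * b1 * a' * b2, Submonoid.mul_mem _ (Submonoid.mul_mem _ (Submonoid.mul_mem _ ha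
              (tower_mono (by omega) hb1)) ha') (tower_mono (by omega) hb2), ?_⟩
        calc a * x * (b1 * z * b2) * T i = a * (x * b1) * z * (b2 * T i) := by
              simp only [mul_assoc]
          _ = a * (b1 * x) * z * (T i * b2) := by
              rw [hx.comm_tower (by omega) hb1, lT.comm_tower (by omega) hb2]
          _ = a * b1 * (x * z * T i) * b2 := by simp only [mul_assoc]
          _ = a * b1 * a' * (T i * b2) := by rw [e]; simp only [mul_assoc]
          _ = a * b1 * a' * b2 * T i := by
              rw [← lT.comm_tower (by omega) hb2]; simp only [mul_assoc]

end TiedTemperleyLieb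

namespace TiedTemperleyLieb

variable {n : ℕ}

/-! ### The homomorphism to diagrams -/

theorem ramifiedGenerator_rel {a b : FreeMonoid (TiedGenerator n)} (h : TiedRelation n a b) :
    FreeMonoid.lift ramifiedGenerator a =
      FreeMonoid.lift (ramifiedGenerator (n := n)) b := by
  apply Subtype.ext
  cases h with
  | ε_sq i => exact Prod.ext (one_mul _) (joiner_mul_self i)
  | ε_comm i j => exact Prod.ext rfl (joiner_comm i j)
  | τ_sq i => exact Prod.ext (tangle_mul_self i) (tangle_mul_self i)
  | τ_comm i j h => exact Prod.ext (tangle_comm h) (tangle_comm h)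
  | τ_τ_τ i j h =>
    exact Prod.ext (tangle_mul_tangle_mul_tangle h) (tangle_mul_tangle_mul_tangle h)
  | φ_sq i => exact Prod.ext (tangle_mul_self i) (joiner_mul_self i)
  | φ_comm i j h => exact Prod.ext (tangle_comm h) (joiner_comm i j)
  | ε_τ_self i => exact Prod.ext (one_mul _) (joiner_mul_tangle i)
  | τ_ε_self i => exact Prod.ext (mul_one _) (tangle_mul_joiner i)
  | ε_φ_comm i j => exact Prod.ext ((one_mul _).trans (mul_one _).symm) (joiner_comm i j)
  | φ_ε_self i => exact Prod.ext (mul_one _) (joiner_mul_self i)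
  | τ_φ_self i =>
    exact Prod.ext rfl ((tangle_mul_joiner i).trans (joiner_mul_tangle i).symm)
  | ε_τ_comm i j h =>
    exact Prod.ext ((one_mul _).trans (mul_one _).symm) (joiner_tangle_comm h)
  | φ_τ_comm i j h => exact Prod.ext (tangle_comm h) (joiner_tangle_comm h)
  | τ_ε_τ i j h =>
    refine Prod.ext ?_ (tangle_mul_joiner_mul_tangle h)
    exact (congrArg (· * _) (mul_one _)).trans (tangle_mul_self i)
  | φ_ε_adj i j h => exact Prod.ext ((mul_one _).trans (one_mul _).symm) (joiner_comm i j)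
  | ε_τ_ε i j h => exact Prod.ext (mul_one _).symm (joiner_mul_tangle_mul_joiner h).symm

/-- The homomorphism from the tied Temperley-Lieb monoid which sends the generators `τ_i`, `ε_i`,
`φ_i` to the pairs `t_i`, `e_i`, `f_i`. -/
def eval (n : ℕ) : TiedTemperleyLieb n →* planarRamifiedMonoid (jonesMonoid n) :=
  PresentedMonoid.lift ramifiedGenerator fun _ _ h => ramifiedGenerator_rel h

/-- The pairing in the pair of set partitions represented by an element. -/
@[reducible] def thin (m : TiedTemperleyLieb n) : SetPartition n := (eval n m).1.1

/-- The coarser set partition in the pair of set partitions represented by an element. -/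
@[reducible] def thick (m : TiedTemperleyLieb n) : SetPartition n := (eval n m).1.2

@[simp] theorem thin_one : thin (1 : TiedTemperleyLieb n) = 1 := by simp [thin]

@[simp] theorem thick_one : thick (1 : TiedTemperleyLieb n) = 1 := by simp [thick]

@[simp] theorem thin_mul (a b : TiedTemperleyLieb n) : thin (a * b) = thin a * thin b := by
  simp [thin]

@[simp] theorem thick_mul (a b : TiedTemperleyLieb n) : thick (a * b) = thick a * thick b := by
  simp [thick]

@[simp] theorem thin_T (i : Fin (n - 1)) : thin (T i) = tangle i := rfl

@[simp] theorem thick_T (i : Fin (n - 1)) : thick (T i) = tangle i := rfl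

theorem eval_eq_iff {a b : TiedTemperleyLieb n} :
    eval n a = eval n b ↔ thin a = thin b ∧ thick a = thick b := by
  rw [Subtype.ext_iff, Prod.ext_iff]

theorem thin_rev (m : TiedTemperleyLieb n) : thin (rev m) = mirror (thin m) := by
  induction m using induction_on with
  | one => rw [rev_one, thin_one, mirror_one]
  | mul m x ih =>
    rw [rev_mul, thin_mul, thin_mul, mirror_mul, ih, rev_of]
    congr 1
    rcases x with i | i | i
    · exact (mirror_tangle i).symm
    · exact mirror_one.symm
    · exact (mirror_tangle i).symm

theorem thick_rev (m : TiedTemperleyLieb n) : thick (rev m) = mirror (thick m) := by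
  induction m using induction_on with
  | one => rw [rev_one, thick_one, mirror_one]
  | mul m x ih =>
    rw [rev_mul, thick_mul, thick_mul, mirror_mul, ih, rev_of]
    congr 1
    rcases x with i | i | i
    · exact (mirror_tangle i).symm
    · exact (mirror_joiner i).symm
    · exact (mirror_joiner i).symm

theorem eval_rev_congr {a b : TiedTemperleyLieb n} (h : eval n a = eval n b) :
    eval n (rev a) = eval n (rev b) := by
  rw [eval_eq_iff] at h ⊢
  rw [thin_rev, thin_rev, thick_rev, thick_rev, h.1, h.2]
  exact ⟨rfl, rfl⟩

theorem eval_mul_rev_mul (m : TiedTemperleyLieb n) : eval n (m * rev m * m) = eval n m := by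
  rw [eval_eq_iff]
  simp only [thin_mul, thin_rev, thick_mul, thick_rev, mul_mirror_mul, and_self]

/-- Elements of the submonoid generated by the letters of small index fix the columns on the
right. -/
theorem isStraightAt_of_mem_tower {s : ℕ} {m : TiedTemperleyLieb n} (h : m ∈ tower n s) {j : Fin n}
    (hj : s < j) : (thin m).IsStraightAt j ∧ (thick m).IsStraightAt j := by
  induction h using Submonoid.closure_induction with
  | mem x hx =>
    obtain ⟨i, hi, hx⟩ := hx
    have h0 : j ≠ lo i := fun e => by rw [e, lo_val] at hj; omega
    have h1 : j ≠ SetPartition.hi i := fun e => by rw [e, hi_val] at hj; omega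
    rcases hx with rfl | rfl | rfl
    · exact ⟨tangle_isStraightAt h0 h1, tangle_isStraightAt h0 h1⟩
    · exact ⟨isStraightAt_one j, joiner_isStraightAt h0 h1⟩
    · exact ⟨tangle_isStraightAt h0 h1, joiner_isStraightAt h0 h1⟩
  | one => rw [thin_one, thick_one]; exact ⟨isStraightAt_one j, isStraightAt_one j⟩
  | mul a b _ _ ha hb =>
    rw [thin_mul, thick_mul]
    exact ⟨ha.1.mul hb.1, ha.2.mul hb.2⟩

/-! ### Faithfulness on the ideal generated by the last `τ` -/

variable {i : Fin (n - 1)}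

/-- Faithfulness on the left ideal generated by the last `τ`, by reduction to the smaller
submonoid. -/
theorem mul_T_eq_of_eval_eq (hn : 3 ≤ n) (ih : Set.InjOn (eval n) (tower n i))
    {a b : TiedTemperleyLieb n}
    (ha : a ∈ tower n (i + 1)) (hb : b ∈ tower n (i + 1))
    (h : eval n (a * T i) = eval n (b * T i)) :
    a * T i = b * T i := by
  obtain ⟨u, hu, eu⟩ := mul_T_of_mem_tower hn i ha
  obtain ⟨v, hv, ev⟩ := mul_T_of_mem_tower hn i hb
  rw [eu, ev, eval_eq_iff] at h
  simp only [thin_mul, thick_mul, thin_T, thick_T] at h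
  have hlt : (i : ℕ) < hi i := by simp
  have su := isStraightAt_of_mem_tower hu hlt
  have sv := isStraightAt_of_mem_tower hv hlt
  rw [eu, ev, ih hu hv (eval_eq_iff.2
    ⟨mul_tangle_cancel su.1 sv.1 h.1, mul_tangle_cancel su.2 sv.2 h.2⟩)]

/-- The ideal generated by the last `τ` in the submonoid generated by the letters of index at most
`i`. -/
def lastIdeal (i : Fin (n - 1)) : Set (TiedTemperleyLieb n) :=
  {m | ∃ a ∈ tower n (i + 1), ∃ b ∈ tower n (i + 1), m = a * T i * b}

theorem lastIdeal_subset {m : TiedTemperleyLieb n} (h : m ∈ lastIdeal i) :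
    m ∈ tower n (i + 1) := by
  obtain ⟨a, ha, b, hb, rfl⟩ := h
  exact Submonoid.mul_mem _ (Submonoid.mul_mem _ ha (T_mem_tower (by omega))) hb

theorem mul_mem_lastIdeal {m x : TiedTemperleyLieb n} (h : m ∈ lastIdeal i)
    (hx : x ∈ tower n (i + 1)) : m * x ∈ lastIdeal i := by
  obtain ⟨a, ha, b, hb, rfl⟩ := h
  exact ⟨a, ha, b * x, Submonoid.mul_mem _ hb hx, by simp only [mul_assoc]⟩

theorem mul_mem_lastIdeal_left {m x : TiedTemperleyLieb n} (h : m ∈ lastIdeal i)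
    (hx : x ∈ tower n (i + 1)) : x * m ∈ lastIdeal i := by
  obtain ⟨a, ha, b, hb, rfl⟩ := h
  exact ⟨x * a, Submonoid.mul_mem _ hx ha, b, hb, by simp only [mul_assoc]⟩

theorem rev_mem_lastIdeal {m : TiedTemperleyLieb n} (h : m ∈ lastIdeal i) :
    rev m ∈ lastIdeal i := by
  obtain ⟨a, ha, b, hb, rfl⟩ := h
  exact ⟨rev b, rev_mem_tower hb, rev a, rev_mem_tower ha, by simp [mul_assoc]⟩

/-- Elements with the same diagrams act in the same way on the ideal. -/
theorem mul_eq_of_eval_eq (hn : 3 ≤ n) (ih : Set.InjOn (eval n) (tower n i))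
    {a b z : TiedTemperleyLieb n} (ha : a ∈ tower n (i + 1)) (hb : b ∈ tower n (i + 1))
    (hz : z ∈ lastIdeal i) (h : eval n a = eval n b) : a * z = b * z := by
  obtain ⟨x, hx, y, -, rfl⟩ := hz
  have := mul_T_eq_of_eval_eq hn ih (Submonoid.mul_mem _ ha hx) (Submonoid.mul_mem _ hb hx)
    (by simp only [map_mul, h])
  simp only [← mul_assoc, this]

theorem mul_eq_of_eval_eq_left (hn : 3 ≤ n) (ih : Set.InjOn (eval n) (tower n i))
    {a b z : TiedTemperleyLieb n} (ha : a ∈ tower n (i + 1)) (hb : b ∈ tower n (i + 1))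
    (hz : z ∈ lastIdeal i) (h : eval n a = eval n b) : z * a = z * b := by
  have := mul_eq_of_eval_eq hn ih (rev_mem_tower ha) (rev_mem_tower hb) (rev_mem_lastIdeal hz)
    (eval_rev_congr h)
  simpa using congrArg rev this

theorem mul_rev_mul_of_mem_lastIdeal (hn : 3 ≤ n) (ih : Set.InjOn (eval n) (tower n i))
    {m : TiedTemperleyLieb n} (h : m ∈ lastIdeal i) : m * rev m * m = m := by
  have hm := lastIdeal_subset h
  obtain ⟨a, ha, b, hb, rfl⟩ := h
  have hTb : T i * b ∈ lastIdeal i := ⟨1, Submonoid.one_mem _, b, hb, by simp⟩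
  -- `z = (τ b)* (τ b)` is a right identity for `τ b`
  have hz : T i * b * (rev (T i * b) * (T i * b)) = T i * b := by
    have hb' := rev_mem_tower hb
    have e := mul_T_eq_of_eval_eq hn ih (a := rev (T i * b) * (T i * b) * rev b) (b := rev b)
      (Submonoid.mul_mem _ (Submonoid.mul_mem _ (rev_mem_tower (lastIdeal_subset hTb))
        (lastIdeal_subset hTb)) hb') hb' (by
        have := eval_mul_rev_mul (rev (T i * b))
        simpa [mul_assoc] using this)
    simpa [mul_assoc] using congrArg rev e
  have hz' : a * T i * b * (rev (T i * b) * (T i * b)) = a * T i * b := by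
    rw [mul_assoc a, mul_assoc a, hz]
  have key := mul_eq_of_eval_eq hn ih
    (Submonoid.mul_mem _ (Submonoid.mul_mem _ hm (rev_mem_tower hm)) hm) hm
    (mul_mem_lastIdeal_left hTb (rev_mem_tower (lastIdeal_subset hTb))) (eval_mul_rev_mul _)
  rwa [mul_assoc (a * T i * b * rev (a * T i * b)), hz'] at key

/-- Faithfulness on the ideal: as elements of the ideal act faithfully on it from both sides,
regularity identifies two of them with the same diagrams. -/
theorem eval_injOn_lastIdeal (hn : 3 ≤ n) (ih : Set.InjOn (eval n) (tower n i)) :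
    Set.InjOn (eval n) (lastIdeal i) := by
  intro a ha b hb h
  have ha' := lastIdeal_subset ha
  have hb' := lastIdeal_subset hb
  calc a = a * rev a * a := (mul_rev_mul_of_mem_lastIdeal hn ih ha).symm
    _ = a * rev a * b :=
        mul_eq_of_eval_eq_left hn ih ha' hb' (mul_mem_lastIdeal ha (rev_mem_tower ha')) h
    _ = a * rev b * b := by
        rw [mul_eq_of_eval_eq_left hn ih (rev_mem_tower ha') (rev_mem_tower hb') ha
          (eval_rev_congr h)]
    _ = b * rev b * b := by
        rw [mul_assoc, mul_assoc, mul_eq_of_eval_eq hn ih ha' hb'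
          (mul_mem_lastIdeal_left hb (rev_mem_tower hb')) h]
    _ = b := mul_rev_mul_of_mem_lastIdeal hn ih hb

theorem T_mem_lastIdeal {j : Fin (n - 1)} (h : (j : ℕ) ≤ i) : T j ∈ lastIdeal i := by
  obtain ⟨d, hd⟩ : ∃ d, (i : ℕ) = j + d := ⟨i - j, by omega⟩
  induction d generalizing j with
  | zero =>
    obtain rfl : i = j := Fin.ext hd
    exact ⟨1, Submonoid.one_mem _, 1, Submonoid.one_mem _, by simp⟩
  | succ d ih =>
    let k : Fin (n - 1) := ⟨j + 1, by omega⟩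
    have hk : T k ∈ lastIdeal i := ih (by dsimp only [k]; omega) (by dsimp only [k]; omega)
    have hj : T j ∈ tower n (i + 1) := T_mem_tower (by omega)
    have hjk : |(j : ℤ) - (k : ℤ)| = 1 := by rw [abs_eq zero_le_one]; dsimp only [k]; omega
    rw [← T_T_T hjk]
    exact mul_mem_lastIdeal (mul_mem_lastIdeal_left hk hj) hj

end TiedTemperleyLieb

namespace TiedTemperleyLieb

variable {n : ℕ}

/-! ### Words without `τ` -/

/-- The element represented by a word. -/
def word (l : List (TiedGenerator n)) : TiedTemperleyLieb n := (l.map (PresentedMonoid.of _)).prod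

@[simp] theorem word_nil : word ([] : List (TiedGenerator n)) = 1 := rfl

@[simp] theorem word_cons (x : TiedGenerator n) (l : List (TiedGenerator n)) :
    word (x :: l) = PresentedMonoid.of _ x * word l := by simp [word]

theorem word_append_singleton (x : TiedGenerator n) (l : List (TiedGenerator n)) :
    word (l ++ [x]) = word l * PresentedMonoid.of _ x := by simp [word]

/-- The index `i` occurs in the word, in a letter `ε_i` or `φ_i`. -/
def Touches (l : List (TiedGenerator n)) (i : Fin (n - 1)) : Prop := .e i ∈ l ∨ .f i ∈ l

/-- A word in the letters `ε` and `φ` with indices less than `s`, in which no letter has an index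
adjacent to the index of a letter `φ`. These words represent the elements outside the ideal
generated by the `τ`. -/
structure IsSparse (s : ℕ) (l : List (TiedGenerator n)) : Prop where
  not_t : ∀ i, .t i ∉ l
  lt : ∀ i, Touches l i → (i : ℕ) < s
  isolated : ∀ i j : Fin (n - 1), .f i ∈ l → |(i : ℤ) - (j : ℤ)| = 1 → ¬ Touches l j

theorem E_comm_word {l : List (TiedGenerator n)} (hl : ∀ i, .t i ∉ l) (i : Fin (n - 1)) :
    E i * word l = word l * E i := by
  induction l with
  | nil => simp
  | cons x l ih =>
    have h1 := ih fun j hj => hl j (List.mem_cons_of_mem _ hj)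
    rw [word_cons, mul_assoc, ← h1, ← mul_assoc, ← mul_assoc]
    congr 1
    rcases x with j | j | j
    · exact absurd List.mem_cons_self (hl j)
    · exact E_comm i j
    · exact E_F_comm i j

theorem F_comm_word {l : List (TiedGenerator n)} (hl : ∀ i, .t i ∉ l) {i : Fin (n - 1)}
    (hi : ∀ j : Fin (n - 1), .f j ∈ l → |(i : ℤ) - (j : ℤ)| ≠ 1) : F i * word l = word l * F i := by
  induction l with
  | nil => simp
  | cons x l ih =>
    have h1 := ih (fun j hj => hl j (List.mem_cons_of_mem _ hj))
      (fun j hj => hi j (List.mem_cons_of_mem _ hj))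
    rw [word_cons, mul_assoc, ← h1, ← mul_assoc, ← mul_assoc]
    congr 1
    rcases x with j | j | j
    · exact absurd List.mem_cons_self (hl j)
    · exact (E_F_comm j i).symm
    · by_cases e : i = j
      · rw [e]; rfl
      · refine F_comm (lt_of_le_of_ne (Int.one_le_abs ?_) (hi j List.mem_cons_self).symm)
        intro h
        exact e (Fin.ext (by omega))

theorem E_mul_word {l : List (TiedGenerator n)} (hl : ∀ i, .t i ∉ l) {i : Fin (n - 1)}
    (hi : Touches l i) : E i * word l = word l := by
  induction l with
  | nil => simp [Touches] at hi
  | cons x l ih =>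
    have hl' : ∀ j, .t j ∉ l := fun j hj => hl j (List.mem_cons_of_mem _ hj)
    by_cases h : Touches l i
    · have h1 := ih hl' h
      rw [E_comm_word hl' i] at h1
      rw [E_comm_word hl i, word_cons, mul_assoc, h1]
    · have : x = .e i ∨ x = .f i := by
        simp only [Touches, List.mem_cons] at hi h
        tauto
      rw [word_cons, ← mul_assoc]
      rcases this with rfl | rfl
      · exact congrArg (· * word l) (E_sq i)
      · exact congrArg (· * word l) (E_F_self i)

theorem word_mul_E {l : List (TiedGenerator n)} (hl : ∀ i, .t i ∉ l) {i : Fin (n - 1)}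
    (hi : Touches l i) : word l * E i = word l := by
  rw [← E_comm_word hl, E_mul_word hl hi]

theorem F_mul_word {l : List (TiedGenerator n)} (hl : ∀ i, .t i ∉ l) {i : Fin (n - 1)}
    (h : ∀ j : Fin (n - 1), .f j ∈ l → |(i : ℤ) - (j : ℤ)| ≠ 1)
    (hi : .f i ∈ l) : F i * word l = word l := by
  induction l with
  | nil => simp at hi
  | cons x l ih =>
    have hl' : ∀ j, .t j ∉ l := fun j hj => hl j (List.mem_cons_of_mem _ hj)
    have h' : ∀ j : Fin (n - 1), .f j ∈ l → |(i : ℤ) - (j : ℤ)| ≠ 1 := fun j hj =>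
      h j (List.mem_cons_of_mem _ hj)
    by_cases hm : .f i ∈ l
    · have h1 := ih hl' h' hm
      rw [F_comm_word hl' h'] at h1
      rw [F_comm_word hl h, word_cons, mul_assoc, h1]
    · obtain rfl : TiedGenerator.f i = x := by simpa [hm] using hi
      rw [word_cons, ← mul_assoc]
      exact congrArg (· * word l) (F_sq i)

theorem IsSparse.ne_one {s : ℕ} {l : List (TiedGenerator n)} (h : IsSparse s l) {i j : Fin (n - 1)}
    (hi : .f i ∈ l) (hj : .f j ∈ l) : |(i : ℤ) - (j : ℤ)| ≠ 1 :=
  fun e => h.isolated i j hi e (Or.inr hj)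

theorem IsSparse.F_mul_word {s : ℕ} {l : List (TiedGenerator n)} (h : IsSparse s l)
    {i : Fin (n - 1)} (hi : .f i ∈ l) : F i * word l = word l :=
  TiedTemperleyLieb.F_mul_word h.not_t (fun _ => h.ne_one hi) hi

theorem IsSparse.word_mul_F {s : ℕ} {l : List (TiedGenerator n)} (h : IsSparse s l)
    {i : Fin (n - 1)} (hi : .f i ∈ l) : word l * F i = word l := by
  rw [← F_comm_word h.not_t (fun _ => h.ne_one hi), h.F_mul_word hi]

/-! ### Diagrams of words without `τ` -/

theorem one_le_thick_word {l : List (TiedGenerator n)} (hl : ∀ i, .t i ∉ l) :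
    1 ≤ thick (word l) := by
  induction l with
  | nil => rw [word_nil, thick_one]
  | cons x l ih =>
    have h1 := ih fun j hj => hl j (List.mem_cons_of_mem _ hj)
    rw [word_cons, thick_mul, ← mul_one (1 : SetPartition n)]
    refine mul_mono ?_ h1
    rcases x with j | j | j
    · exact absurd List.mem_cons_self (hl j)
    · exact one_le_joiner j
    · exact one_le_joiner j

theorem thick_word_inl {l : List (TiedGenerator n)} (hl : ∀ i, .t i ∉ l) {i : Fin (n - 1)}
    (hi : Touches l i) : thick (word l) (Sum.inl (lo i)) (Sum.inl (SetPartition.hi i)) := by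
  rw [← E_mul_word hl hi, thick_mul]
  exact mul_inl_inl (joiner_inl i)

theorem IsSparse.thin_word_inl {s : ℕ} {l : List (TiedGenerator n)} (h : IsSparse s l)
    {i : Fin (n - 1)} (hi : .f i ∈ l) :
    thin (word l) (Sum.inl (lo i)) (Sum.inl (SetPartition.hi i)) := by
  rw [← h.F_mul_word hi, thin_mul]
  exact mul_inl_inl (tangle_inl i)

theorem thick_word_le_ker_of_touches {l : List (TiedGenerator n)} (hl : ∀ i, .t i ∉ l)
    {c : Fin n → Prop} (hc : ∀ i, Touches l i → c (lo i) = c (SetPartition.hi i)) :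
    thick (word l) ≤ Setoid.ker (Sum.elim c c) := by
  induction l with
  | nil => rw [word_nil, thick_one, one_le_ker]
  | cons x l ih =>
    have h1 := ih (fun j hj => hl j (List.mem_cons_of_mem _ hj))
      (fun i h => hc i (h.imp (List.mem_cons_of_mem _) (List.mem_cons_of_mem _)))
    rw [word_cons, thick_mul]
    rcases x with j | j | j
    · exact absurd List.mem_cons_self (hl j)
    · exact joiner_mul_le_ker.2 ⟨hc j (Or.inl List.mem_cons_self), h1⟩
    · exact joiner_mul_le_ker.2 ⟨hc j (Or.inr List.mem_cons_self), h1⟩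

/-- If no letter has index `i`, then the first `i` columns are separated from the others. -/
theorem thick_word_le_ker {l : List (TiedGenerator n)} (hl : ∀ i, .t i ∉ l) {i : Fin (n - 1)}
    (hi : ¬ Touches l i) : thick (word l) ≤ Setoid.ker (Sum.elim (· ≤ lo i) (· ≤ lo i)) := by
  refine thick_word_le_ker_of_touches hl fun j hj => ?_
  have : (j : ℕ) ≠ i := fun e => hi (Fin.ext e ▸ hj)
  simp only [Fin.le_def, lo_val, hi_val, eq_iff_iff]
  omega

theorem thin_word_isStraightAt {l : List (TiedGenerator n)} (hl : ∀ i, .t i ∉ l) {j : Fin n}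
    (hj : ∀ i, .f i ∈ l → j ≠ lo i ∧ j ≠ SetPartition.hi i) : (thin (word l)).IsStraightAt j := by
  induction l with
  | nil => rw [word_nil, thin_one]; exact isStraightAt_one j
  | cons x l ih =>
    have h1 := ih (fun j hj => hl j (List.mem_cons_of_mem _ hj))
      (fun i hi => hj i (List.mem_cons_of_mem _ hi))
    rw [word_cons, thin_mul]
    refine IsStraightAt.mul ?_ h1
    rcases x with i | i | i
    · exact absurd List.mem_cons_self (hl i)
    · exact isStraightAt_one j
    · exact tangle_isStraightAt (hj i List.mem_cons_self).1 (hj i List.mem_cons_self).2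

theorem eq_of_isStraightAt {K : SetPartition n} {x y : Fin n} (h : K.IsStraightAt x)
    (hxy : K (Sum.inl x) (Sum.inl y)) : y = x :=
  (show (x = x) = (y = x) from h.2 hxy) ▸ rfl

theorem IsSparse.touches_iff {s : ℕ} {l : List (TiedGenerator n)} (h : IsSparse s l)
    (i : Fin (n - 1)) :
    Touches l i ↔ thick (word l) (Sum.inl (lo i)) (Sum.inl (SetPartition.hi i)) := by
  refine ⟨thick_word_inl h.not_t, fun hJ => ?_⟩
  by_contra hi
  have : (lo i ≤ lo i) = (SetPartition.hi i ≤ lo i) := thick_word_le_ker h.not_t hi hJ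
  simp [Fin.le_def] at this

theorem adj_iff {i j : Fin (n - 1)} : |(i : ℤ) - (j : ℤ)| = 1 ↔
    (i : ℕ) + 1 = j ∨ (j : ℕ) + 1 = i := by
  rw [abs_eq zero_le_one]; omega

/-- If no `φ` acts on the columns of `i`, these columns of the pairing are vertical lines. -/
theorem thin_word_isStraightAt_pair {l : List (TiedGenerator n)} (hl : ∀ i, .t i ∉ l)
    {i : Fin (n - 1)} (hi : .f i ∉ l)
    (hadj : ∀ j : Fin (n - 1), |(i : ℤ) - (j : ℤ)| = 1 → .f j ∉ l) :
    (thin (word l)).IsStraightAt (lo i) ∧ (thin (word l)).IsStraightAt (SetPartition.hi i) := by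
  have key : ∀ j : Fin (n - 1), .f j ∈ l → (i : ℕ) ≠ j ∧ (i : ℕ) + 1 ≠ j ∧ (j : ℕ) + 1 ≠ i := by
    intro j hj
    refine ⟨fun e => hi ?_, fun e => hadj j (adj_iff.2 (Or.inl e)) hj,
      fun e => hadj j (adj_iff.2 (Or.inr e)) hj⟩
    rwa [Fin.ext e]
  constructor <;> refine thin_word_isStraightAt hl fun j hj => ?_ <;>
    have := key j hj <;> simp only [ne_eq, Fin.ext_iff, lo_val, hi_val] <;> omega

theorem IsSparse.f_mem_iff {s : ℕ} {l : List (TiedGenerator n)} (h : IsSparse s l)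
    (i : Fin (n - 1)) :
    .f i ∈ l ↔ thin (word l) (Sum.inl (lo i)) (Sum.inl (SetPartition.hi i)) := by
  refine ⟨h.thin_word_inl, fun hI => ?_⟩
  by_contra hi
  have ht : Touches l i := (h.touches_iff i).2 ((eval n (word l)).2.2.2 hI)
  have := eq_of_isStraightAt (thin_word_isStraightAt_pair h.not_t hi fun j hj hm =>
    h.isolated j i hm (by rwa [abs_sub_comm]) ht).1 hI
  exact lo_ne_hi i this.symm

theorem IsSparse.word_mul_word {s : ℕ} {l l' : List (TiedGenerator n)} (h : IsSparse s l)
    (h' : IsSparse s l') (e : eval n (word l) = eval n (word l')) :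
    word l * word l' = word l ∧ word l' * word l = word l := by
  rw [eval_eq_iff] at e
  have key : ∀ l₀ : List (TiedGenerator n), (∀ x ∈ l₀, x ∈ l') →
      word l * word l₀ = word l ∧ word l₀ * word l = word l := by
    intro l₀ hl₀
    induction l₀ with
    | nil => simp
    | cons x l₀ ih =>
      obtain ⟨h1, h2⟩ := ih fun y hy => hl₀ y (List.mem_cons_of_mem _ hy)
      have hx := hl₀ x List.mem_cons_self
      have : word l * PresentedMonoid.of _ x = word l ∧
          PresentedMonoid.of _ x * word l = word l := by
        rcases x with i | i | i
        · exact absurd hx (h'.not_t i)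
        · have : Touches l i := by
            rw [h.touches_iff, e.2, ← h'.touches_iff]; exact Or.inl hx
          exact ⟨word_mul_E h.not_t this, E_mul_word h.not_t this⟩
        · have : .f i ∈ l := by rwa [h.f_mem_iff, e.1, ← h'.f_mem_iff]
          exact ⟨h.word_mul_F this, h.F_mul_word this⟩
      rw [word_cons, ← mul_assoc, this.1, h1, mul_assoc, h2, this.2]
      exact ⟨rfl, rfl⟩
  exact key l' fun _ hx => hx

/-- A sparse word is determined, as an element of the tied Temperley-Lieb monoid, by its diagram. -/
theorem IsSparse.word_eq_word {s : ℕ} {l l' : List (TiedGenerator n)} (h : IsSparse s l)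
    (h' : IsSparse s l') (e : eval n (word l) = eval n (word l')) : word l = word l' :=
  (h.word_mul_word h' e).1.symm.trans (h'.word_mul_word h e.symm).2

/-! ### Sparse words lie outside the ideal -/

/-- The pairing `I` has a cup on two neighbouring top dots whose block in `J` contains a further top
dot or no bottom dot. This distinguishes the elements of the ideal generated by the `τ` from
those represented by sparse words. -/
def IsDegenerate (I J : SetPartition n) : Prop :=
  ∃ a : Fin (n - 1), I (Sum.inl (lo a)) (Sum.inl (hi a)) ∧
    ((∃ y, y ≠ lo a ∧ y ≠ hi a ∧ J (Sum.inl (lo a)) (Sum.inl y)) ∨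
      ∀ y, ¬ J (Sum.inl (lo a)) (Sum.inr y))

theorem IsDegenerate.mul {I J : SetPartition n} (h : IsDegenerate I J) (I' J' : SetPartition n) :
    IsDegenerate (I * I') (J * J') := by
  obtain ⟨a, ha, h⟩ := h
  refine ⟨a, mul_inl_inl ha, ?_⟩
  rcases h with ⟨y, h0, h1, h⟩ | h
  · exact Or.inl ⟨y, h0, h1, mul_inl_inl h⟩
  · right
    intro y hy
    have h1 : J * J' ≤ Setoid.ker (Sum.elim (fun x => J (Sum.inl (lo a)) (Sum.inl x))
        fun _ => False) := by
      rw [mul_le_ker]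
      refine ⟨fun _ => False, fun u v huv => ?_, fun u v huv => ?_⟩
      · have e : ∀ w : Dots n, Sum.elim (fun x => J (Sum.inl (lo a)) (Sum.inl x))
            (fun _ => False) w = J (Sum.inl (lo a)) w := by
          rintro (w | w)
          · rfl
          · exact propext ⟨False.elim, h w⟩
        show Sum.elim _ _ u = Sum.elim _ _ v
        rw [e, e]
        exact propext ⟨fun k => J.trans' k huv, fun k => J.trans' k (J.symm' huv)⟩
      · rcases u with u | u <;> rcases v with v | v <;> rfl
    have h2 : J (Sum.inl (lo a)) (Sum.inl (lo a)) = False := h1 hy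
    exact h2 ▸ J.refl' _

theorem IsSparse.not_isDegenerate {s : ℕ} {l : List (TiedGenerator n)} (h : IsSparse s l) :
    ¬ IsDegenerate (thin (word l)) (thick (word l)) := by
  rintro ⟨a, ha, hb⟩
  have hf := (h.f_mem_iff a).2 ha
  rcases hb with ⟨y, h0, h1, hy⟩ | hb
  · have h0 : (y : ℕ) ≠ a := fun e => h0 (Fin.ext e)
    have h1 : (y : ℕ) ≠ a + 1 := fun e => h1 (Fin.ext e)
    rcases lt_or_gt_of_ne h0 with h2 | h2
    · have : (lo a ≤ lo _) = (y ≤ lo _) := thick_word_le_ker h.not_t (i := ⟨a - 1, by omega⟩)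
        (h.isolated a _ hf (adj_iff.2 (Or.inr (Nat.sub_add_cancel (by omega))))) hy
      simp only [Fin.le_def, lo_val, eq_iff_iff] at this
      omega
    · have : (lo a ≤ lo _) = (y ≤ lo _) := thick_word_le_ker h.not_t (i := ⟨a + 1, by omega⟩)
        (h.isolated a _ hf (adj_iff.2 (Or.inl rfl))) hy
      simp only [Fin.le_def, lo_val, eq_iff_iff] at this
      omega
  · exact hb _ (one_le_apply (one_le_thick_word h.not_t) _)

end TiedTemperleyLieb

namespace TiedTemperleyLieb

variable {n : ℕ}

theorem le_mul_of_one_le {K L : SetPartition n} (h : 1 ≤ K) : L ≤ K * L := by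
  conv_lhs => rw [← one_mul L]
  exact mul_mono h le_rfl

/-- If the columns of `i` and the columns of an adjacent index are joined in the top row, then the
block of the columns of `i` contains a third top dot. -/
theorem exists_third_dot {K : SetPartition n} {i j : Fin (n - 1)} (h : |(i : ℤ) - (j : ℤ)| = 1)
    (hi : K (Sum.inl (lo i)) (Sum.inl (SetPartition.hi i)))
    (hj : K (Sum.inl (lo j)) (Sum.inl (SetPartition.hi j))) :
    ∃ y, y ≠ lo i ∧ y ≠ SetPartition.hi i ∧ K (Sum.inl (lo i)) (Sum.inl y) := by
  rcases adj_cases h with ⟨e, h1, h2, h3⟩ | ⟨e, h1, h2, h3⟩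
  · exact ⟨_, h2.symm, h3.symm, K.trans' hi (e ▸ hj)⟩
  · exact ⟨_, h1.symm, h2.symm, e ▸ K.symm' hj⟩

theorem IsSparse.isDegenerate_mul_E {s : ℕ} {l : List (TiedGenerator n)} (h : IsSparse s l)
    {i j : Fin (n - 1)} (hij : |(i : ℤ) - (j : ℤ)| = 1) (hj : .f j ∈ l) :
    IsDegenerate (thin (word l * E i)) (thick (word l * E i)) := by
  rw [thin_mul, thick_mul]
  exact ⟨j, mul_inl_inl (h.thin_word_inl hj), Or.inl (exists_third_dot (by rwa [abs_sub_comm])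
    (mul_inl_inl (thick_word_inl h.not_t (Or.inr hj)))
    (le_mul_of_one_le (one_le_thick_word h.not_t) (joiner_inl i)))⟩

theorem IsSparse.isDegenerate_mul_F {s : ℕ} {l : List (TiedGenerator n)} (h : IsSparse s l)
    {i j : Fin (n - 1)} (hij : |(i : ℤ) - (j : ℤ)| = 1) (hj : Touches l j) :
    IsDegenerate (thin (word l * F i)) (thick (word l * F i)) := by
  rw [thin_mul, thick_mul]
  have hi := le_mul_of_one_le (one_le_thick_word h.not_t) (joiner_inl i)
  by_cases hf : ∃ k : Fin (n - 1), |(i : ℤ) - (k : ℤ)| = 1 ∧ .f k ∈ l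
  · obtain ⟨k, hik, hk⟩ := hf
    exact ⟨k, mul_inl_inl (h.thin_word_inl hk), Or.inl (exists_third_dot (by rwa [abs_sub_comm])
      (mul_inl_inl (thick_word_inl h.not_t (Or.inr hk))) hi)⟩
  · obtain ⟨h1, h2⟩ := thin_word_isStraightAt_pair (i := i) h.not_t
      (fun hm => h.isolated i j hm hij hj) (fun k hk hm => hf ⟨k, hk, hm⟩)
    exact ⟨i, mul_inl_inl_of_bend h1.1 (tangle_inl i) h2.1,
      Or.inl (exists_third_dot hij hi (mul_inl_inl (thick_word_inl h.not_t hj)))⟩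

theorem IsSparse.isDegenerate_mul_T {s : ℕ} {l : List (TiedGenerator n)} (h : IsSparse s l)
    (i : Fin (n - 1)) : IsDegenerate (thin (word l * T i)) (thick (word l * T i)) := by
  rw [thin_mul, thick_mul]
  have hi := le_mul_of_one_le (one_le_thick_word h.not_t) (tangle_inl i)
  by_cases hf : ∃ k : Fin (n - 1), |(i : ℤ) - (k : ℤ)| = 1 ∧ .f k ∈ l
  · obtain ⟨k, hik, hk⟩ := hf
    exact ⟨k, mul_inl_inl (h.thin_word_inl hk), Or.inl (exists_third_dot (by rwa [abs_sub_comm])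
      (mul_inl_inl (thick_word_inl h.not_t (Or.inr hk))) hi)⟩
  · have cup : (thin (word l) * thin (T i)) (Sum.inl (lo i)) (Sum.inl (SetPartition.hi i)) := by
      by_cases hm : .f i ∈ l
      · exact mul_inl_inl (h.thin_word_inl hm)
      · obtain ⟨h1, h2⟩ := thin_word_isStraightAt_pair (i := i) h.not_t hm
          (fun k hk hm => hf ⟨k, hk, hm⟩)
        exact mul_inl_inl_of_bend h1.1 (tangle_inl i) h2.1
    refine ⟨i, cup, ?_⟩
    by_cases hj : ∃ j : Fin (n - 1), |(i : ℤ) - (j : ℤ)| = 1 ∧ Touches l j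
    · obtain ⟨j, hij, hj⟩ := hj
      exact Or.inl (exists_third_dot hij hi (mul_inl_inl (thick_word_inl h.not_t hj)))
    · -- nothing is attached to the two columns of `i`, so `τ_i` closes their block
      right
      intro y hy
      have h1 : thick (word l) ≤ Setoid.ker (Sum.elim (fun x => x = lo i ∨ x = SetPartition.hi i)
          (fun x => x = lo i ∨ x = SetPartition.hi i)) := by
        refine thick_word_le_ker_of_touches h.not_t fun j hj' => ?_
        have : |(i : ℤ) - (j : ℤ)| ≠ 1 := fun e => hj ⟨j, e, hj'⟩
        rw [ne_eq, adj_iff] at this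
        simp only [Fin.ext_iff, lo_val, hi_val, eq_iff_iff]
        omega
      have h2 : thick (word l) * tangle i ≤ Setoid.ker (Sum.elim
          (fun x => x = lo i ∨ x = SetPartition.hi i) (fun _ => False)) := by
        refine mul_tangle_le_ker.2 ⟨rfl, True, ?_⟩
        convert h1 using 4
        simp [recolour]
      have h3 : (lo i = lo i ∨ lo i = SetPartition.hi i) = False := h2 hy
      simp at h3

theorem IsSparse.append_E {s : ℕ} {l : List (TiedGenerator n)} (h : IsSparse s l)
    {i : Fin (n - 1)} (hi : (i : ℕ) < s)
    (hf : ∀ j : Fin (n - 1), |(i : ℤ) - (j : ℤ)| = 1 → .f j ∉ l) : IsSparse s (l ++ [.e i]) := by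
  refine ⟨fun j hj => ?_, fun j hj => ?_, fun j k hj hjk hk => ?_⟩
  · simp [h.not_t] at hj
  · simp only [Touches, List.mem_append, List.mem_singleton, TiedGenerator.e.injEq, reduceCtorEq,
      or_false] at hj
    rcases hj with (hj | rfl) | hj
    · exact h.lt j (Or.inl hj)
    · exact hi
    · exact h.lt j (Or.inr hj)
  · simp only [Touches, List.mem_append, List.mem_singleton, TiedGenerator.e.injEq, reduceCtorEq,
      or_false] at hj hk
    rcases hk with (hk | rfl) | hk
    · exact h.isolated j k hj hjk (Or.inl hk)
    · exact hf j (by rwa [abs_sub_comm]) hj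
    · exact h.isolated j k hj hjk (Or.inr hk)

theorem IsSparse.append_F {s : ℕ} {l : List (TiedGenerator n)} (h : IsSparse s l)
    {i : Fin (n - 1)} (hi : (i : ℕ) < s)
    (hf : ∀ j : Fin (n - 1), |(i : ℤ) - (j : ℤ)| = 1 → ¬ Touches l j) :
    IsSparse s (l ++ [.f i]) := by
  refine ⟨fun j hj => ?_, fun j hj => ?_, fun j k hj hjk hk => ?_⟩
  · simp [h.not_t] at hj
  · simp only [Touches, List.mem_append, List.mem_singleton, TiedGenerator.f.injEq, reduceCtorEq,
      or_false] at hj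
    rcases hj with hj | hj | rfl
    · exact h.lt j (Or.inl hj)
    · exact h.lt j (Or.inr hj)
    · exact hi
  · simp only [Touches, List.mem_append, List.mem_singleton, TiedGenerator.f.injEq, reduceCtorEq,
      or_false] at hj hk
    rcases hj with hj | rfl
    · rcases hk with hk | hk | rfl
      · exact h.isolated j k hj hjk (Or.inl hk)
      · exact h.isolated j k hj hjk (Or.inr hk)
      · exact hf j (by rwa [abs_sub_comm]) (Or.inr hj)
    · rcases hk with hk | hk | rfl
      · exact hf k hjk (Or.inl hk)
      · exact hf k hjk (Or.inr hk)
      · simp at hjk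

/-- Every element is represented by a sparse word, or lies in the ideal generated by the `τ` and
has a degenerate diagram. -/
theorem isSparse_or_isDegenerate {i : Fin (n - 1)} {m : TiedTemperleyLieb n}
    (h : m ∈ tower n (i + 1)) :
    (∃ l, IsSparse (i + 1) l ∧ m = word l) ∨
      (m ∈ lastIdeal i ∧ IsDegenerate (thin m) (thick m)) := by
  induction h using Submonoid.closure_induction_right with
  | one => exact Or.inl ⟨[], ⟨by simp, by simp [Touches], by simp⟩, rfl⟩
  | mul_right m hm x hx ih =>
    obtain ⟨j, hj, hx⟩ := hx
    have hx' := hx.mem_tower hj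
    rcases ih with ⟨l, hl, rfl⟩ | ⟨h1, h2⟩
    · have hE : ∀ k : Fin (n - 1), |(j : ℤ) - (k : ℤ)| = 1 → Touches l k →
          F k * E j ∈ lastIdeal i := fun k hjk hk => by
        have hk' := hl.lt k hk
        have hEj := E_mem_tower hj
        rw [← E_T_E (by rwa [abs_sub_comm])]
        exact mul_mem_lastIdeal (mul_mem_lastIdeal_left (T_mem_lastIdeal (by omega)) hEj) hEj
      rcases hx with rfl | rfl | rfl
      · exact Or.inr ⟨mul_mem_lastIdeal_left (T_mem_lastIdeal (by omega)) hm,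
          hl.isDegenerate_mul_T j⟩
      · by_cases hf : ∃ k : Fin (n - 1), |(j : ℤ) - (k : ℤ)| = 1 ∧ .f k ∈ l
        · obtain ⟨k, hjk, hk⟩ := hf
          refine Or.inr ⟨?_, hl.isDegenerate_mul_E hjk hk⟩
          rw [← hl.word_mul_F hk, mul_assoc]
          exact mul_mem_lastIdeal_left (hE k hjk (Or.inr hk)) hm
        · exact Or.inl ⟨_, hl.append_E hj fun k hjk hk => hf ⟨k, hjk, hk⟩,
            (word_append_singleton _ _).symm⟩
      · by_cases hf : ∃ k : Fin (n - 1), |(j : ℤ) - (k : ℤ)| = 1 ∧ Touches l k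
        · obtain ⟨k, hjk, hk⟩ := hf
          refine Or.inr ⟨?_, hl.isDegenerate_mul_F hjk hk⟩
          have hk' := hl.lt k hk
          have hEk := E_mem_tower hk'
          rw [← word_mul_E hl.not_t hk, mul_assoc, E_F_comm, ← E_T_E hjk]
          exact mul_mem_lastIdeal_left (mul_mem_lastIdeal (mul_mem_lastIdeal_left
            (T_mem_lastIdeal (by omega)) hEk) hEk) hm
        · exact Or.inl ⟨_, hl.append_F hj fun k hjk hk => hf ⟨k, hjk, hk⟩,
            (word_append_singleton _ _).symm⟩
    · refine Or.inr ⟨mul_mem_lastIdeal h1 hx', ?_⟩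
      rw [thin_mul, thick_mul]
      exact h2.mul _ _

/-- Faithfulness on the tower: elements with degenerate diagrams lie in the ideal, where the previous
step of the induction applies, and all others are sparse words. -/
theorem eval_injOn_tower (hn : 3 ≤ n) {s : ℕ} (hs : s ≤ n - 1) :
    Set.InjOn (eval n) (tower n s) := by
  induction s with
  | zero =>
    intro a ha b hb _
    rw [tower_zero] at ha hb
    rw [Submonoid.mem_bot.1 ha, Submonoid.mem_bot.1 hb]
  | succ s ih =>
    let i : Fin (n - 1) := ⟨s, hs⟩
    have ih' : Set.InjOn (eval n) (tower n i) := ih (by omega)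
    intro a ha b hb h
    have h' := eval_eq_iff.1 h
    rcases isSparse_or_isDegenerate (i := i) ha with ⟨l, hl, rfl⟩ | ⟨h1, h2⟩ <;>
      rcases isSparse_or_isDegenerate (i := i) hb with ⟨l', hl', rfl⟩ | ⟨k1, k2⟩
    · exact hl.word_eq_word hl' h
    · rw [← h'.1, ← h'.2] at k2
      exact absurd k2 hl.not_isDegenerate
    · rw [h'.1, h'.2] at h2
      exact absurd h2 hl'.not_isDegenerate
    · exact eval_injOn_lastIdeal hn ih' h1 k1 h

theorem eval_injective (hn : 3 ≤ n) : Function.Injective (eval n) := by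
  have := eval_injOn_tower hn le_rfl
  rw [tower_top] at this
  exact fun a b h => this (Submonoid.mem_top a) (Submonoid.mem_top b) h

end TiedTemperleyLieb

namespace SetPartition

variable {n : ℕ}

/-! ### Replacing the last columns of a diagram by vertical lines -/

/-- The column of a dot. -/
def col : Dots n → Fin n := Sum.elim id id

@[simp] theorem col_inl (j : Fin n) : col (Sum.inl j : Dots n) = j := rfl

@[simp] theorem col_inr (j : Fin n) : col (Sum.inr j : Dots n) = j := rfl

/-- The colouring of the dots whose colour classes are the blocks of `graft s ρ K`. -/
def graftColour (s : ℕ) (ρ : Dots n → Dots n) (K : SetPartition n) (x : Dots n) :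
    Quotient K ⊕ Fin n :=
  if (col x : ℕ) < s then Sum.inl (Quotient.mk K (ρ x)) else Sum.inr (col x)

/-- The set partition which on the first `s` columns is the pullback of `K` along `ρ` and whose
other columns are vertical lines. -/
@[reducible] def graft (s : ℕ) (ρ : Dots n → Dots n) (K : SetPartition n) : SetPartition n :=
  Setoid.ker (graftColour s ρ K)

variable {s : ℕ} {ρ : Dots n → Dots n} {K : SetPartition n}

theorem graft_apply {x y : Dots n} : graft s ρ K x y ↔
    ((col x : ℕ) < s ∧ (col y : ℕ) < s ∧ K (ρ x) (ρ y)) ∨ (s ≤ (col x : ℕ) ∧ col x = col y) := by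
  show graftColour s ρ K x = graftColour s ρ K y ↔ _
  unfold graftColour
  split_ifs with h1 h2 h2
  · rw [Sum.inl.injEq, Quotient.eq]
    simp [h1, h2]
  · simp only [false_iff]
    rintro (⟨-, h, -⟩ | ⟨h, -⟩) <;> omega
  · simp only [false_iff]
    rintro (⟨h, -⟩ | ⟨-, h⟩)
    · omega
    · rw [h] at h1; omega
  · rw [Sum.inr.injEq]
    constructor
    · exact fun h => Or.inr ⟨by omega, h⟩
    · rintro (⟨h, -⟩ | ⟨-, h⟩)
      · omega
      · exact h

theorem graft_mono {L : SetPartition n} (h : K ≤ L) : graft s ρ K ≤ graft s ρ L := by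
  intro x y hxy
  rw [graft_apply] at hxy ⊢
  exact hxy.imp_left fun ⟨h1, h2, h3⟩ => ⟨h1, h2, h h3⟩

theorem graft_isStraightAt {j : Fin n} (hj : s ≤ j) : (graft s ρ K).IsStraightAt j := by
  refine ⟨graft_apply.2 (Or.inr ⟨hj, rfl⟩), fun x y hxy => ?_⟩
  have key : ∀ z : Dots n, Sum.elim (· = j) (· = j) z = (col z = j) := by
    rintro (z | z) <;> rfl
  show Sum.elim (· = j) (· = j) x = Sum.elim (· = j) (· = j) y
  rw [key, key]
  rcases graft_apply.1 hxy with ⟨h1, h2, -⟩ | ⟨-, h⟩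
  · refine propext ⟨fun e => absurd (congrArg Fin.val e) ?_,
      fun e => absurd (congrArg Fin.val e) ?_⟩ <;> omega
  · rw [h]

theorem graft_le_ker {a b : Fin n → Prop} : graft s ρ K ≤ Setoid.ker (Sum.elim a b) ↔
    (∀ x y, (col x : ℕ) < s → (col y : ℕ) < s → K (ρ x) (ρ y) →
      Sum.elim a b x = Sum.elim a b y) ∧ ∀ j : Fin n, s ≤ j → a j = b j := by
  constructor
  · intro h
    exact ⟨fun x y hx hy hxy => h (graft_apply.2 (Or.inl ⟨hx, hy, hxy⟩)),
      fun j hj => (graft_isStraightAt hj).eq_of_le_ker h⟩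
  · rintro ⟨h1, h2⟩ x y hxy
    rcases graft_apply.1 hxy with ⟨hx, hy, h⟩ | ⟨hx, h⟩
    · exact h1 x y hx hy h
    · show Sum.elim a b x = Sum.elim a b y
      rcases x with x | x <;> rcases y with y | y <;> (obtain rfl : x = y := h)
      · rfl
      · exact h2 _ hx
      · exact (h2 _ hx).symm
      · rfl

/-- The dots strictly between the two ends of a vertical line lie further to the right. -/
theorem lt_col_of_between {x y z : Dots n} (h : col x = col z) (hxy : pos x < pos y)
    (hyz : pos y < pos z) : (col x : ℕ) < col y := by
  rcases x with x | x <;> rcases y with y | y <;> rcases z with z | z <;>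
    simp only [col_inl, col_inr, pos] at * <;> subst h <;> omega

/-- The grafted diagram is planar if `ρ` preserves the boundary order: the vertical lines lie to the
right of everything else. -/
theorem graft_isPlanar (hK : K.IsPlanar) (hρ : ∀ x y, (col x : ℕ) < s → (col y : ℕ) < s →
    pos x < pos y → pos (ρ x) < pos (ρ y)) : (graft s ρ K).IsPlanar := by
  intro a b c d hab hbc hcd hac hbd
  rcases graft_apply.1 hac with ⟨ha, hc, h⟩ | ⟨ha, h⟩
  · rcases graft_apply.1 hbd with ⟨hb, hd, h'⟩ | ⟨hb, h'⟩
    · exact graft_apply.2 (Or.inl ⟨ha, hb, hK _ _ _ _ (hρ _ _ ha hb hab) (hρ _ _ hb hc hbc)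
        (hρ _ _ hc hd hcd) h h'⟩)
    · have := lt_col_of_between h' hbc hcd
      omega
  · have h1 := lt_col_of_between h hab hbc
    rcases graft_apply.1 hbd with ⟨hb, -, -⟩ | ⟨-, h'⟩
    · omega
    · have h2 := lt_col_of_between h' hbc hcd
      rw [h] at h1; omega

theorem graft_isPairing (hK : K.IsPairing) (hρ : ∀ x y, (col x : ℕ) < s → (col y : ℕ) < s →
    ρ x = ρ y → x = y) (hρ' : ∀ x z, (col x : ℕ) < s → K (ρ x) z → ∃ y, (col y : ℕ) < s ∧ ρ y = z) :
    (graft s ρ K).IsPairing := by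
  obtain ⟨f, hf, hf', -⟩ := hK.exists_partner
  refine isPairing_of_partner fun x => ?_
  by_cases hx : (col x : ℕ) < s
  · obtain ⟨y, hy, hyx⟩ := hρ' x (f (ρ x)) hx ((hf _ _).2 (Or.inr rfl))
    refine ⟨y, fun e => hf' (ρ x) (by rw [← hyx, e]), fun z => ?_⟩
    rw [graft_apply, hf, ← hyx]
    constructor
    · rintro (⟨-, hz, h | h⟩ | ⟨h, -⟩)
      · exact Or.inl (hρ _ _ hz hx h)
      · exact Or.inr (hρ _ _ hz hy h)
      · omega
    · rintro (rfl | rfl)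
      · exact Or.inl ⟨hx, hx, Or.inl rfl⟩
      · exact Or.inl ⟨hx, hy, Or.inr rfl⟩
  · refine ⟨x.swap, by rcases x with x | x <;> simp, fun z => ?_⟩
    rw [graft_apply]
    have hx' : s ≤ (col x : ℕ) := not_lt.1 hx
    simp only [hx, hx', false_and, false_or, true_and]
    rcases x with x | x <;> rcases z with z | z <;> simp [eq_comm]

theorem straight_apply {j : Fin n} (hK : K.IsStraightAt j) {x y : Dots n} (hx : col x = j)
    (h : K x y) : col y = j := by
  have h' : Sum.elim (· = j) (· = j) x = Sum.elim (· = j) (· = j) y := hK.2 h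
  have key : ∀ z : Dots n, Sum.elim (· = j) (· = j) z = (col z = j) := by
    rintro (z | z) <;> rfl
  rw [key, key] at h'
  exact h' ▸ hx

/-- A pairing finer than a diagram with a straight column has that straight column. -/
theorem IsPairing.isStraightAt {I : SetPartition n} (hI : I.IsPairing) {J : SetPartition n}
    (h : I ≤ J) {j : Fin n} (hj : J.IsStraightAt j) : I.IsStraightAt j := by
  obtain ⟨f, hf, hf', -⟩ := hI.exists_partner
  have h1 : I (Sum.inl j) (f (Sum.inl j)) := (hf _ _).2 (Or.inr rfl)
  have h2 := straight_apply hj rfl (h h1)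
  refine ⟨?_, fun x y hxy => hj.2 (h hxy)⟩
  rcases e : f (Sum.inl j) with k | k
  · rw [e] at h2
    exact absurd (e.trans (congrArg _ h2)) (hf' _)
  · rw [e] at h1 h2
    rwa [show k = j from h2] at h1

theorem mul_tangle_eq_self {i : Fin (n - 1)} (h : K (Sum.inr (lo i)) (Sum.inr (hi i)))
    (h' : ∀ z, K (Sum.inr (lo i)) z → z = Sum.inr (lo i) ∨ z = Sum.inr (hi i)) :
    K * tangle i = K := by
  have iso : ∀ x y, K x y → (x = Sum.inr (lo i) ∨ x = Sum.inr (hi i)) →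
      (y = Sum.inr (lo i) ∨ y = Sum.inr (hi i)) := by
    rintro x y hxy (rfl | rfl)
    · exact h' _ hxy
    · exact h' _ (K.trans' h hxy)
  refine ext_ker fun a b => ?_
  rw [mul_tangle_le_ker]
  constructor
  · rintro ⟨hb, v, hv⟩ x y hxy
    have hv := hv hxy
    have key : ∀ z : Dots n, ¬ (z = Sum.inr (lo i) ∨ z = Sum.inr (hi i)) →
        Sum.elim a (recolour b i v) z = Sum.elim a b z := by
      rintro (z | z) hz
      · rfl
      · exact recolour_of_ne _ _ (fun e => hz (Or.inl (congrArg _ e)))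
          (fun e => hz (Or.inr (congrArg _ e)))
    have key' : ∀ z : Dots n, (z = Sum.inr (lo i) ∨ z = Sum.inr (hi i)) →
        Sum.elim a b z = b (lo i) := by
      rintro _ (rfl | rfl)
      · rfl
      · exact hb.symm
    show Sum.elim a b x = Sum.elim a b y
    by_cases hx : x = Sum.inr (lo i) ∨ x = Sum.inr (hi i)
    · rw [key' x hx, key' y (iso x y hxy hx)]
    · rw [← key x hx, ← key y fun hy => hx (iso y x (K.symm' hxy) hy)]
      exact hv
  · intro hab
    have hb : b (lo i) = b (hi i) := hab h
    exact ⟨hb, b (lo i), by rwa [recolour_self hb]⟩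

theorem mul_joiner_eq_self {i : Fin (n - 1)} (h : K (Sum.inr (lo i)) (Sum.inr (hi i))) :
    K * joiner i = K := by
  refine ext_ker fun a b => ?_
  rw [mul_joiner_le_ker]
  exact ⟨fun h => h.2, fun hab => ⟨hab h, hab⟩⟩

/-- The relabelling of the dots which bends column `i + 1` of the top row down: it is the dot at the
place of the bottom dot `i`. For a diagram ending in the tangle `i` it undoes the multiplication by
this tangle, see `graft_bend_mul_tangle`. -/
def bend (i : Fin (n - 1)) (x : Dots n) : Dots n :=
  if x = Sum.inr (lo i) then Sum.inl (hi i) else x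

theorem bend_pos_lt {i : Fin (n - 1)} (x y : Dots n) (hx : (col x : ℕ) < i + 1)
    (hy : (col y : ℕ) < i + 1) (h : pos x < pos y) : pos (bend i x) < pos (bend i y) := by
  have := i.2
  unfold bend
  split_ifs with h1 h2 h2
  · rw [h1, h2] at h; omega
  · subst h1
    rcases y with y | y <;> simp only [pos, lo_val, hi_val, col_inl, col_inr] at * <;> omega
  · subst h2
    rcases x with x | x
    · simp only [pos, hi_val, col_inl] at *; omega
    · have : (x : ℕ) ≠ i := fun e => h1 (congrArg _ (Fin.ext e))
      simp only [pos, lo_val, hi_val, col_inr] at *; omega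
  · exact h

theorem bend_inj {i : Fin (n - 1)} (x y : Dots n) (hx : (col x : ℕ) < i + 1)
    (hy : (col y : ℕ) < i + 1) (h : bend i x = bend i y) : x = y := by
  rcases lt_trichotomy (pos x) (pos y) with h' | h' | h'
  · have := bend_pos_lt x y hx hy h'; rw [h] at this; omega
  · exact pos_injective h'
  · have := bend_pos_lt y x hy hx h'; rw [h] at this; omega

/-- In a diagram which ends in the tangle `i`, the bottom dots of the columns of `i` are separated from
all other dots. -/
theorem mem_pair_eq_of_mul_tangle {i : Fin (n - 1)} (hK : K * tangle i = K) {x y : Dots n}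
    (hxy : K x y) : (x = Sum.inr (lo i) ∨ x = Sum.inr (hi i)) =
      (y = Sum.inr (lo i) ∨ y = Sum.inr (hi i)) := by
  have h : K * tangle i ≤ Setoid.ker (Sum.elim (fun _ => False)
      (fun k => k = lo i ∨ k = hi i)) := by
    rw [mul_tangle_le_ker]
    refine ⟨by simp, False, ?_⟩
    intro u v _
    show Sum.elim _ _ u = Sum.elim _ _ v
    have : ∀ w : Dots n, Sum.elim (fun _ => False) (recolour (fun k => k = lo i ∨ k = hi i) i False) w
        = False := by
      rintro (w | w)
      · rfl
      · simp only [Sum.elim_inr, recolour]; split_ifs <;> simp_all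
    rw [this, this]
  rw [hK] at h
  have key : ∀ w : Dots n, Sum.elim (fun _ => False) (fun k => k = lo i ∨ k = hi i) w =
      (w = Sum.inr (lo i) ∨ w = Sum.inr (hi i)) := by
    rintro (w | w) <;> simp
  have := h hxy
  rw [← key x, ← key y]
  exact this

theorem exists_bend_eq {i : Fin (n - 1)} {x : Dots n} (hx : (col x : ℕ) ≤ i + 1)
    (h : ¬ (x = Sum.inr (lo i) ∨ x = Sum.inr (hi i))) :
    ∃ y, (col y : ℕ) < i + 1 ∧ bend i y = x := by
  have key : ∀ x : Dots n, (col x : ℕ) < i + 1 → x ≠ Sum.inr (lo i) →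
      ∃ y, (col y : ℕ) < i + 1 ∧ bend i y = x := fun x h h' => ⟨x, h, if_neg h'⟩
  by_cases h1 : (col x : ℕ) < i + 1
  · exact key x h1 fun e => h (Or.inl e)
  · rcases x with x | x
    · refine ⟨Sum.inr (lo i), by simp, ?_⟩
      rw [bend, if_pos rfl]
      exact congrArg _ (Fin.ext (by simp only [col_inl, hi_val] at *; omega))
    · exact absurd (Or.inr (congrArg _ (Fin.ext (by simp only [col_inr, hi_val] at *; omega)))) h

/-- A diagram which ends in the tangle `i`, and whose columns to the right of those of `i` are straight,
is the product with this tangle of the diagram bent down. -/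
theorem graft_bend_mul_tangle {i : Fin (n - 1)} (hK : K * tangle i = K)
    (hs : ∀ j : Fin n, (i : ℕ) + 2 ≤ j → K.IsStraightAt j) :
    graft (i + 1) (bend i) K * tangle i = K := by
  conv_rhs => rw [← hK]
  refine ext_ker fun a b => ?_
  rw [mul_tangle_le_ker, mul_tangle_le_ker]
  refine and_congr_right fun hb => ?_
  have hr : ∀ v, ∀ j : Fin n, (i : ℕ) + 2 ≤ j → recolour b i v j = b j := fun v j hj =>
    recolour_of_ne _ _ (fun e => by rw [e, lo_val] at hj; omega)
      (fun e => by rw [e, hi_val] at hj; omega)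
  -- a colouring of the bent diagram and the corresponding colouring of `K`
  have hc : ∀ v, ∀ x : Dots n, (col x : ℕ) < i + 1 →
      Sum.elim a (recolour b i (a (hi i))) x = Sum.elim a (recolour b i v) (bend i x) := by
    intro v x hx
    by_cases h : x = Sum.inr (lo i)
    · rw [bend, if_pos h, h]; simp
    · rw [bend, if_neg h]
      rcases x with x | x
      · rfl
      · have h0 : x ≠ lo i := fun e => h (congrArg _ e)
        have h1 : x ≠ hi i := fun e => by rw [e, col_inr, hi_val] at hx; omega
        rw [Sum.elim_inr, Sum.elim_inr, recolour_of_ne _ _ h0 h1, recolour_of_ne _ _ h0 h1]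
  constructor
  · rintro ⟨v, hv⟩
    have e : v = a (hi i) := by
      have := (graft_le_ker.1 hv).2 (hi i) (by simp)
      rw [this, recolour_hi]
    subst e
    obtain ⟨h1, h2⟩ := graft_le_ker.1 hv
    refine ⟨True, fun x y hxy => ?_⟩
    show Sum.elim a (recolour b i True) x = Sum.elim a (recolour b i True) y
    have hm := mem_pair_eq_of_mul_tangle hK hxy
    by_cases hx : x = Sum.inr (lo i) ∨ x = Sum.inr (hi i)
    · have hy := hm ▸ hx
      have key : ∀ z : Dots n, (z = Sum.inr (lo i) ∨ z = Sum.inr (hi i)) →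
          Sum.elim a (recolour b i True) z = True := by
        rintro _ (rfl | rfl) <;> simp
      rw [key x hx, key y hy]
    · have hy : ¬ (y = Sum.inr (lo i) ∨ y = Sum.inr (hi i)) := hm ▸ hx
      by_cases hcx : (i : ℕ) + 2 ≤ col x
      · have hcy := straight_apply (hs _ hcx) rfl hxy
        have h3 := h2 (col x) (by omega)
        rw [hr _ _ hcx] at h3
        have key : ∀ z : Dots n, col z = col x →
            Sum.elim a (recolour b i True) z = a (col x) := by
          rintro (z | z) hz
          · exact congrArg a hz
          · rw [h3, ← hr True _ hcx]; exact congrArg (recolour b i True) hz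
        rw [key x rfl, key y hcy]
      · have hcy : ¬ (i : ℕ) + 2 ≤ col y := fun h =>
          hcx (by rw [straight_apply (hs _ h) rfl (K.symm' hxy)]; exact h)
        obtain ⟨x', hx', rfl⟩ := exists_bend_eq (by omega) hx
        obtain ⟨y', hy', rfl⟩ := exists_bend_eq (by omega) hy
        rw [← hc True x' hx', ← hc True y' hy']
        exact h1 x' y' hx' hy' hxy
  · rintro ⟨v, hv⟩
    refine ⟨a (hi i), graft_le_ker.2 ⟨fun x y hx hy hxy => ?_, fun j hj => ?_⟩⟩
    · rw [hc v x hx, hc v y hy]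
      exact hv hxy
    · by_cases h : j = hi i
      · rw [h, recolour_hi]
      · have hj' : (i : ℕ) + 2 ≤ j := by
          have : (j : ℕ) ≠ i + 1 := fun e => h (Fin.ext e)
          omega
        rw [hr _ _ hj', (hs j hj').eq_of_le_ker hv, hr _ _ hj']

end SetPartition

namespace SetPartition

variable {n : ℕ}

/-! ### Caps -/

/-- In a planar diagram the blocks which meet the gap between two dots of a bottom block, without
meeting that block, are contained in the gap. -/
theorem IsPlanar.mem_gap {K : SetPartition n} (hK : K.IsPlanar) {a b c : Fin n}
    (hab : K (Sum.inr a) (Sum.inr b)) (hac : a < c) (hcb : c < b)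
    (h : ¬ K (Sum.inr a) (Sum.inr c)) {z : Dots n} (hz : K (Sum.inr c) z) :
    ∃ d, z = Sum.inr d ∧ a < d ∧ d < b := by
  have h1 : pos (Sum.inr b : Dots n) < pos (Sum.inr c : Dots n) := by
    simp only [pos]; rw [Fin.lt_def] at *; omega
  have h2 : pos (Sum.inr c : Dots n) < pos (Sum.inr a : Dots n) := by
    simp only [pos]; rw [Fin.lt_def] at *; omega
  have hza : pos z ≠ pos (Sum.inr a : Dots n) := fun e =>
    h (K.symm' (pos_injective e ▸ hz))
  have hzb : pos z ≠ pos (Sum.inr b : Dots n) := fun e =>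
    h (K.trans' hab (K.symm' (pos_injective e ▸ hz)))
  have h3 : pos (Sum.inr b : Dots n) < pos z := by
    by_contra h3
    have := hK z (Sum.inr b) (Sum.inr c) (Sum.inr a) (by omega) h1 h2 (K.symm' hz) (K.symm' hab)
    exact h (K.trans' hab (K.trans' (K.symm' this) (K.symm' hz)))
  have h4 : pos z < pos (Sum.inr a : Dots n) := by
    by_contra h4
    have := hK (Sum.inr b) (Sum.inr c) (Sum.inr a) z h1 h2 (by omega) (K.symm' hab) hz
    exact h (K.trans' hab this)
  rcases z with d | d
  · simp only [pos] at h3; omega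
  · refine ⟨d, rfl, ?_, ?_⟩ <;> simp only [pos] at h3 h4 <;> rw [Fin.lt_def] <;> omega

theorem IsPairing.eq_of_apply {I : SetPartition n} (hI : I.IsPairing) {x y z : Dots n}
    (hxy : I x y) (hxz : I x z) (hy : y ≠ x) (hz : z ≠ x) : y = z := by
  obtain ⟨f, hf, -, -⟩ := hI.exists_partner
  rw [((hf x y).1 hxy).resolve_left hy, ((hf x z).1 hxz).resolve_left hz]

/-- Below every arc between bottom dots there is a cap on two neighbouring dots. -/
theorem exists_cap {I : SetPartition n} (hI : I.IsPlanar) (hI' : I.IsPairing) {a b : Fin n}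
    (hab : I (Sum.inr a) (Sum.inr b)) (h : a < b) :
    ∃ k : Fin (n - 1), a ≤ lo k ∧ hi k ≤ b ∧ I (Sum.inr (lo k)) (Sum.inr (hi k)) := by
  induction hd : (b : ℕ) - a using Nat.strong_induction_on generalizing a b with
  | _ d ih =>
    by_cases h1 : (a : ℕ) + 1 = b
    · have e : hi ⟨a, by omega⟩ = b := Fin.ext h1
      exact ⟨⟨a, by omega⟩, le_rfl, e.le, e ▸ hab⟩
    · have hlt : (a : ℕ) < b := h
      have hc : (a : ℕ) + 1 < n := by omega
      have hac : a < ⟨a + 1, hc⟩ := by rw [Fin.lt_def]; simp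
      have hcb : (⟨a + 1, hc⟩ : Fin n) < b := by rw [Fin.lt_def]; dsimp only; omega
      have hn : ¬ I (Sum.inr a) (Sum.inr ⟨a + 1, hc⟩) := fun hh => by
        have := hI'.eq_of_apply hab hh (by simpa using h.ne') (by simpa using hac.ne')
        rw [Sum.inr.injEq] at this
        exact hcb.ne this.symm
      obtain ⟨f, hf, hf', -⟩ := hI'.exists_partner
      obtain ⟨e, he, hae, heb⟩ := hI.mem_gap hab hac hcb hn ((hf _ (f _)).2 (Or.inr rfl))
      have hce := (hf (Sum.inr ⟨a + 1, hc⟩) (f (Sum.inr ⟨a + 1, hc⟩))).2 (Or.inr rfl)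
      rw [he] at hce
      have hne : (e : ℕ) ≠ a + 1 := fun h => hf' (Sum.inr ⟨a + 1, hc⟩) (he.trans
        (congrArg _ (Fin.ext h)))
      rw [Fin.lt_def] at hae heb
      obtain ⟨k, hk1, hk2, hk⟩ := ih _ (by dsimp only at *; omega) hce
        (by rw [Fin.lt_def]; dsimp only; omega) rfl
      rw [Fin.le_def] at hk1 hk2
      exact ⟨k, by rw [Fin.le_def]; dsimp only at *; omega, by rw [Fin.le_def]; omega, hk⟩

/-- There is a cap on two neighbouring bottom dots whose block in `J` consists only of these two
dots or contains a neighbouring bottom dot. -/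
def IsReducible (I J : SetPartition n) : Prop :=
  ∃ k : Fin (n - 1), I (Sum.inr (lo k)) (Sum.inr (hi k)) ∧
    ((∀ z, J (Sum.inr (lo k)) z → z = Sum.inr (lo k) ∨ z = Sum.inr (hi k)) ∨
      ∃ j : Fin (n - 1), |(k : ℤ) - (j : ℤ)| = 1 ∧ J (Sum.inr (lo j)) (Sum.inr (hi j)))

theorem isReducible_of_right {I J : SetPartition n} {k : Fin (n - 1)} {c : Fin n}
    (h : I (Sum.inr (lo k)) (Sum.inr (hi k))) (hc : (c : ℕ) = k + 2)
    (h' : J (Sum.inr (hi k)) (Sum.inr c)) : IsReducible I J := by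
  refine ⟨k, h, Or.inr ⟨⟨k + 1, by omega⟩, ?_, ?_⟩⟩
  · rw [abs_eq zero_le_one]; dsimp only; omega
  · rw [show c = hi ⟨k + 1, by omega⟩ from Fin.ext hc] at h'
    exact h'

theorem isReducible_of_left {I J : SetPartition n} {k : Fin (n - 1)} {c : Fin n}
    (h : I (Sum.inr (lo k)) (Sum.inr (hi k))) (hc : (c : ℕ) + 1 = k)
    (h' : J (Sum.inr c) (Sum.inr (lo k))) : IsReducible I J := by
  refine ⟨k, h, Or.inr ⟨⟨c, by omega⟩, ?_, ?_⟩⟩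
  · rw [abs_eq zero_le_one]; dsimp only; omega
  · rw [show lo k = hi ⟨c, by omega⟩ from Fin.ext hc.symm] at h'
    exact h'

/-- In an irreducible diagram the bottom dots of a block are consecutive: a gap would contain a cap
which can be reduced. -/
theorem bottom_convex {I J : SetPartition n} (hI : I.IsPlanar) (hI' : I.IsPairing)
    (hJ : J.IsPlanar) (hIJ : I ≤ J) (hred : ¬ IsReducible I J) {a b c : Fin n}
    (hab : J (Sum.inr a) (Sum.inr b)) (hac : a < c) (hcb : c < b) : J (Sum.inr a) (Sum.inr c) := by
  induction hd : (b : ℕ) - a using Nat.strong_induction_on generalizing a b c with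
  | _ d ih =>
    by_contra h
    obtain ⟨f, hf, hf', -⟩ := hI'.exists_partner
    have hcf : I (Sum.inr c) (f (Sum.inr c)) := (hf _ _).2 (Or.inr rfl)
    obtain ⟨e, he, hae, heb⟩ := hJ.mem_gap hab hac hcb h (hIJ hcf)
    have hec : e ≠ c := fun h => hf' _ (he.trans (congrArg _ h))
    rw [he] at hcf
    obtain ⟨k, hk, hak, hkb, hnk⟩ : ∃ k : Fin (n - 1), I (Sum.inr (lo k)) (Sum.inr (hi k)) ∧
        a < lo k ∧ hi k < b ∧ ¬ J (Sum.inr a) (Sum.inr (lo k)) := by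
      -- the cap below the arc through `c` cannot be joined to the block of `a`
      have key : ∀ x y : Fin n, I (Sum.inr x) (Sum.inr y) → x < y → a < x → y < b →
          ¬ J (Sum.inr a) (Sum.inr x) → ∃ k : Fin (n - 1), I (Sum.inr (lo k)) (Sum.inr (hi k)) ∧
            a < lo k ∧ hi k < b ∧ ¬ J (Sum.inr a) (Sum.inr (lo k)) := by
        intro x y hxy hlt hax hyb hnx
        obtain ⟨k, h1, h2, hk⟩ := exists_cap hI hI' hxy hlt
        refine ⟨k, hk, hax.trans_le h1, h2.trans_lt hyb, fun hak => ?_⟩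
        rcases h1.eq_or_lt with h1 | h1
        · exact hnx (h1 ▸ hak)
        · have hky : lo k < y := lt_of_lt_of_le (by rw [Fin.lt_def]; simp) h2
          by_cases hxk : J (Sum.inr x) (Sum.inr (lo k))
          · exact hnx (J.trans' hak (J.symm' hxk))
          · obtain ⟨d, hd, h3, -⟩ := hJ.mem_gap (hIJ hxy) h1 hky hxk (J.symm' hak)
            rw [Sum.inr.injEq] at hd
            exact absurd (hax.trans (hd ▸ h3)) (lt_irrefl _)
      rcases lt_or_gt_of_ne hec with hlt | hlt
      · exact key e c (I.symm' hcf) hlt hae hcb fun h' =>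
          h (J.trans' h' (J.symm' (hIJ hcf)))
      · exact key c e hcf hlt hac heb h
    have hlk : lo k < b := lt_trans (by rw [Fin.lt_def]; simp) hkb
    refine hred ⟨k, hk, Or.inl fun z hz => ?_⟩
    obtain ⟨d', rfl, had, hdb⟩ := hJ.mem_gap hab hak hlk hnk hz
    by_contra hne
    simp only [Sum.inr.injEq, Fin.ext_iff, lo_val, hi_val] at hne
    rw [Fin.lt_def] at had hdb hak hkb
    rw [lo_val] at hak
    rw [hi_val] at hkb
    rcases lt_or_ge (d' : ℕ) k with hlt | hge
    · have hk1 : (k : ℕ) - 1 < n := by omega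
      by_cases hadj : J (Sum.inr (⟨k - 1, hk1⟩ : Fin n)) (Sum.inr (lo k))
      · exact hred (isReducible_of_left hk (by dsimp only; omega) hadj)
      · by_cases hdk : (d' : ℕ) = k - 1
        · exact hadj (J.symm' ((show d' = ⟨k - 1, hk1⟩ from Fin.ext hdk) ▸ hz))
        · have := ih _ (by rw [← hd, lo_val]; omega) (J.symm' hz) (c := ⟨k - 1, hk1⟩)
            (by rw [Fin.lt_def]; dsimp only; omega) (by rw [Fin.lt_def, lo_val]; dsimp only; omega)
            rfl
          exact hadj (J.symm' (J.trans' hz this))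
    · have hk2 : (k : ℕ) + 2 < n := by omega
      have hz' := J.trans' (J.symm' (hIJ hk)) hz
      by_cases hadj : J (Sum.inr (hi k)) (Sum.inr (⟨k + 2, hk2⟩ : Fin n))
      · exact hred (isReducible_of_right hk rfl hadj)
      · by_cases hdk : (d' : ℕ) = k + 2
        · exact hadj ((show d' = ⟨k + 2, hk2⟩ from Fin.ext hdk) ▸ hz')
        · have := ih _ (by rw [← hd, hi_val]; omega) hz' (c := ⟨k + 2, hk2⟩)
            (by rw [Fin.lt_def, hi_val]; dsimp only; omega)
            (by rw [Fin.lt_def]; dsimp only; omega) rfl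
          exact hadj this

/-- In an irreducible diagram every arc between bottom dots joins two neighbours, which are the only
bottom dots of their block, and this block reaches the top row. -/
theorem cap_of_irreducible {I J : SetPartition n} (hI : I.IsPlanar) (hI' : I.IsPairing)
    (hJ : J.IsPlanar) (hIJ : I ≤ J) (hred : ¬ IsReducible I J) {a b : Fin n}
    (hab : I (Sum.inr a) (Sum.inr b)) (h : a < b) :
    (b : ℕ) = a + 1 ∧ (∀ c, J (Sum.inr a) (Sum.inr c) → c = a ∨ c = b) ∧
      ∃ y, J (Sum.inr a) (Sum.inl y) := by
  have convex := fun {a b c : Fin n} => bottom_convex hI hI' hJ hIJ hred (a := a) (b := b) (c := c)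
  obtain ⟨k, h1, h2, hk⟩ := exists_cap hI hI' hab h
  rw [Fin.le_def, lo_val] at h1
  rw [Fin.le_def, hi_val] at h2
  have hJab := hIJ hab
  have hmem : ∀ c : Fin n, a ≤ c → c ≤ b → J (Sum.inr a) (Sum.inr c) := by
    intro c hc1 hc2
    rcases hc1.eq_or_lt with rfl | hc1
    · exact J.refl' _
    · rcases hc2.eq_or_lt with rfl | hc2
      · exact hJab
      · exact convex hJab hc1 hc2
  have hka : (a : ℕ) = k := by
    by_contra hne
    have e1 := hmem ⟨k - 1, by omega⟩ (by rw [Fin.le_def]; dsimp only; omega)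
      (by rw [Fin.le_def]; dsimp only; omega)
    have e2 := hmem (lo k) (by rw [Fin.le_def, lo_val]; omega) (by rw [Fin.le_def, lo_val]; omega)
    exact hred (isReducible_of_left hk (by dsimp only; omega) (J.trans' (J.symm' e1) e2))
  have hkb : (b : ℕ) = k + 1 := by
    by_contra hne
    have e1 := hmem ⟨k + 2, by omega⟩ (by rw [Fin.le_def]; dsimp only; omega)
      (by rw [Fin.le_def]; dsimp only; omega)
    have e2 := hmem (hi k) (by rw [Fin.le_def, hi_val]; omega) (by rw [Fin.le_def, hi_val]; omega)
    exact hred (isReducible_of_right hk rfl (J.trans' (J.symm' e2) e1))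
  obtain rfl : a = lo k := Fin.ext hka
  obtain rfl : b = hi k := Fin.ext hkb
  have hbot : ∀ c, J (Sum.inr (lo k)) (Sum.inr c) → c = lo k ∨ c = hi k := by
    intro c hc
    by_contra hne
    simp only [Fin.ext_iff, lo_val, hi_val] at hne
    rcases lt_or_ge (c : ℕ) k with hlt | hge
    · by_cases hck : (c : ℕ) + 1 = k
      · exact hred (isReducible_of_left hk hck (J.symm' hc))
      · have := convex (J.symm' hc) (c := ⟨k - 1, by omega⟩)
          (by rw [Fin.lt_def]; dsimp only; omega) (by rw [Fin.lt_def, lo_val]; dsimp only; omega)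
        exact hred (isReducible_of_left hk (c := ⟨k - 1, by omega⟩) (by dsimp only; omega)
          (J.symm' (J.trans' hc this)))
    · have hc' := J.trans' (J.symm' hJab) hc
      by_cases hck : (c : ℕ) = k + 2
      · exact hred (isReducible_of_right hk hck hc')
      · have := convex hc' (c := ⟨k + 2, by omega⟩)
          (by rw [Fin.lt_def, hi_val]; dsimp only; omega) (by rw [Fin.lt_def]; dsimp only; omega)
        exact hred (isReducible_of_right hk (c := ⟨k + 2, by omega⟩) rfl this)
  refine ⟨rfl, hbot, ?_⟩
  by_contra hno
  refine hred ⟨k, hk, Or.inl fun z hz => ?_⟩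
  rcases z with z | z
  · exact absurd ⟨z, hz⟩ hno
  · exact (hbot z hz).imp (congrArg _) (congrArg _)

end SetPartition

namespace TiedTemperleyLieb

variable {n : ℕ}

/-! ### Generation -/

/-- The pair `(I, J)` belongs to the planar ramified Jones monoid, and its columns from number `s`
on are vertical lines. -/
structure IsAdmissible (s : ℕ) (I J : SetPartition n) : Prop where
  thin_planar : I.IsPlanar
  thin_pairing : I.IsPairing
  thick_planar : J.IsPlanar
  le : I ≤ J
  straight : ∀ j : Fin n, s ≤ j → J.IsStraightAt j

/-- The pair `(I, J)` is a product of the generators. -/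
def IsGenerated (I J : SetPartition n) : Prop := ∃ m, thin m = I ∧ thick m = J

theorem IsGenerated.mul {I J I' J' : SetPartition n} (h : IsGenerated I J)
    (h' : IsGenerated I' J') : IsGenerated (I * I') (J * J') := by
  obtain ⟨m, rfl, rfl⟩ := h
  obtain ⟨m', rfl, rfl⟩ := h'
  exact ⟨m * m', thin_mul _ _, thick_mul _ _⟩

theorem isGenerated_T (i : Fin (n - 1)) : IsGenerated (tangle i) (tangle i) := ⟨T i, rfl, rfl⟩

theorem isGenerated_E (i : Fin (n - 1)) : IsGenerated 1 (joiner i) := ⟨E i, rfl, rfl⟩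

theorem isGenerated_F (i : Fin (n - 1)) : IsGenerated (tangle i) (joiner i) := ⟨F i, rfl, rfl⟩

theorem isGenerated_mirror {I J : SetPartition n} (h : IsGenerated (mirror I) (mirror J)) :
    IsGenerated I J := by
  obtain ⟨m, h1, h2⟩ := h
  exact ⟨rev m, by rw [thin_rev, h1, mirror_mirror], by rw [thick_rev, h2, mirror_mirror]⟩

namespace IsAdmissible

variable {s : ℕ} {I J : SetPartition n}

theorem mirror (h : IsAdmissible s I J) :
    IsAdmissible s (SetPartition.mirror I) (SetPartition.mirror J) :=
  ⟨h.thin_planar.mirror, h.thin_pairing.mirror, h.thick_planar.mirror, mirror_mono h.le,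
    fun j hj => (h.straight j hj).mirror⟩

theorem thin_straight (h : IsAdmissible s I J) (j : Fin n) (hj : s ≤ j) : I.IsStraightAt j :=
  h.thin_pairing.isStraightAt h.le (h.straight j hj)

theorem mul_tangle (h : IsAdmissible s I J) {k : Fin (n - 1)} (hk : (k : ℕ) + 1 < s) :
    IsAdmissible s (I * tangle k) (J * tangle k) := by
  refine ⟨h.thin_planar.mul (tangle_isPlanar k), h.thin_pairing.mul (tangle_isPairing k),
    h.thick_planar.mul (tangle_isPlanar k), mul_mono h.le le_rfl, fun j hj =>
    (h.straight j hj).mul (tangle_isStraightAt ?_ ?_)⟩ <;>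
    · rintro rfl
      simp only [lo_val, hi_val] at hj
      omega

/-- Replacing the columns from number `s'` on by vertical lines. -/
theorem graft {s' : ℕ} (h : IsAdmissible s I J)
    (hI : ∀ x z : Dots n, (col x : ℕ) < s' → I x z → (col z : ℕ) < s') :
    IsAdmissible s' (SetPartition.graft s' id I) (SetPartition.graft s' id J) :=
  ⟨graft_isPlanar h.thin_planar fun _ _ _ _ => id,
    graft_isPairing h.thin_pairing (fun _ _ _ _ => id) fun x z hx hz => ⟨z, hI x z hx hz, rfl⟩,
    graft_isPlanar h.thick_planar fun _ _ _ _ => id, graft_mono h.le,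
    fun _ hj => graft_isStraightAt hj⟩

theorem bend {i : Fin (n - 1)} (h : IsAdmissible (i + 2) I J) (hI : I * tangle i = I) :
    IsAdmissible (i + 1) (SetPartition.graft (i + 1) (bend i) I)
      (SetPartition.graft (i + 1) (SetPartition.bend i) J) := by
  refine ⟨graft_isPlanar h.thin_planar bend_pos_lt, graft_isPairing h.thin_pairing bend_inj
    fun x z hx hz => ?_, graft_isPlanar h.thick_planar bend_pos_lt, graft_mono h.le,
    fun _ hj => graft_isStraightAt hj⟩
  have hb : ¬ (SetPartition.bend i x = Sum.inr (lo i) ∨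
      SetPartition.bend i x = Sum.inr (hi i)) := by
    unfold SetPartition.bend
    split_ifs with hx'
    · simp
    · rintro (h' | h')
      · exact hx' h'
      · rw [h', col_inr, hi_val] at hx; omega
  have hbc : (col (SetPartition.bend i x) : ℕ) ≤ i + 1 := by
    unfold SetPartition.bend
    split_ifs
    · simp
    · omega
  refine exists_bend_eq ?_ (by rwa [mem_pair_eq_of_mul_tangle hI hz] at hb)
  by_contra hz'
  have := straight_apply (h.thin_straight _ (by omega)) rfl (I.symm' hz)
  rw [this] at hbc
  omega

end IsAdmissible

/-- A pair which ends in the tangle `k` is generated if all pairs with one more straight column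
are: the last column can be bent down once the tangle has been moved there. -/
theorem isGenerated_of_mul_tangle {s : ℕ}
    (ih : ∀ I J : SetPartition n, IsAdmissible (s + 1) I J → IsGenerated I J)
    {I J : SetPartition n} (h : IsAdmissible (s + 2) I J) {k : Fin (n - 1)} (hk : (k : ℕ) ≤ s)
    (hs : s < n - 1) (hI : I * tangle k = I) (hJ : J * tangle k = J) : IsGenerated I J := by
  obtain ⟨d, hd⟩ : ∃ d, s = k + d := ⟨s - k, by omega⟩
  induction d generalizing k I J with
  | zero =>
    obtain rfl : s = k := hd
    rw [← graft_bend_mul_tangle hI fun j hj => h.thin_straight j hj,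
      ← graft_bend_mul_tangle hJ h.straight]
    exact (ih _ _ (h.bend hI)).mul (isGenerated_T k)
  | succ d ihd =>
    let l : Fin (n - 1) := ⟨k + 1, by omega⟩
    have hkl : |(k : ℤ) - (l : ℤ)| = 1 := by rw [abs_eq zero_le_one]; dsimp only [l]; omega
    have hl : (l : ℕ) ≤ s := by dsimp only [l]; omega
    have := ihd (h.mul_tangle (k := l) (by omega)) hl (by rw [mul_assoc, tangle_mul_self])
      (by rw [mul_assoc, tangle_mul_self]) (by dsimp only [l]; omega)
    have key : ∀ K : SetPartition n, K * tangle k = K → K * tangle l * tangle k = K := by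
      intro K hK
      conv_lhs => rw [← hK]
      rw [mul_assoc K, mul_assoc K, tangle_mul_tangle_mul_tangle hkl, hK]
    rw [← key I hI, ← key J hJ]
    exact this.mul (isGenerated_T k)

/-- A reducible cap provides a factor `τ`. -/
theorem isGenerated_of_isReducible {s : ℕ} (hs : s < n)
    (ih : ∀ I J : SetPartition n, IsAdmissible s I J → IsGenerated I J)
    {I J : SetPartition n} (h : IsAdmissible (s + 1) I J) (hred : IsReducible I J) :
    IsGenerated I J := by
  obtain ⟨k, hk, hred⟩ := hred
  have hks : (k : ℕ) < s := by
    by_contra hks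
    have := straight_apply (h.thin_straight (hi k) (by rw [hi_val]; omega)) rfl (I.symm' hk)
    exact lo_ne_hi k this
  obtain ⟨r, rfl⟩ : ∃ r, s = r + 1 := ⟨s - 1, by omega⟩
  have hI : I * tangle k = I := by
    refine mul_tangle_eq_self hk fun z hz => ?_
    by_cases hz' : z = Sum.inr (lo k)
    · exact Or.inl hz'
    · exact Or.inr (h.thin_pairing.eq_of_apply hz hk hz' (by simpa using (lo_ne_hi k).symm))
  rcases hred with hred | ⟨j, hkj, hj⟩
  · exact isGenerated_of_mul_tangle ih h
      (by omega) (by omega) hI (mul_tangle_eq_self (h.le hk) hred)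
  · -- `φ_k ε_j = ε_j τ_k ε_j` produces a factor `τ_k`
    have hJk := mul_joiner_eq_self (h.le hk)
    have hJj := mul_joiner_eq_self hj
    have h1 : IsAdmissible (r + 2) I (J * tangle k) := by
      have := h.mul_tangle (k := k) (by omega)
      rwa [hI] at this
    have h2 := isGenerated_of_mul_tangle ih h1 (k := k) (by omega) (by omega) hI
      (by rw [mul_assoc, tangle_mul_self])
    have h3 := h2.mul (isGenerated_E j)
    have e : J * tangle k * joiner j = J := by
      conv_lhs => rw [← hJj]
      rw [mul_assoc J, mul_assoc J, joiner_mul_tangle_mul_joiner hkj, ← mul_assoc, hJj, hJk]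
    rwa [mul_one, e] at h3

/-- A diagram whose column `c` is joined to its left neighbour is obtained from the diagram in which
column `c` is cut off by joining the two columns again. -/
theorem graft_mul_joiner {J : SetPartition n} {c : Fin n} {i : Fin (n - 1)} (hi' : hi i = c)
    (hs : ∀ j : Fin n, (c : ℕ) + 1 ≤ j → J.IsStraightAt j)
    (hc : J (Sum.inl c) (Sum.inr c)) (h : J (Sum.inr (lo i)) (Sum.inr (hi i))) :
    graft c id J * joiner i = J := by
  refine ext_ker fun a b => ?_
  rw [mul_joiner_le_ker, graft_le_ker]
  have hlo : (lo i : ℕ) < c := by rw [← hi']; simp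
  constructor
  · rintro ⟨h1, h2, h3⟩
    -- a dot of column `c` may be replaced by the bottom dot to the left of this column
    have key : ∀ x : Dots n, ¬ (c : ℕ) + 1 ≤ col x → ∃ x' : Dots n, (col x' : ℕ) < c ∧ J x x' ∧
        Sum.elim a b x = Sum.elim a b x' := by
      intro x hx
      by_cases hxc : (col x : ℕ) < c
      · exact ⟨x, hxc, J.refl' x, rfl⟩
      · have hxc' : col x = c := Fin.ext (by omega)
        refine ⟨Sum.inr (lo i), hlo, ?_⟩
        have hac : a c = b c := h3 c le_rfl
        rw [hi'] at h h1
        rcases x with x | x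
        · obtain rfl : x = c := hxc'
          exact ⟨J.trans' hc (J.symm' h), hac.trans h1.symm⟩
        · obtain rfl : x = c := hxc'
          exact ⟨J.symm' h, h1.symm⟩
    intro x y hxy
    show Sum.elim a b x = Sum.elim a b y
    by_cases hx : (c : ℕ) + 1 ≤ col x
    · have hy := straight_apply (hs _ hx) rfl hxy
      have e := h3 (col x) (by omega)
      rcases x with x | x <;> rcases y with y | y <;> (obtain rfl : y = x := hy)
      · rfl
      · exact e
      · exact e.symm
      · rfl
    · have hy : ¬ (c : ℕ) + 1 ≤ col y := fun hy => hx
        (by rw [straight_apply (hs _ hy) rfl (J.symm' hxy)]; exact hy)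
      obtain ⟨x', hx', hxx, ex⟩ := key x hx
      obtain ⟨y', hy', hyy, ey⟩ := key y hy
      rw [ex, ey]
      exact h2 x' y' hx' hy' (J.trans' (J.symm' hxx) (J.trans' hxy hyy))
  · intro hab
    refine ⟨hab h, fun x y _ _ hxy => hab hxy, fun j hj => ?_⟩
    rcases hj.eq_or_lt with hj | hj
    · rw [← Fin.ext hj]; exact hab hc
    · exact (hs j hj).eq_of_le_ker hab

/-- The case in which the last relevant column is a vertical line of `I` which `J` joins to its
neighbour: a factor `ε` can be split off. -/
theorem isGenerated_of_joined {c : Fin n}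
    (ih : ∀ I J : SetPartition n, IsAdmissible c I J → IsGenerated I J)
    {I J : SetPartition n} (h : IsAdmissible (c + 1) I J) (hc : I (Sum.inl c) (Sum.inr c))
    {i : Fin (n - 1)} (hi' : hi i = c) (hj : J (Sum.inr (lo i)) (Sum.inr (hi i))) :
    IsGenerated I J := by
  have hIc : I.IsStraightAt c := by
    refine ⟨hc, fun x y hxy => ?_⟩
    obtain ⟨f, hf, -, hff⟩ := h.thin_pairing.exists_partner
    have e : f (Sum.inl c) = Sum.inr c := (((hf _ _).1 hc).resolve_left (by simp)).symm
    have e' : f (Sum.inr c) = Sum.inl c := by rw [← e, hff]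
    have key : ∀ x y : Dots n, I x y → Sum.elim (· = c) (· = c) x → Sum.elim (· = c) (· = c) y := by
      intro x y hxy hx
      rcases x with x | x <;> (obtain rfl : x = c := hx) <;> rcases (hf _ _).1 hxy with rfl | rfl
      · rfl
      · rw [e]; rfl
      · rfl
      · rw [e']; rfl
    exact propext ⟨key x y hxy, key y x (I.symm' hxy)⟩
  have hIs : ∀ j : Fin n, (c : ℕ) ≤ j → I.IsStraightAt j := by
    intro j hj
    rcases hj.eq_or_lt with hj | hj
    · rwa [← Fin.ext hj]
    · exact h.thin_straight j hj
  have hI : graft c id I = I := by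
    refine ext_ker fun a b => ?_
    rw [graft_le_ker]
    constructor
    · rintro ⟨h2, h3⟩ x y hxy
      show Sum.elim a b x = Sum.elim a b y
      by_cases hx : (c : ℕ) ≤ col x
      · have hy := straight_apply (hIs _ hx) rfl hxy
        have e := h3 (col x) (by omega)
        rcases x with x | x <;> rcases y with y | y <;> (obtain rfl : y = x := hy)
        · rfl
        · exact e
        · exact e.symm
        · rfl
      · have hy : ¬ (c : ℕ) ≤ col y := fun hy => hx
          (by rw [straight_apply (hIs _ hy) rfl (I.symm' hxy)]; exact hy)
        exact h2 x y (by omega) (by omega) hxy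
    · exact fun hab => ⟨fun x y _ _ hxy => hab hxy, fun j hj => (hIs j hj).eq_of_le_ker hab⟩
  have h1 := h.graft (s' := c) fun x z hx hxz => by
    by_contra hz
    have := straight_apply (hIs _ (not_lt.1 hz)) rfl (I.symm' hxz)
    rw [this] at hx
    exact hz hx
  have h2 := (ih _ _ h1).mul (isGenerated_E i)
  rwa [hI, mul_one, graft_mul_joiner hi' h.straight (h.le hc) hj] at h2

/-- The case in which the last two relevant columns consist of a cup and a cap which `J` joins to each
other and to nothing else: a factor `φ` can be split off. -/
theorem isGenerated_of_cup_cap {i : Fin (n - 1)}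
    (ih : ∀ I J : SetPartition n, IsAdmissible i I J → IsGenerated I J)
    {I J : SetPartition n} (h : IsAdmissible (i + 2) I J)
    (h1 : I (Sum.inl (lo i)) (Sum.inl (hi i))) (h2 : I (Sum.inr (lo i)) (Sum.inr (hi i)))
    (hJ : J (Sum.inl (lo i)) (Sum.inr (lo i)))
    (hJt : ∀ y, J (Sum.inl (lo i)) (Sum.inl y) → y = lo i ∨ y = hi i)
    (hJb : ∀ y, J (Sum.inr (lo i)) (Sum.inr y) → y = lo i ∨ y = hi i) : IsGenerated I J := by
  have hsmall : ∀ x z : Dots n, (col x : ℕ) < i → J x z → (col z : ℕ) < i := by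
    intro x z hx hxz
    by_contra hz
    have key : ∀ w : Dots n, J (Sum.inl (lo i)) w → ¬ (col w : ℕ) < i := by
      rintro (w | w) hw
      · rcases hJt w hw with rfl | rfl <;> simp
      · rcases hJb w (J.trans' (J.symm' hJ) hw) with rfl | rfl <;> simp
    by_cases hz' : (i : ℕ) + 2 ≤ col z
    · have := straight_apply (h.straight _ hz') rfl (J.symm' hxz)
      rw [this] at hx; omega
    · have hzi : J (Sum.inl (lo i)) z := by
        have e : col z = lo i ∨ col z = hi i := by
          simp only [Fin.ext_iff, lo_val, hi_val]; omega
        rcases z with z | z <;> rcases e with e | e <;>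
          simp only [col_inl, col_inr] at e <;> subst e
        · exact J.refl' _
        · exact h.le h1
        · exact hJ
        · exact J.trans' hJ (h.le h2)
      exact key x (J.trans' hzi (J.symm' hxz)) hx
  have hgen := (ih _ _ (h.graft (s' := i) fun x z hx hxz => hsmall x z hx (h.le hxz))).mul
    (isGenerated_F i)
  have hcases : ∀ x : Dots n, (col x : ℕ) < i ∨ (col x = lo i ∨ col x = hi i) ∨
      (i : ℕ) + 2 ≤ col x := by
    intro x
    simp only [Fin.ext_iff, lo_val, hi_val]
    omega
  have hmid : ∀ x y : Dots n, (col x = lo i ∨ col x = hi i) → J x y →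
      (col y = lo i ∨ col y = hi i) := by
    intro x y hx hxy
    simp only [Fin.ext_iff, lo_val, hi_val] at hx
    rcases hcases y with hy | hy | hy
    · have := hsmall y x hy (J.symm' hxy)
      omega
    · exact hy
    · have := straight_apply (h.straight _ hy) rfl (J.symm' hxy)
      rw [← this] at hy
      omega
  have hbig : ∀ {a b : Fin n → Prop}, (∀ j : Fin n, (i : ℕ) + 2 ≤ j → a j = b j) →
      ∀ x y : Dots n, (i : ℕ) + 2 ≤ col x → J x y → Sum.elim a b x = Sum.elim a b y := by
    intro a b hab x y hx hxy
    have hy := straight_apply (h.straight _ hx) rfl hxy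
    have e := hab _ hx
    rcases x with x | x <;> rcases y with y | y <;> (obtain rfl : y = x := hy)
    · rfl
    · exact e
    · exact e.symm
    · rfl
  have eJ : graft i id J * joiner i = J := by
    refine ext_ker fun a b => ?_
    rw [mul_joiner_le_ker, graft_le_ker]
    constructor
    · rintro ⟨hb, k1, k2⟩ x y hxy
      show Sum.elim a b x = Sum.elim a b y
      rcases hcases x with hx | hx | hx
      · exact k1 x y hx (hsmall x y hx hxy) hxy
      · have hy := hmid x y hx hxy
        have key : ∀ z : Dots n, (col z = lo i ∨ col z = hi i) → Sum.elim a b z = b (lo i) := by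
          rintro (z | z) (hz | hz) <;> simp only [col_inl, col_inr] at hz <;> subst hz
          · exact k2 _ (by simp)
          · exact (k2 _ (by simp)).trans hb.symm
          · rfl
          · exact hb.symm
        rw [key x hx, key y hy]
      · exact hbig (fun j hj => k2 j (by omega)) x y hx hxy
    · intro hab
      refine ⟨hab (h.le h2), fun x y _ _ hxy => hab hxy, fun j hj => ?_⟩
      rcases hcases (Sum.inl j) with hj' | (rfl | rfl) | hj'
      · exact absurd hj' (not_lt.2 hj)
      · exact hab hJ
      · exact hab (J.trans' (J.symm' (h.le h1)) (J.trans' hJ (h.le h2)))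
      · exact (h.straight j hj').eq_of_le_ker hab
  have hr : ∀ (b : Fin n → Prop) (v : Prop) (j : Fin n), ((j : ℕ) < i ∨ (i : ℕ) + 2 ≤ j) →
      recolour b i v j = b j := fun b v j hj =>
    recolour_of_ne _ _ (fun e => by rw [e, lo_val] at hj; omega)
      (fun e => by rw [e, hi_val] at hj; omega)
  have hr' : ∀ (a b : Fin n → Prop) (v : Prop) (x : Dots n), (col x : ℕ) < i →
      Sum.elim a (recolour b i v) x = Sum.elim a b x := by
    rintro a b v (x | x) hx
    · rfl
    · exact hr b v x (Or.inl hx)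
  have eI : graft i id I * tangle i = I := by
    refine ext_ker fun a b => ?_
    rw [mul_tangle_le_ker]
    constructor
    · rintro ⟨hb, v, hv⟩ x y hxy
      obtain ⟨k1, k2⟩ := graft_le_ker.1 hv
      have ea : a (lo i) = a (hi i) := by
        rw [k2 (lo i) (by simp), k2 (hi i) (by simp), recolour_lo, recolour_hi]
      show Sum.elim a b x = Sum.elim a b y
      rcases hcases x with hx | hx | hx
      · have hy := hsmall x y hx (h.le hxy)
        rw [← hr' a b v x hx, ← hr' a b v y hy]
        exact k1 x y hx hy hxy
      · by_cases hyx : y = x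
        · rw [hyx]
        · have hne : hi i ≠ lo i := (lo_ne_hi i).symm
          have uniq := fun {z : Dots n} (hz : I x z) (hzx : z ≠ x) =>
            h.thin_pairing.eq_of_apply hxy hz hyx hzx
          rcases x with x | x <;> rcases hx with hx | hx <;>
            simp only [col_inl, col_inr] at hx <;> subst hx
          · rw [uniq h1 (by simpa using hne)]; exact ea
          · rw [uniq (I.symm' h1) (by simpa using hne.symm)]; exact ea.symm
          · rw [uniq h2 (by simpa using hne)]; exact hb
          · rw [uniq (I.symm' h2) (by simpa using hne.symm)]; exact hb.symm
      · refine hbig (fun j hj => ?_) x y hx (h.le hxy)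
        rw [k2 j (by omega), hr b v j (Or.inr hj)]
    · intro hab
      refine ⟨hab h2, a (lo i), graft_le_ker.2 ⟨fun x y hx hy hxy => ?_, fun j hj => ?_⟩⟩
      · rw [hr' a b _ x hx, hr' a b _ y hy]
        exact hab hxy
      · rcases hcases (Sum.inl j) with hj' | (rfl | rfl) | hj'
        · exact absurd hj' (not_lt.2 hj)
        · rw [recolour_lo]
        · rw [recolour_hi]; exact (hab h1).symm
        · rw [hr b _ j (Or.inr hj')]
          exact (h.thin_straight j hj').eq_of_le_ker hab
  rwa [eI, eJ] at hgen

/-- In an irreducible diagram, the last relevant bottom dot cannot lie on a through strand while the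
last relevant top dot lies on a cup. -/
theorem not_cup_of_through {I J : SetPartition n} (hI : I.IsPlanar) (hI' : I.IsPairing)
    (hJ : J.IsPlanar) (hIJ : I ≤ J) (hred : ¬ IsReducible (mirror I) (mirror J)) {c d e : Fin n}
    (hs : ∀ j : Fin n, c < j → J.IsStraightAt j)
    (hcd : I (Sum.inr c) (Sum.inl d)) (hdc : d < c) (hce : I (Sum.inl c) (Sum.inl e))
    (hec : e < c) : False := by
  obtain ⟨h1, h2, y, hy⟩ := cap_of_irreducible hI.mirror hI'.mirror hJ.mirror (mirror_mono hIJ)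
    hred (I.symm' hce) hec
  have hy : J (Sum.inl e) (Sum.inr y) := hy
  have hyc : y ≤ c := by
    by_contra hyc
    have := straight_apply (hs y (not_le.1 hyc)) rfl (J.symm' hy)
    exact absurd (hec.trans (not_le.1 hyc)) (by rw [← this]; simp)
  have hey := J.trans' (hIJ hce) hy
  have hdJ : J (Sum.inl c) (Sum.inl d) := by
    rcases hyc.eq_or_lt with rfl | hyc
    · exact J.trans' hey (hIJ hcd)
    · refine J.symm' (hJ (Sum.inl d) (Sum.inl c) (Sum.inr c) (Sum.inr y) ?_ ?_ ?_
        (J.symm' (hIJ hcd)) hey) <;> simp only [pos] <;> rw [Fin.lt_def] at * <;> omega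
  rcases h2 d (J.trans' (J.symm' (hIJ hce)) hdJ) with rfl | rfl
  · have := hI'.eq_of_apply (I.symm' hce) (I.symm' hcd) (by simpa using hec.ne') (by simp)
    simp at this
  · exact lt_irrefl _ hdc

/-- The planar ramified Jones monoid is generated by the `t_i`, `e_i` and `f_i`, by induction on the
number `s` of columns which may differ from vertical lines. -/
theorem isGenerated_of_isAdmissible {s : ℕ} (hs : s ≤ n) {I J : SetPartition n}
    (h : IsAdmissible s I J) : IsGenerated I J := by
  induction s using Nat.strong_induction_on generalizing I J with
  | _ s ih =>
    rcases s with _ | s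
    · have key : ∀ K : SetPartition n, (∀ j, K.IsStraightAt j) → K = 1 := by
        intro K hK
        refine ext_ker fun a b => ?_
        rw [one_le_ker]
        constructor
        · exact fun hab => funext fun j => (hK j).eq_of_le_ker hab
        · rintro rfl x y hxy
          have := straight_apply (hK (col x)) rfl hxy
          rcases x with x | x <;> rcases y with y | y <;> (obtain rfl : y = x := this) <;> rfl
      rw [key I fun j => h.thin_straight j (Nat.zero_le _),
        key J fun j => h.straight j (Nat.zero_le _)]
      exact ⟨1, thin_one, thick_one⟩
    · have ih' : ∀ I J : SetPartition n, IsAdmissible s I J → IsGenerated I J :=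
        fun I J h => ih s (by omega) (by omega) h
      by_cases hb : IsReducible I J
      · exact isGenerated_of_isReducible hs ih' h hb
      by_cases ht : IsReducible (mirror I) (mirror J)
      · exact isGenerated_mirror (isGenerated_of_isReducible hs ih' h.mirror ht)
      let c : Fin n := ⟨s, hs⟩
      have hstr : ∀ j : Fin n, c < j → J.IsStraightAt j := fun j hj => h.straight j hj
      have hle : ∀ x y : Dots n, col x = c → I x y → col y ≤ c := by
        intro x y hx hxy
        by_contra hy
        have := straight_apply (hstr _ (not_le.1 hy)) rfl (J.symm' (h.le hxy))
        exact hy (by rw [← this, hx])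
      obtain ⟨f, hf, hf', -⟩ := h.thin_pairing.exists_partner
      have hbot : I (Sum.inr c) (f (Sum.inr c)) := (hf _ _).2 (Or.inr rfl)
      have htop : I (Sum.inl c) (f (Sum.inl c)) := (hf _ _).2 (Or.inr rfl)
      have hbne := hf' (Sum.inr c)
      have htne := hf' (Sum.inl c)
      have hble := hle _ _ rfl hbot
      have htle := hle _ _ rfl htop
      rcases hfb : f (Sum.inr c) with d | d <;> rw [hfb] at hbot hbne hble <;>
        simp only [col_inl, col_inr] at hble
      · rcases hble.eq_or_lt with rfl | hdc
        · -- the last column is a vertical line of the pairing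
          have hc := I.symm' hbot
          by_cases hJc : J.IsStraightAt c
          · refine ih' I J ⟨h.thin_planar, h.thin_pairing, h.thick_planar, h.le, fun j hj => ?_⟩
            rcases hj.eq_or_lt with hj | hj
            · rwa [← (Fin.ext hj : c = j)]
            · exact h.straight j hj
          · obtain ⟨y, hy, hyc⟩ : ∃ y : Dots n, J (Sum.inr c) y ∧ col y ≠ c := by
              by_contra! hno
              have hno' : ∀ x y : Dots n, J x y → col x = c → col y = c := by
                intro x y hxy hx
                refine hno y (J.trans' ?_ hxy)
                rcases x with x | x <;> (obtain rfl : x = c := hx)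
                · exact J.symm' (h.le hc)
                · exact J.refl' _
              refine hJc ⟨h.le hc, fun x y hxy => ?_⟩
              have key : ∀ z : Dots n, Sum.elim (· = c) (· = c) z = (col z = c) := by
                rintro (z | z) <;> rfl
              show Sum.elim (· = c) (· = c) x = Sum.elim (· = c) (· = c) y
              rw [key, key]
              exact propext ⟨hno' x y hxy, hno' y x (J.symm' hxy)⟩
            have hyc' : col y < c := by
              refine lt_of_le_of_ne ?_ hyc
              by_contra hy'
              exact absurd (straight_apply (hstr _ (not_le.1 hy')) rfl (J.symm' hy)).ge hy'
            have hc0 : s - 1 < n - 1 := by rw [Fin.lt_def] at hyc'; dsimp only [c] at hyc'; omega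
            have hic : hi (⟨s - 1, hc0⟩ : Fin (n - 1)) = c := by
              rw [Fin.lt_def] at hyc'
              exact Fin.ext (by rw [hi_val]; dsimp only [c] at *; omega)
            -- the column is joined to its neighbour in the top or in the bottom row
            have key : ∀ {I J : SetPartition n}, IsAdmissible (s + 1) I J → ¬ IsReducible I J →
                I (Sum.inl c) (Sum.inr c) → ∀ z, z < c → J (Sum.inr c) (Sum.inr z) →
                IsGenerated I J := by
              intro I J h hb hc z hzc hz
              refine isGenerated_of_joined (c := c) ih' h hc hic ?_
              rw [hic]
              have hz' := J.symm' hz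
              by_cases hze : z = lo ⟨s - 1, hc0⟩
              · rw [← hze]; exact hz'
              · have hlt : lo (⟨s - 1, hc0⟩ : Fin (n - 1)) < c := by
                  rw [← hic, Fin.lt_def]; simp
                have hzlt : z < lo (⟨s - 1, hc0⟩ : Fin (n - 1)) := by
                  refine lt_of_le_of_ne ?_ hze
                  rw [Fin.lt_def] at hzc
                  rw [Fin.le_def, lo_val]
                  dsimp only [c] at *; omega
                exact J.trans' (J.symm' (bottom_convex h.thin_planar h.thin_pairing
                  h.thick_planar h.le hb hz' hzlt hlt)) hz'
            rcases y with y | y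
            · exact isGenerated_mirror (key h.mirror ht (I.symm' hc) y hyc'
                (J.trans' (h.le hc) hy))
            · exact key h hb hc y hyc' hy
        · exfalso
          rcases hft : f (Sum.inl c) with e | e <;> rw [hft] at htop htne htle <;>
            simp only [col_inl, col_inr] at htle
          · exact not_cup_of_through h.thin_planar h.thin_pairing h.thick_planar h.le ht hstr hbot
              hdc htop (lt_of_le_of_ne htle fun e => htne (congrArg _ e))
          · -- two through strands would cross
            have hec : e < c := by
              refine lt_of_le_of_ne htle ?_
              rintro rfl
              have := h.thin_pairing.eq_of_apply hbot (I.symm' htop) (by simp) (by simp)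
              simp only [Sum.inl.injEq] at this
              exact hdc.ne this
            have hx : I (Sum.inl d) (Sum.inl c) := by
              refine h.thin_planar _ _ (Sum.inr c) (Sum.inr e) ?_ ?_ ?_ (I.symm' hbot) htop <;>
                simp only [pos] <;> rw [Fin.lt_def] at * <;> omega
            have := h.thin_pairing.eq_of_apply hx (I.symm' hbot) (by simpa using hdc.ne') (by simp)
            simp at this
      · have hdc : d < c := lt_of_le_of_ne hble fun e => hbne (congrArg _ e)
        rcases hft : f (Sum.inl c) with e | e <;> rw [hft] at htop htne htle <;>
          simp only [col_inl, col_inr] at htle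
        · have hec : e < c := lt_of_le_of_ne htle fun e => htne (congrArg _ e)
          obtain ⟨h1, h2, y, hy⟩ := cap_of_irreducible h.thin_planar h.thin_pairing h.thick_planar
            h.le hb (I.symm' hbot) hdc
          obtain ⟨k1, k2, z, hz⟩ := cap_of_irreducible h.mirror.thin_planar h.mirror.thin_pairing
            h.mirror.thick_planar h.mirror.le ht (I.symm' htop) hec
          have hz : J (Sum.inl e) (Sum.inr z) := hz
          dsimp only [c] at h1 k1
          have hsn : (d : ℕ) < n - 1 := by omega
          obtain ⟨i, hi1⟩ : ∃ i : Fin (n - 1), lo i = d := ⟨⟨d, hsn⟩, rfl⟩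
          have hi2 : hi i = c := Fin.ext (by rw [hi_val, ← lo_val, hi1]; exact h1.symm)
          have hde : e = d := Fin.ext (by omega)
          subst hde
          subst hi1
          rw [← hi2] at htop hbot
          have his : s = i + 1 := by rw [lo_val] at h1; exact h1
          subst his
          have hbend : J (Sum.inl (hi i)) (Sum.inr (hi i)) := by
            have a1 : J (Sum.inl y) (Sum.inr (hi i)) := J.symm' (J.trans' (h.le hbot) hy)
            have a2 : J (Sum.inl (hi i)) (Sum.inr z) := J.trans' (h.le htop) hz
            have hyle : y ≤ hi i := by
              by_contra hlt
              have e := straight_apply (hstr y (by rw [← hi2]; exact not_le.1 hlt)) rfl a1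
              exact hlt (by rw [← e]; exact le_rfl)
            have hzle : z ≤ hi i := by
              by_contra hlt
              have e := straight_apply (hstr z (by rw [← hi2]; exact not_le.1 hlt)) rfl (J.symm' a2)
              exact hlt (by rw [← e]; exact le_rfl)
            rcases hyle.eq_or_lt with rfl | hyle
            · exact a1
            · rcases hzle.eq_or_lt with rfl | hzle
              · exact a2
              · have := h.thick_planar (Sum.inl y) (Sum.inl (hi i)) (Sum.inr (hi i)) (Sum.inr z)
                  (by simp only [pos]; rw [Fin.lt_def] at *; omega)
                  (by simp only [pos]; omega)
                  (by simp only [pos]; rw [Fin.lt_def] at *; omega) a1 a2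
                exact J.trans' (J.symm' this) a1
          rw [← hi2] at h2 k2
          exact isGenerated_of_cup_cap (fun I J h => ih i (by omega) (by omega) h) h
            (I.symm' htop) (I.symm' hbot)
            (J.trans' (J.symm' (h.le htop)) (J.trans' hbend (h.le hbot))) k2 h2
        · exfalso
          have hec : e < c := by
            refine lt_of_le_of_ne htle ?_
            rintro rfl
            have := h.thin_pairing.eq_of_apply hbot (I.symm' htop) (by simpa using hdc.ne) (by simp)
            simp at this
          have hbr : ¬ IsReducible (mirror (mirror I)) (mirror (mirror J)) := by
            rwa [mirror_mirror, mirror_mirror]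
          exact not_cup_of_through h.mirror.thin_planar h.mirror.thin_pairing h.mirror.thick_planar
            h.mirror.le hbr (fun j hj => (hstr j hj).mirror) (c := c) (d := e) (e := d) htop hec
            hbot hdc

theorem eval_surjective (n : ℕ) : Function.Surjective (eval n) := by
  rintro ⟨⟨I, J⟩, ⟨h1, h2⟩, h3, h4⟩
  obtain ⟨m, hI, hJ⟩ := isGenerated_of_isAdmissible le_rfl
    (⟨h1, h2, h3, h4, fun j hj => absurd j.2 (by omega)⟩ : IsAdmissible n I J)
  exact ⟨m, Subtype.ext (Prod.ext hI hJ)⟩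

end TiedTemperleyLieb

/-! ### The presentation -/

/-- For `n ≠ 2`, the planar ramified Jones monoid is isomorphic to the tied Temperley-Lieb monoid,
and it is presented by the generators `t_i`, `e_i`, `f_i` subject to the tied Temperley-Lieb
relations. -/
theorem mainTheorem4 (n : ℕ) (hn : n ≠ 2) :
    Nonempty (planarRamifiedMonoid (jonesMonoid n) ≃* TiedTemperleyLieb n) ∧
      IsPresentedBy (ramifiedGenerator (n := n)) (TiedRelation n) := by
  have hinj : Function.Injective (TiedTemperleyLieb.eval n) := by
    by_cases h : 3 ≤ n
    · exact TiedTemperleyLieb.eval_injective h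
    · -- for `n ≤ 1` there are no generators
      have h1 : ∀ m : TiedTemperleyLieb n, m = 1 := fun m => by
        have := TiedTemperleyLieb.tower_top (n := n) ▸ Submonoid.mem_top m
        rwa [show n - 1 = 0 by omega, TiedTemperleyLieb.tower_zero, Submonoid.mem_bot] at this
      intro a b _
      rw [h1 a, h1 b]
  have hsurj := TiedTemperleyLieb.eval_surjective n
  refine ⟨⟨(MulEquiv.ofBijective _ ⟨hinj, hsurj⟩).symm⟩, fun p => ?_, ?_⟩
  · obtain ⟨m, rfl⟩ := hsurj p
    obtain ⟨w, rfl⟩ := PresentedMonoid.surjective_mk m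
    exact ⟨w, rfl⟩
  · refine le_antisymm (fun a b h => ?_)
      (Con.conGen_le.2 fun _ _ h => TiedTemperleyLieb.ramifiedGenerator_rel h)
    exact PresentedMonoid.mk_eq_mk_iff.1 (hinj h)
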